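/- Let $R$ be a principal ideal domain (for example a field), let $n\ge 0$, and let $\mathcal C$ be an ordinary $R$-linear $n$-category based on a system of fields (for example, string diagrams for a traditional $n$-category). That is, we are given: * sets of fields on all compact topological $k$-manifolds (possibly with boundary), $k\le n$, with restriction to unions of components and to boundaries, an action of homeomorphisms, and gluing. A field on a finite disjoint union is the same as a field on each part. A field on $M$ can be glued along disjoint codimension-0 submanifolds $Y,Y'\subset\partial M$ exactly if its boundary restriction splits along $\partial M=Y\cup Y'\cup V$, where $V=\overline{\partial M\setminus(Y\cup Y')}$, and the two restrictions to $Y$ and $Y'$ agree under the gluing. Gluing is then unique, injective, strictly associative, natural with respect to homeomorphisms, and compatible with disjoint unions and boundary restriction; * for each $n$-ball $B$, a submodule of the $R$-linear combinations of fields on $B$, those which "evaluate to zero". These submodules are invariant under homeomorphisms, they contain $h^*f-f$ for $h$ isotopic to the identity rel $\partial B$, and gluing a linear combination with fixed boundary restriction that evaluates to zero to a field yields, on any larger ball, again a linear combination with fixed boundary restriction that evaluates to zero. A *null field* on $B$ is a linear combination of fields on $B$, all with the same restriction to $\partial B$, which evaluates to zero. Let $W$ be a compact $n$-manifold. A *ball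 decomposition* of $W$ is a finite sequence of gluings $M_0\to M_1\to\dots\to M_m\cong W$, each gluing a manifold to itself along disjoint codimension-0 submanifolds of its boundary, with $M_0=\bigsqcup_a X_a$ a finite disjoint union of balls. A $k$-*blob diagram* on $W$ consists of a collection of $k$ distinct balls (blobs) embedded in $W$ and a linear combination $s$ of fields on $W$ for which there is a ball decomposition such that each blob appears as a connected component of some $M_j$; the innermost blobs are initial pieces $X_a$; and $s$ is obtained by gluing linear combinations $s_a$ of fields on the pieces $X_a$, where $s_a$ is a null field if $X_a$ is an innermost blob and a single field otherwise. The blob group $\mathcal B_k(W)=\mathcal B_k(W;\mathcal C)$ is the $R$-module generated by the $k$-blob diagrams with ordered blobs. Diagrams are linear in $s$, and reordering the blobs multiplies a diagram by the sign of the permutation. (That is, $\mathcal B_k(W)$ is the span of the elements $(B_1\wedge\dots\wedge B_k)\otimes s$ in the tensor product of the exterior algebra of the free module on the subsets of $W$ with the module of linear combinations of fields on $W$.) The differential is the alternating sum over the ways to forget one of the blobs. This makes $\mathcal B_*(W)$ a chain complex, functorial with respect to homeomorphisms of $W$. Then for all compact $n$-manifolds $X_1,X_2$ there is an isomorphism of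 chain complexes of $R$-modules $$\mathcal B_*(X_1\sqcup X_2)\;\cong\;\mathcal B_*(X_1)\otimes_R\mathcal B_*(X_2),$$ natural with respect to homeomorphisms of $X_1$ and of $X_2$; that is, the two sides are naturally isomorphic as functors of $(X_1,X_2)$, from pairs of compact $n$-manifolds and homeomorphisms to chain complexes. -/

import Mathlib

universe u

open CategoryTheory

namespace BlobComplex

open Topology TensorProduct

/-! ### Manifolds, balls, boundaries -/

/-- The closed half-space `{y ∈ ℝⁿ | y₀ ≥ 0}` (a point for `n = 0`). -/
def HalfSpace (n : ℕ) : Type :=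
  {y : EuclideanSpace ℝ (Fin n) // ∀ i : Fin n, i.val = 0 → 0 ≤ y i}

instance (n : ℕ) : TopologicalSpace (HalfSpace n) := instTopologicalSpaceSubtype

/-- A compact topological `n`-manifold, possibly with boundary, possibly empty or disconnected:
a compact Hausdorff space locally homeomorphic to the closed half-space.
(Second countability is automatic.) -/
structure Mfd (n : ℕ) where
  carrier : Type u
  [top : TopologicalSpace carrier]
  [t2 : T2Space carrier]
  [compact : CompactSpace carrier]
  charts : ∀ x : carrier, ∃ e : OpenPartialHomeomorph carrier (HalfSpace n), x ∈ e.source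

namespace Mfd

instance (n : ℕ) : CoeSort (Mfd.{u} n) (Type u) := ⟨Mfd.carrier⟩

attribute [instance] Mfd.top Mfd.t2 Mfd.compact

variable {n : ℕ}

/-- The boundary of a manifold, as a subset. -/
def boundary (X : Mfd.{u} n) : Set X :=
  {x | ∃ e : OpenPartialHomeomorph X (HalfSpace n), x ∈ e.source ∧
    ∃ i : Fin n, i.val = 0 ∧ (e x).1 i = 0}

/-- `B` is an `n`-ball: it is homeomorphic to the standard closed ball. -/
def IsBall (B : Mfd.{u} n) : Prop :=
  Nonempty (B ≃ₜ Metric.closedBall (0 : EuclideanSpace ℝ (Fin n)) 1)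

/-- A union of connected components of a manifold, as a manifold. -/
def sub (X : Mfd.{u} n) (S : Set X) (hS : IsClopen S) : Mfd.{u} n where
  carrier := S
  compact := isCompact_iff_compactSpace.mp hS.isClosed.isCompact
  charts x := by
    obtain ⟨e, he⟩ := X.charts x
    have : Nonempty S := ⟨x⟩
    exact ⟨(hS.isOpen.isOpenEmbedding_subtypeVal.toOpenPartialHomeomorph _).trans e, by
      simpa [OpenPartialHomeomorph.trans_source] using he⟩

/-- The disjoint union of two manifolds. -/
def sum (X Y : Mfd.{u} n) : Mfd.{u} n where
  carrier := X ⊕ Y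
  charts := by
    rintro (x | y)
    · obtain ⟨e, he⟩ := X.charts x
      have : Nonempty X := ⟨x⟩
      exact ⟨(IsOpenEmbedding.inl.toOpenPartialHomeomorph _).symm.trans e, by
        simpa [OpenPartialHomeomorph.trans_source,
          (IsOpenEmbedding.inl (X := X) (Y := Y)).toOpenPartialHomeomorph_left_inv] using he⟩
    · obtain ⟨e, he⟩ := Y.charts y
      have : Nonempty Y := ⟨y⟩
      exact ⟨(IsOpenEmbedding.inr.toOpenPartialHomeomorph _).symm.trans e, by
        simpa [OpenPartialHomeomorph.trans_source,
          (IsOpenEmbedding.inr (X := X) (Y := Y)).toOpenPartialHomeomorph_left_inv] using he⟩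

/-- The category of compact `n`-manifolds and homeomorphisms. -/
instance : Category (Mfd.{u} n) where
  Hom X Y := X ≃ₜ Y
  id X := Homeomorph.refl X
  comp f g := f.trans g

end Mfd

variable {n : ℕ}

/-- `i` presents `X` as the disjoint union of the finitely many manifolds `A a`.
(An open embedding of compact manifolds is the inclusion of a union of components.) -/
structure IsPartition {ι : Type} {A : ι → Mfd.{u} n} {X : Mfd.{u} n} (i : ∀ a, A a → X) :
    Prop where
  emb : ∀ a, IsOpenEmbedding (i a)
  bij : Function.Bijective fun p : Σ a, A a => i p.1 p.2

/-- `X` is the disjoint union of `A` and `B`. -/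
structure IsPartition₂ {A B X : Mfd.{u} n} (i : A → X) (j : B → X) : Prop where
  embl : IsOpenEmbedding i
  embr : IsOpenEmbedding j
  bij : Function.Bijective (Sum.elim i j)

/-! ### Gluing -/

/-- `Y` is a closed codimension 0 submanifold of `∂M`: near each of its points there is a chart
of `M` in which `Y` is the whole boundary hyperplane, or a half of it. -/
structure IsBdryPiece {M : Mfd.{u} n} (Y : Set M) : Prop where
  closed : IsClosed Y
  chart : ∀ y ∈ Y, ∃ e : OpenPartialHomeomorph M (HalfSpace n), y ∈ e.source ∧
    ((∃ i : Fin n, i.val = 0 ∧ ∀ z ∈ e.source, z ∈ Y ↔ (e z).1 i = 0) ∨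
     (∃ i j : Fin n, i.val = 0 ∧ j.val = 1 ∧
        ∀ z ∈ e.source, z ∈ Y ↔ (e z).1 i = 0 ∧ 0 ≤ (e z).1 j))

/-- `π : M → M'` is the gluing of `M` to itself along the disjoint codimension 0 submanifolds
`Y`, `Y'` of its boundary: the quotient map which identifies `Y` with `Y'` and nothing else.
(The gluing homeomorphism is `(π|Y')⁻¹ ∘ π|Y`; all spaces are compact Hausdorff.) -/
structure IsGluingAlong {M M' : Mfd.{u} n} (π : M → M') (Y Y' : Set M) : Prop where
  piece : IsBdryPiece Y
  piece' : IsBdryPiece Y'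
  disj : Disjoint Y Y'
  cont : Continuous π
  surj : Function.Surjective π
  fiber : ∀ x x', π x = π x' → x = x' ∨ (x ∈ Y ∧ x' ∈ Y') ∨ (x ∈ Y' ∧ x' ∈ Y)
  image : π '' Y = π '' Y'

/-- A finite sequence of gluings `M = M₀ → M₁ → ⋯ → M_m ≅ W`. -/
inductive GluingSeq : Mfd.{u} n → Mfd.{u} n → Type (u + 1)
  | iso {M W : Mfd.{u} n} (e : M ≃ₜ W) : GluingSeq M W
  | step {M M' W : Mfd.{u} n} (π : M → M') (hπ : ∃ Y Y', IsGluingAlong π Y Y')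
      (γ : GluingSeq M' W) : GluingSeq M W

/-- The composite `M → W` of a sequence of gluings. -/
def GluingSeq.map : {M W : Mfd.{u} n} → GluingSeq M W → M → W
  | _, _, .iso e => e
  | _, _, .step π _ γ => γ.map ∘ π

/-- `π` is a composite of gluings. -/
def IsGluing {M W : Mfd.{u} n} (π : M → W) : Prop := ∃ γ : GluingSeq M W, γ.map = π

/-- Some component of `M` is a ball which `π : M → W` embeds in `W`, with image `B`. -/
def IsBallImage {M W : Mfd.{u} n} (π : M → W) (B : Set W) : Prop :=
  ∃ (Q : Mfd.{u} n) (i : Q → M), Q.IsBall ∧ IsOpenEmbedding i ∧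
    Function.Injective (π ∘ i) ∧ Set.range (π ∘ i) = B

/-- The embedded ball `B` in `W` appears as a component of one of the stages `M_j` of the
sequence of gluings. -/
def GluingSeq.Has : {M W : Mfd.{u} n} → GluingSeq M W → Set W → Prop
  | _, _, .iso e, B => IsBallImage e B
  | _, _, .step π _ γ, B => IsBallImage (γ.map ∘ π) B ∨ γ.Has B

/-- A ball decomposition of `W`: a sequence of gluings `M₀ → ⋯ → M_m ≅ W` whose initial stage is
a finite disjoint union of balls `X_a`. (The composite `⊔ X_a → W` is the associated permissible
decomposition.) -/
structure BallDecomp (W : Mfd.{u} n) where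
  ι : Type
  [fin : Fintype ι]
  X : ι → Mfd.{u} n
  ball : ∀ a, (X a).IsBall
  M : Mfd.{u} n
  i : ∀ a, X a → M
  part : IsPartition i
  γ : GluingSeq M W

attribute [instance] BallDecomp.fin

/-- The initial piece `X_a`, mapped to `W`. -/
def BallDecomp.toFun {W : Mfd.{u} n} (D : BallDecomp W) (a : D.ι) : D.X a → W :=
  D.γ.map ∘ D.i a

/-- A collection `C` of embedded balls in `W` is permissible if all of them appear as components
in the stages of a single ball decomposition. -/
def Permissible {W : Mfd.{u} n} (C : Set (Set W)) : Prop :=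
  ∃ D : BallDecomp W, ∀ B ∈ C, D.γ.Has B

/-- `B` is an innermost member of the collection `C`. -/
def Innermost {α : Type u} (C : Set (Set α)) (B : Set α) : Prop :=
  B ∈ C ∧ ∀ B' ∈ C, ¬ B' ⊂ B

/-! ### Fields -/

/-- `j` presents `D` as the boundary of `X`. -/
structure IsBoundary {k : ℕ} {D : Mfd.{u} k} {X : Mfd.{u} (k + 1)} (j : D → X) : Prop where
  emb : IsEmbedding j
  range : Set.range j = X.boundary

/-- For a gluing `π : X → X'` along `Y`, `Y'`, with `j : D → X` the boundary of `X`: a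
presentation of the decomposition `∂X = Y ∪ Y' ∪ V`, where `V` is the closure of the complement
of `Y ∪ Y'`. Here `T = Z ⊔ Z ⊔ V` is the result of cutting `D` open along `∂Y` and `∂Y'`,
the two copies of `Z` being identified with `Y` and `Y'` compatibly with the gluing. -/
structure IsCut {k : ℕ} {X X' : Mfd.{u} (k + 1)} {D T Z V : Mfd.{u} k}
    (π : X → X') (Y Y' : Set X) (j : D → X) (p : T → D)
    (a b : Z → T) (c : V → T) : Prop where
  bdry : IsBoundary j
  gluing : IsGluing p
  emba : IsOpenEmbedding a
  embb : IsOpenEmbedding b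
  embc : IsOpenEmbedding c
  bij : Function.Bijective (Sum.elim a (Sum.elim b c))
  inja : Function.Injective (p ∘ a)
  injb : Function.Injective (p ∘ b)
  injc : Function.Injective (p ∘ c)
  rangea : Set.range (j ∘ p ∘ a) = Y
  rangeb : Set.range (j ∘ p ∘ b) = Y'
  rangec : Set.range (j ∘ p ∘ c) = closure (X.boundary \ (Y ∪ Y'))
  compat : ∀ z, π (j (p (a z))) = π (j (p (b z)))

/-- An `n`-dimensional system of fields (for example: string diagrams for an `n`-category): sets
of fields on all `k`-manifolds, `k ≤ n`, with actions of homeomorphisms, restriction to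
unions of components and to boundaries, and gluing. The data in dimensions `k > n` are not
subject to any law and are never used. -/
structure FieldSystem (n : ℕ) where
  /-- the set of fields on a `k`-manifold -/
  Field : ∀ k : ℕ, Mfd.{u} k → Type u
  /-- pull-back along homeomorphisms and along inclusions of unions of components -/
  res : ∀ {k : ℕ} {A X : Mfd.{u} k} (i : A → X), IsOpenEmbedding i → Field k X → Field k A
  /-- restriction to the boundary -/
  bd : ∀ {k : ℕ} {D : Mfd.{u} k} {X : Mfd.{u} (k + 1)} (j : D → X), IsBoundary j →
    Field (k + 1) X → Field k D
  /-- `Glued π f g`: the field `f` on `M` can be glued along `π : M → M'`, with result `g`. -/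
  Glued : ∀ {k : ℕ} {M M' : Mfd.{u} k}, (M → M') → Field k M → Field k M' → Prop
  res_id : ∀ {k : ℕ}, k ≤ n → ∀ {X : Mfd.{u} k} (h : IsOpenEmbedding (id : X → X))
    (f : Field k X), res id h f = f
  res_comp : ∀ {k : ℕ}, k ≤ n → ∀ {A B X : Mfd.{u} k} (i : A → B) (j : B → X)
    (hi : IsOpenEmbedding i) (hj : IsOpenEmbedding j) (hij : IsOpenEmbedding (j ∘ i))
    (f : Field k X), res i hi (res j hj f) = res (j ∘ i) hij f
  /-- a field on a finite disjoint union is the same as a field on each part -/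
  res_bijective : ∀ {k : ℕ}, k ≤ n → ∀ {ι : Type} [Finite ι] {A : ι → Mfd.{u} k} {X : Mfd.{u} k}
    (i : ∀ a, A a → X) (hi : IsPartition i),
    Function.Bijective fun (f : Field k X) (a : ι) => res (i a) (hi.emb a) f
  /-- restriction to the boundary is natural -/
  bd_res : ∀ {k : ℕ}, k + 1 ≤ n → ∀ {D E : Mfd.{u} k} {A X : Mfd.{u} (k + 1)}
    (jA : D → A) (jX : E → X) (hA : IsBoundary jA) (hX : IsBoundary jX)
    (i : A → X) (i' : D → E) (hi : IsOpenEmbedding i) (hi' : IsOpenEmbedding i'),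
    jX ∘ i' = i ∘ jA → ∀ f : Field (k + 1) X, bd jA hA (res i hi f) = res i' hi' (bd jX hX f)
  /-- the result of gluing is unique -/
  glued_unique : ∀ {k : ℕ}, k ≤ n → ∀ {M M' : Mfd.{u} k} (π : M → M'), IsGluing π →
    ∀ {f : Field k M} {g g' : Field k M'}, Glued π f g → Glued π f g' → g = g'
  /-- gluing is injective -/
  glued_injective : ∀ {k : ℕ}, k ≤ n → ∀ {M M' : Mfd.{u} k} (π : M → M'), IsGluing π →
    ∀ {f f' : Field k M} {g : Field k M'}, Glued π f g → Glued π f' g → f = f'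
  /-- gluing along a homeomorphism is its action on fields -/
  glued_homeo : ∀ {k : ℕ}, k ≤ n → ∀ {M M' : Mfd.{u} k} (e : M ≃ₜ M') (f : Field k M)
    (g : Field k M'), Glued e f g ↔ res e e.isOpenEmbedding g = f
  /-- gluing is strictly associative -/
  glued_comp : ∀ {k : ℕ}, k ≤ n → ∀ {M M' M'' : Mfd.{u} k} (π : M → M') (π' : M' → M''),
    IsGluing π → IsGluing π' → ∀ (f : Field k M) (h : Field k M''),
    Glued (π' ∘ π) f h ↔ ∃ g, Glued π f g ∧ Glued π' g h
  /-- gluing is compatible with disjoint unions and natural with respect to homeomorphisms -/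
  glued_partition : ∀ {k : ℕ}, k ≤ n → ∀ {ι : Type} [Finite ι] {A A' : ι → Mfd.{u} k}
    {M M' : Mfd.{u} k} (i : ∀ a, A a → M) (i' : ∀ a, A' a → M')
    (hi : IsPartition i) (hi' : IsPartition i') (π : M → M') (ρ : ∀ a, A a → A' a),
    IsGluing π → (∀ a, IsGluing (ρ a)) → (∀ a, π ∘ i a = i' a ∘ ρ a) →
    ∀ (f : Field k M) (g : Field k M'),
    Glued π f g ↔ ∀ a, Glued (ρ a) (res (i a) (hi.emb a) f) (res (i' a) (hi'.emb a) g)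
  /-- a field `f` can be glued along `Y`, `Y'` if and only if its restriction to `∂X` splits along
  `∂X = Y ∪ Y' ∪ V` and the restrictions to `Y` and `Y'` agree -/
  glued_iff : ∀ {k : ℕ}, k + 1 ≤ n → ∀ {X X' : Mfd.{u} (k + 1)} {D T Z V : Mfd.{u} k}
    (π : X → X') (Y Y' : Set X) (_ : IsGluingAlong π Y Y') (j : D → X) (p : T → D)
    (a b : Z → T) (c : V → T) (h : IsCut π Y Y' j p a b c) (f : Field (k + 1) X),
    (∃ g, Glued π f g) ↔
      ∃ t : Field k T, Glued p t (bd j h.bdry f) ∧ res a h.emba t = res b h.embb t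
  /-- the boundary of a glued field is glued from the restriction to `V` -/
  bd_glued : ∀ {k : ℕ}, k + 1 ≤ n → ∀ {X X' : Mfd.{u} (k + 1)} {D T Z V D' : Mfd.{u} k}
    (π : X → X') (Y Y' : Set X) (_ : IsGluingAlong π Y Y') (j : D → X) (p : T → D)
    (a b : Z → T) (c : V → T) (h : IsCut π Y Y' j p a b c)
    (j' : D' → X') (hj' : IsBoundary j') (q : V → D') (_ : IsGluing q)
    (_ : j' ∘ q = π ∘ j ∘ p ∘ c) (f : Field (k + 1) X) (g : Field (k + 1) X') (t : Field k T),
    Glued π f g → Glued p t (bd j h.bdry f) → Glued q (res c h.embc t) (bd j' hj' g)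

namespace FieldSystem

/-- Two fields have the same restriction to the boundary (no condition in dimension `0`). -/
def SameBd (F : FieldSystem.{u} n) : ∀ {k : ℕ} {X : Mfd.{u} k}, F.Field k X → F.Field k X → Prop
  | 0, _, _, _ => True
  | k + 1, X, f, f' =>
    ∀ (D : Mfd.{u} k) (j : D → X) (h : IsBoundary j), F.bd j h f = F.bd j h f'

/-- All terms of the linear combination `v` have the same restriction to the boundary. -/
def FixedBd (F : FieldSystem.{u} n) {R : Type u} [CommRing R] {k : ℕ} {X : Mfd.{u} k}
    (v : F.Field k X →₀ R) : Prop :=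
  ∀ f ∈ v.support, ∀ f' ∈ v.support, F.SameBd f f'

end FieldSystem

/-- `h` is isotopic to the identity, relative to the boundary. -/
def IsotopicToId {B : Mfd.{u} n} (h : B ≃ₜ B) : Prop :=
  ∃ H : unitInterval → (B ≃ₜ B), Continuous (fun p : unitInterval × B => H p.1 p.2) ∧
    H 0 = Homeomorph.refl B ∧ H 1 = h ∧ ∀ t, ∀ x ∈ B.boundary, H t x = x

/-- An ordinary `R`-linear `n`-category `C` based on a system of fields `F`: its `k`-morphisms,
`k < n`, are the fields on `k`-balls, and its `n`-morphisms on an `n`-ball `B` are linear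
combinations of fields on `B`, up to having the same evaluation. It is given by the submodules
`U B` of linear combinations that evaluate to zero; only the intersections `U(B; c)` of `U B` with
the linear combinations of fields with boundary restriction `c` matter, and only for balls `B`. -/
structure FieldCategory (R : Type u) [CommRing R] (n : ℕ) extends FieldSystem.{u} n where
  U : ∀ B : Mfd.{u} n, Submodule R (Field n B →₀ R)
  /-- invariance under homeomorphisms -/
  U_homeo : ∀ {B B' : Mfd.{u} n}, B.IsBall → ∀ (e : B ≃ₜ B') (v : Field n B' →₀ R), v ∈ U B' →
    v.mapDomain (res e e.isOpenEmbedding) ∈ U B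
  /-- homeomorphisms isotopic to the identity act trivially on `n`-morphisms -/
  U_isotopy : ∀ {B : Mfd.{u} n}, B.IsBall → ∀ (h : B ≃ₜ B), IsotopicToId h →
    ∀ f : Field n B, Finsupp.single (res h h.isOpenEmbedding f) 1 - Finsupp.single f 1 ∈ U B
  /-- evaluation is compatible with gluing: if a ball `P` is assembled from a ball `B` and further
  pieces `E`, then gluing a linear combination in `U(B; c)` to a field `r` on `E` gives a linear
  combination in `U(P; c')`. -/
  U_glue : ∀ {N B E P : Mfd.{u} n}, B.IsBall → P.IsBall → ∀ (i : B → N) (e : E → N)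
    (h : IsPartition₂ i e) (π : N → P), IsGluing π →
    ∀ (v : Field n B →₀ R) (r : Field n E) (m : Field n B → Field n N) (g : Field n B → Field n P),
    v ∈ U B → toFieldSystem.FixedBd v →
    (∀ f ∈ v.support, res i h.embl (m f) = f ∧ res e h.embr (m f) = r ∧ Glued π (m f) (g f)) →
    v.mapDomain g ∈ U P ∧ toFieldSystem.FixedBd (v.mapDomain g)


/-! ### Blob diagrams and the blob groups -/

variable {R : Type u} [CommRing R]

namespace FieldCategory

variable (C : FieldCategory.{u} R n)

/-- The `n`-morphisms of `C` on a ball. -/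
noncomputable abbrev Mor (B : Mfd.{u} n) : Type u := (C.Field n B →₀ R) ⧸ C.U B

/-- Evaluation of linear combinations of fields on a ball to `n`-morphisms. -/
noncomputable abbrev ev (B : Mfd.{u} n) : (C.Field n B →₀ R) →ₗ[R] C.Mor B := (C.U B).mkQ

/-- A null field: a linear combination of fields with fixed boundary restriction which evaluates
to zero. -/
def IsNull {B : Mfd.{u} n} (v : C.Field n B →₀ R) : Prop :=
  C.ev B v = 0 ∧ C.FixedBd v

/-- The linear combination `⊗ u_a` of fields on the disjoint union `M = ⊔ X_a`, for linear
combinations `u_a` of fields on `X_a`. -/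
noncomputable def juxt {ι : Type} [Fintype ι] {X : ι → Mfd.{u} n} {M : Mfd.{u} n}
    {i : ∀ a, X a → M} (hi : IsPartition i) (v : ∀ a, C.Field n (X a) →₀ R) :
    C.Field n M →₀ R :=
  Finsupp.ofSupportFinite (fun m => ∏ a, v a (C.res (i a) (hi.emb a) m)) <| by
    refine Set.Finite.subset (Set.Finite.preimage
      ((C.res_bijective le_rfl i hi).1.injOn)
      (Set.Finite.pi' (t := fun a => ((v a).support : Set (C.Field n (X a))))
        fun a => Finset.finite_toSet _)) ?_
    intro m hm a
    simp only [Finset.mem_coe, Finsupp.mem_support_iff]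
    intro h
    exact hm (Finset.prod_eq_zero (Finset.mem_univ a) h)

/-- The data exhibiting `(K, s)`, with `K` a collection of balls in `W` and `s` a linear
combination of fields on `W`, as a blob diagram: a ball decomposition of `W` compatible with `K`,
in which the innermost members of `K` are initial pieces, and linear combinations `u_a` of fields on
the initial pieces which glue to `s`; here `u_a` is a null field if `X_a` is an innermost blob, and
a single field otherwise. -/
structure BlobData {W : Mfd.{u} n} (K : Set (Set W)) (s : C.Field n W →₀ R) where
  D : BallDecomp W
  has : ∀ B ∈ K, D.γ.Has B
  /-- the initial pieces which are innermost blobs -/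
  N : Set D.ι
  inj : ∀ a ∈ N, Function.Injective (D.toFun a)
  bijOn : Set.BijOn (fun a => Set.range (D.toFun a)) N {B | Innermost K B}
  v : ∀ a, C.Field n (D.X a) →₀ R
  null : ∀ a ∈ N, C.IsNull (v a)
  single : ∀ a ∉ N, ∃ f, v a = Finsupp.single f 1
  /-- the result of gluing a field on the union of the initial pieces -/
  g : C.Field n D.M → C.Field n W
  glued : ∀ m, (∀ a, v a (C.res (D.i a) (D.part.emb a) m) ≠ 0) → C.Glued D.γ.map m (g m)
  eq : s = (C.juxt D.part v).mapDomain g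

/-- `(K, s)` is a blob diagram on `W`, with set of blobs `K`. -/
def IsBlobDiagram {W : Mfd.{u} n} (K : Set (Set W)) (s : C.Field n W →₀ R) : Prop :=
  Nonempty (C.BlobData K s)

/-- The exterior algebra of the free module on the set of subsets of `W`, tensored with the
linear combinations of fields on `W`. -/
noncomputable abbrev Ambient (W : Mfd.{u} n) : Type u :=
  ExteriorAlgebra R (Set W →₀ R) ⊗[R] (C.Field n W →₀ R)

/-- The element `(b 0 ∧ ⋯ ∧ b (k-1)) ⊗ s`. Reordering the blobs `b i` changes it by the sign of
the permutation. -/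
noncomputable def diagram {W : Mfd.{u} n} {k : ℕ} (b : Fin k → Set W) (s : C.Field n W →₀ R) :
    C.Ambient W :=
  ExteriorAlgebra.ιMulti R k (fun i => Finsupp.single (b i) 1) ⊗ₜ s

/-- The `k`-th blob group, generated by the `k`-blob diagrams. -/
noncomputable def blobGroup (W : Mfd.{u} n) (k : ℕ) : Submodule R (C.Ambient W) :=
  Submodule.span R {x | ∃ (b : Fin k → Set W) (s : C.Field n W →₀ R), Function.Injective b ∧
    C.IsBlobDiagram (Set.range b) s ∧ x = C.diagram b s}

/-- The differential on the ambient module: contraction with the linear form that takes the value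
`1` on each blob, that is, the alternating sum over the ways to forget one blob
(see `differential_diagram`). -/
noncomputable def differential (W : Mfd.{u} n) : C.Ambient W →ₗ[R] C.Ambient W :=
  LinearMap.rTensor (C.Field n W →₀ R)
    (CliffordAlgebra.contractLeft (Q := (0 : QuadraticForm R (Set W →₀ R)))
      (Finsupp.linearCombination R fun _ => (1 : R)))

end FieldCategory


/-! ### Elementary facts on gluings -/

section Gluing

variable {M M' W E A A' : Mfd.{u} n}

theorem IsGluingAlong.isClosedMap {π : M → M'} {Y Y' : Set M} (h : IsGluingAlong π Y Y') :
    IsClosedMap π := h.cont.isClosedMap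

theorem GluingSeq.continuous_map : ∀ {M W : Mfd.{u} n} (γ : GluingSeq M W), Continuous γ.map
  | _, _, .iso e => e.continuous
  | _, _, .step _ hπ γ => by
    obtain ⟨_, _, h⟩ := hπ
    exact γ.continuous_map.comp h.cont

theorem GluingSeq.surjective_map :
    ∀ {M W : Mfd.{u} n} (γ : GluingSeq M W), Function.Surjective γ.map
  | _, _, .iso e => e.surjective
  | _, _, .step _ hπ γ => by
    obtain ⟨_, _, h⟩ := hπ
    exact γ.surjective_map.comp h.surj

theorem isBdryPiece_empty : IsBdryPiece (∅ : Set M) :=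
  ⟨isClosed_empty, fun _ h => h.elim⟩

theorem isGluingAlong_homeo (e : M ≃ₜ M') : IsGluingAlong e ∅ ∅ :=
  ⟨isBdryPiece_empty, isBdryPiece_empty, by simp, e.continuous, e.surjective,
    fun _ _ h => Or.inl (e.injective h), rfl⟩

theorem IsGluing.homeo (e : M ≃ₜ M') : IsGluing e := ⟨.iso e, rfl⟩

theorem IsGluing.of_along {π : M → M'} {Y Y' : Set M} (h : IsGluingAlong π Y Y') : IsGluing π :=
  ⟨.step π ⟨_, _, h⟩ (.iso (Homeomorph.refl _)), rfl⟩

theorem IsGluing.comp {π : M → M'} {π' : M' → W} (h' : IsGluing π') (h : IsGluing π) :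
    IsGluing (π' ∘ π) := by
  obtain ⟨γ, rfl⟩ := h
  obtain ⟨γ', rfl⟩ := h'
  induction γ with
  | iso e => exact ⟨.step e ⟨_, _, isGluingAlong_homeo e⟩ γ', rfl⟩
  | step π hπ γ ih =>
    obtain ⟨δ, hδ⟩ := ih γ'
    exact ⟨.step π hπ δ, by simp only [GluingSeq.map, hδ]; rfl⟩

theorem IsGluing.surjective {π : M → M'} (h : IsGluing π) : Function.Surjective π := by
  obtain ⟨γ, rfl⟩ := h
  exact γ.surjective_map

theorem IsBdryPiece.preimage {i : A → M} (hi : IsOpenEmbedding i) {Y : Set M}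
    (hY : IsBdryPiece Y) : IsBdryPiece (i ⁻¹' Y) := by
  refine ⟨hY.closed.preimage hi.continuous, fun y hy => ?_⟩
  obtain ⟨e, he, h⟩ := hY.chart _ hy
  have : Nonempty A := ⟨y⟩
  refine ⟨(hi.toOpenPartialHomeomorph _).trans e, by
    simpa [OpenPartialHomeomorph.trans_source] using he, ?_⟩
  rcases h with ⟨a, ha, h⟩ | ⟨a, b, ha, hb, h⟩
  · refine Or.inl ⟨a, ha, fun z hz => ?_⟩
    simp only [OpenPartialHomeomorph.trans_source, Set.mem_inter_iff, Set.mem_preimage] at hz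
    exact h _ hz.2
  · refine Or.inr ⟨a, b, ha, hb, fun z hz => ?_⟩
    simp only [OpenPartialHomeomorph.trans_source, Set.mem_inter_iff, Set.mem_preimage] at hz
    exact h _ hz.2

theorem IsBdryPiece.image {i : A → M} (hi : IsOpenEmbedding i) {Y : Set A}
    (hY : IsBdryPiece Y) : IsBdryPiece (i '' Y) := by
  refine ⟨hi.continuous.isClosedMap _ hY.closed, ?_⟩
  rintro _ ⟨y, hy, rfl⟩
  obtain ⟨e, he, h⟩ := hY.chart _ hy
  have : Nonempty A := ⟨y⟩
  have key : ∀ z ∈ ((hi.toOpenPartialHomeomorph _).symm.trans e).source, ∃ w, i w = z ∧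
      w ∈ e.source ∧ ((hi.toOpenPartialHomeomorph _).symm.trans e) z = e w := by
    intro z hz
    simp only [OpenPartialHomeomorph.trans_source, Set.mem_inter_iff, Set.mem_preimage,
      OpenPartialHomeomorph.symm_source, hi.toOpenPartialHomeomorph_target] at hz
    obtain ⟨⟨w, rfl⟩, hw⟩ := hz
    rw [hi.toOpenPartialHomeomorph_left_inv] at hw
    exact ⟨w, rfl, hw, by simp [hi.toOpenPartialHomeomorph_left_inv]⟩
  refine ⟨(hi.toOpenPartialHomeomorph _).symm.trans e, by
    simpa [OpenPartialHomeomorph.trans_source, hi.toOpenPartialHomeomorph_left_inv] using he, ?_⟩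
  rcases h with ⟨a, ha, h⟩ | ⟨a, b, ha, hb, h⟩
  · refine Or.inl ⟨a, ha, fun z hz => ?_⟩
    obtain ⟨w, rfl, hw, hz⟩ := key z hz
    rw [hz, hi.injective.mem_set_image]
    exact h w hw
  · refine Or.inr ⟨a, b, ha, hb, fun z hz => ?_⟩
    obtain ⟨w, rfl, hw, hz⟩ := key z hz
    rw [hz, hi.injective.mem_set_image]
    exact h w hw

theorem IsGluingAlong.restrict {π : M → M'} {Y Y' : Set M} (h : IsGluingAlong π Y Y')
    (S : Set M') (hS : IsClopen S) :
    IsGluingAlong (M := M.sub (π ⁻¹' S) (hS.preimage h.cont)) (M' := M'.sub S hS)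
      (S.restrictPreimage π) (Subtype.val ⁻¹' Y) (Subtype.val ⁻¹' Y') where
  piece := h.piece.preimage (A := M.sub (π ⁻¹' S) (hS.preimage h.cont))
    (hS.preimage h.cont).isOpen.isOpenEmbedding_subtypeVal
  piece' := h.piece'.preimage (A := M.sub (π ⁻¹' S) (hS.preimage h.cont))
    (hS.preimage h.cont).isOpen.isOpenEmbedding_subtypeVal
  disj := h.disj.preimage _
  cont := h.cont.restrictPreimage
  surj := S.restrictPreimage_surjective h.surj
  fiber x x' hx := by
    have := h.fiber x.1 x'.1 (congrArg Subtype.val hx)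
    rcases this with h1 | h1 | h1
    exacts [Or.inl (Subtype.ext h1), Or.inr (Or.inl h1), Or.inr (Or.inr h1)]
  image := by
    ext ⟨z, hz⟩
    constructor
    · rintro ⟨y, hy, e⟩
      obtain ⟨y', hy', e'⟩ := h.image.subset ⟨y.1, hy, rfl⟩
      have e2 : π y.1 = z := congrArg Subtype.val e
      exact ⟨⟨y', by rw [Set.mem_preimage, e', e2]; exact hz⟩, hy', Subtype.ext (e'.trans e2)⟩
    · rintro ⟨y, hy, e⟩
      obtain ⟨y', hy', e'⟩ := h.image.superset ⟨y.1, hy, rfl⟩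
      have e2 : π y.1 = z := congrArg Subtype.val e
      exact ⟨⟨y', by rw [Set.mem_preimage, e', e2]; exact hz⟩, hy', Subtype.ext (e'.trans e2)⟩

theorem IsGluingAlong.sum_left {π : A → A'} {Y Y' : Set A} (h : IsGluingAlong π Y Y') :
    IsGluingAlong (M := A.sum E) (M' := A'.sum E) (Sum.map π id) (Sum.inl '' Y) (Sum.inl '' Y') where
  piece := h.piece.image (M := A.sum E) IsOpenEmbedding.inl
  piece' := h.piece'.image (M := A.sum E) IsOpenEmbedding.inl
  disj := (Set.disjoint_image_iff Sum.inl_injective).mpr h.disj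
  cont := h.cont.sumMap continuous_id
  surj := h.surj.sumMap Function.surjective_id
  fiber := by
    rintro (x | x) (y | y) hxy
    · rcases h.fiber x y (Sum.inl_injective hxy) with h1 | h1 | h1
      · exact Or.inl (congrArg _ h1)
      · exact Or.inr (Or.inl ⟨⟨_, h1.1, rfl⟩, ⟨_, h1.2, rfl⟩⟩)
      · exact Or.inr (Or.inr ⟨⟨_, h1.1, rfl⟩, ⟨_, h1.2, rfl⟩⟩)
    · cases hxy
    · cases hxy
    · exact Or.inl (congrArg _ (Sum.inr_injective hxy))
  image := by
    have : ∀ s : Set A, (Sum.map π id '' (Sum.inl '' s) : Set (A' ⊕ E)) = Sum.inl '' (π '' s) :=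
      fun s => by simp only [Set.image_image, Sum.map_inl]
    exact (this Y).trans ((congrArg _ h.image).trans (this Y').symm)

/-- The homeomorphism from a disjoint union given by a partition. -/
noncomputable def IsPartition₂.homeo {i : A → M} {j : E → M} (h : IsPartition₂ i j) :
    (A.sum E : Mfd.{u} n) ≃ₜ M :=
  Continuous.homeoOfEquivCompactToT2 (f := Equiv.ofBijective _ h.bij)
    (by exact continuous_sum_dom.mpr ⟨h.embl.continuous, h.embr.continuous⟩)

theorem isPartition₂_sub (S : Set M) (hS : IsClopen S) :
    IsPartition₂ (A := M.sub S hS) (B := M.sub Sᶜ hS.compl) (X := M) Subtype.val Subtype.val where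
  embl := hS.isOpen.isOpenEmbedding_subtypeVal
  embr := hS.compl.isOpen.isOpenEmbedding_subtypeVal
  bij := by
    constructor
    · rintro (x | x) (y | y) h
      · exact congrArg _ (Subtype.ext h)
      · exact (y.2 (by have : x.1 = y.1 := h
                       rw [← this]; exact x.2)).elim
      · exact (x.2 (by have : x.1 = y.1 := h
                       rw [this]; exact y.2)).elim
      · exact congrArg _ (Subtype.ext h)
    · intro x
      by_cases hx : x ∈ S
      exacts [⟨Sum.inl ⟨x, hx⟩, rfl⟩, ⟨Sum.inr ⟨x, hx⟩, rfl⟩]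

theorem IsPartition₂.symm {i : A → M} {j : E → M} (h : IsPartition₂ i j) : IsPartition₂ j i where
  embl := h.embr
  embr := h.embl
  bij := by
    have : Sum.elim j i = Sum.elim i j ∘ Equiv.sumComm E A := by ext (x | x) <;> rfl
    rw [this]
    exact h.bij.comp (Equiv.bijective _)

theorem isPartition₂_sum : IsPartition₂ (A := A) (B := E) (X := A.sum E) Sum.inl Sum.inr where
  embl := IsOpenEmbedding.inl
  embr := IsOpenEmbedding.inr
  bij := by
    have : Sum.elim (Sum.inl : A → A ⊕ E) Sum.inr = id := by ext (x | x) <;> rfl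
    exact this ▸ Function.bijective_id

theorem IsGluing.sum_left {ρ : A → A'} (h : IsGluing ρ) :
    IsGluing (M := A.sum E) (W := A'.sum E) (Sum.map ρ id) := by
  obtain ⟨γ, rfl⟩ := h
  induction γ with
  | @iso M W e =>
    exact IsGluing.homeo (M := M.sum E) (M' := W.sum E) (e.sumCongr (Homeomorph.refl E))
  | step π hπ γ ih =>
    obtain ⟨Y, Y', hπ⟩ := hπ
    obtain ⟨δ, hδ⟩ := ih.comp (IsGluing.of_along (hπ.sum_left (E := E)))
    exact ⟨δ, hδ.trans (by funext x; rcases x with x | x <;> rfl)⟩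

theorem IsBdryPiece.interior_eq_empty {Y : Set M} (hY : IsBdryPiece Y) : interior Y = ∅ := by
  by_contra hne
  obtain ⟨y, hy⟩ := Set.nonempty_iff_ne_empty.mpr hne
  obtain ⟨e, he, h⟩ := hY.chart y (interior_subset hy)
  obtain ⟨i, hi0, hi⟩ : ∃ i : Fin n, i.val = 0 ∧ ∀ z ∈ e.source, z ∈ Y → (e z).1 i = 0 := by
    rcases h with ⟨i, h0, h⟩ | ⟨i, j, h0, _, h⟩
    exacts [⟨i, h0, fun z hz hzY => (h z hz).1 hzY⟩, ⟨i, h0, fun z hz hzY => ((h z hz).1 hzY).1⟩]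
  have hO : IsOpen (e '' (e.source ∩ interior Y)) :=
    e.isOpen_image_of_subset_source (e.open_source.inter isOpen_interior) Set.inter_subset_left
  let c : ℝ → HalfSpace n := fun t =>
    ⟨(e y).1 + WithLp.toLp 2 (fun j => if j = i then |t| else 0), by
      intro j hj
      obtain rfl : j = i := Fin.ext (hj.trans hi0.symm)
      simpa using add_nonneg ((e y).2 j hj) (abs_nonneg t)⟩
  have hc : Continuous c := by
    refine Continuous.subtype_mk (continuous_const.add ?_) _
    refine (PiLp.continuous_toLp 2 _).comp (continuous_pi fun j => ?_)
    split_ifs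
    exacts [continuous_abs, continuous_const]
  have hc0 : c 0 = e y := by
    apply Subtype.ext
    ext j
    simp [c]
  have hmem : c ⁻¹' (e '' (e.source ∩ interior Y)) ∈ 𝓝 (0 : ℝ) :=
    hc.continuousAt.preimage_mem_nhds (by rw [hc0]; exact hO.mem_nhds ⟨y, ⟨he, hy⟩, rfl⟩)
  obtain ⟨ε, hε, hball⟩ := Metric.mem_nhds_iff.mp hmem
  obtain ⟨z, ⟨hz, hzY⟩, hze⟩ := hball (show ε / 2 ∈ Metric.ball (0 : ℝ) ε by
    simp [abs_of_pos hε, hε])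
  have h1 := hi z hz (interior_subset hzY)
  have h2 := hi y he (interior_subset hy)
  rw [hze] at h1
  simp only [c, PiLp.add_apply, h2, if_true, zero_add, abs_eq_zero] at h1
  linarith

/-- Away from a nowhere dense set, a composite of gluings has trivial fibres. -/
theorem GluingSeq.exists_dense : ∀ {M W : Mfd.{u} n} (γ : GluingSeq M W),
    ∃ O : Set M, IsOpen O ∧ Dense O ∧ ∀ x ∈ O, ∀ x', γ.map x = γ.map x' → x = x'
  | _, _, .iso e => ⟨Set.univ, isOpen_univ, dense_univ, fun _ _ _ h => e.injective h⟩
  | M, _, .step (M' := M') π hπ γ => by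
    obtain ⟨O, hO, hd, hinj⟩ := γ.exists_dense
    obtain ⟨Y, Y', h⟩ := hπ
    have hYc : IsOpen (Y ∪ Y')ᶜ := (h.piece.closed.union h.piece'.closed).isOpen_compl
    have hYd : Dense (Y ∪ Y')ᶜ := by
      rw [← interior_eq_empty_iff_dense_compl,
        interior_union_isClosed_of_interior_empty h.piece.closed h.piece'.interior_eq_empty]
      exact h.piece.interior_eq_empty
    have hfib : ∀ x ∈ (Y ∪ Y')ᶜ, ∀ x', π x = π x' → x = x' := by
      intro x hx x' e
      rcases h.fiber x x' e with h1 | h1 | h1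
      exacts [h1, (hx (Or.inl h1.1)).elim, (hx (Or.inr h1.1)).elim]
    refine ⟨(Y ∪ Y')ᶜ ∩ π ⁻¹' O, hYc.inter (hO.preimage h.cont), ?_, ?_⟩
    · rw [dense_iff_inter_open]
      intro V hV hne
      obtain ⟨x, hxV, hxY⟩ := hYd.inter_open_nonempty V hV hne
      have hq : IsQuotientMap π := h.isClosedMap.isQuotientMap h.cont h.surj
      have himg : IsOpen (π '' (V ∩ (Y ∪ Y')ᶜ)) := by
        rw [← hq.isOpen_preimage]
        convert hV.inter hYc using 1
        ext z
        constructor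
        · rintro ⟨w, hw, e⟩
          exact hfib w hw.2 z e ▸ hw
        · exact fun hz => ⟨z, hz, rfl⟩
      obtain ⟨_, ⟨w, hw, rfl⟩, hwO⟩ := hd.inter_open_nonempty _ himg ⟨_, x, ⟨hxV, hxY⟩, rfl⟩
      exact ⟨w, hw.1, hw.2, hwO⟩
    · intro x hx x' e
      exact hfib x hx.1 x' (hinj _ hx.2 _ e)

theorem Mfd.IsBall.isPreconnected {B : Mfd.{u} n} (hB : B.IsBall) :
    IsPreconnected (Set.univ : Set B) := by
  obtain ⟨e⟩ := hB
  have : PreconnectedSpace (Metric.closedBall (0 : EuclideanSpace ℝ (Fin n)) 1) :=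
    isPreconnected_iff_preconnectedSpace.mp (convex_closedBall _ _).isPreconnected
  rw [← e.symm.surjective.range_eq]
  exact isPreconnected_range e.symm.continuous

theorem Mfd.IsBall.nonempty {B : Mfd.{u} n} (hB : B.IsBall) : Nonempty B := by
  obtain ⟨e⟩ := hB
  exact ⟨e.symm ⟨0, by simp⟩⟩

theorem Mfd.IsBall.subset_of_mem {B : Mfd.{u} n} (hB : B.IsBall) {i : B → M} (hi : Continuous i)
    {S : Set M} (hS : IsClopen S) {x : B} (hx : i x ∈ S) : ∀ y, i y ∈ S := fun _ =>
  hB.isPreconnected.subset_isClopen (hS.preimage hi) ⟨x, trivial, hx⟩ trivial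

theorem GluingSeq.has_of_isBallImage {γ : GluingSeq M W} {B : Set W} (h : IsBallImage γ.map B) :
    γ.Has B := by
  cases γ with
  | iso e => exact h
  | step π hπ γ => exact Or.inl h

/-- For a ball `P` that appears in a sequence of gluings `M → ⋯ → W`: a sequence of gluings which
starts instead with `P` together with those components of `M` that do not lie in `P`. -/
structure Collapse (γ : GluingSeq M W) (P : Set W) where
  S : Set M
  hS : IsClopen S
  Q : Mfd.{u} n
  ρ : M.sub S hS → Q
  γ' : GluingSeq ((M.sub Sᶜ hS.compl).sum Q) W
  ball : Q.IsBall
  gluing : IsGluing ρ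
  mapl : ∀ x : M.sub Sᶜ hS.compl, γ'.map (Sum.inl x) = γ.map x.1
  mapr : ∀ x : M.sub S hS, γ'.map (Sum.inr (ρ x)) = γ.map x.1
  inj : Function.Injective (fun x : Q => γ'.map (Sum.inr x))
  range : Set.range (fun x : Q => γ'.map (Sum.inr x)) = P
  has : ∀ B, γ.Has B → γ'.Has B ∨ B ⊆ P

theorem GluingSeq.exists_collapse_aux (γ : GluingSeq M W) {P : Set W} (hP : IsBallImage γ.map P) :
    Nonempty (Collapse γ P) := by
  obtain ⟨Q, i, hQ, hi, hinj, hr⟩ := hP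
  have hS : IsClopen (Set.range i) := ⟨hi.continuous.isClosedMap.isClosed_range, hi.isOpen_range⟩
  let r : Q ≃ₜ M.sub _ hS := hi.isEmbedding.toHomeomorph
  have hpart : IsPartition₂ (A := M.sub _ hS.compl) (X := M) Subtype.val i := by
    refine ⟨hS.compl.isOpen.isOpenEmbedding_subtypeVal, hi, ?_⟩
    have : Sum.elim (Subtype.val : M.sub _ hS.compl → M) i =
        Sum.elim Subtype.val Subtype.val ∘ Sum.map id r := by
      ext (x | x) <;> rfl
    exact this ▸ (isPartition₂_sub _ hS).symm.bij.comp
      (Function.bijective_id.sumMap r.bijective)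
  refine ⟨_, hS, Q, r.symm, .step hpart.homeo ⟨_, _, isGluingAlong_homeo _⟩ γ, hQ,
    IsGluing.homeo _, fun _ => rfl, fun x => ?_, hinj, hr, fun B hB => Or.inl (Or.inr hB)⟩
  change γ.map (i (r.symm x)) = γ.map x.1
  exact congrArg (fun z => γ.map z.1) (r.apply_symm_apply x)

theorem GluingSeq.exists_collapse (γ : GluingSeq M W) {P : Set W} (hP : γ.Has P) :
    Nonempty (Collapse γ P) := by
  induction γ with
  | iso e => exact exists_collapse_aux (.iso e) hP
  | step π hπ γ ih =>
    rcases hP with hP | hP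
    · exact exists_collapse_aux (.step π hπ γ) hP
    obtain ⟨S, hS, Q, ρ, γ', hQ, hρ, h1, h2, h3, h4, h5⟩ := ih hP
    obtain ⟨Y, Y', hπ⟩ := hπ
    have hr := IsGluing.of_along (hπ.restrict S hS)
    refine ⟨π ⁻¹' S, hS.preimage hπ.cont, Q, ρ ∘ S.restrictPreimage π,
      .step (M := (Mfd.sub _ _ (hS.preimage hπ.cont).compl).sum Q) _
        ⟨_, _, (hπ.restrict Sᶜ hS.compl).sum_left⟩ γ', hQ, hρ.comp hr,
      fun x => h1 _, fun x => h2 _, h3, h4, fun B hB => ?_⟩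
    rcases hB with hB | hB
    · obtain ⟨QB, i, hQB, hi, hinj, hrange⟩ := hB
      obtain ⟨x⟩ := hQB.nonempty
      by_cases hx : i x ∈ π ⁻¹' S
      · right
        rw [← hrange, ← h4]
        rintro _ ⟨y, rfl⟩
        have hy := hQB.subset_of_mem hi.continuous (hS.preimage hπ.cont) hx y
        exact ⟨_, h2 ⟨π (i y), hy⟩⟩
      · have hall := hQB.subset_of_mem hi.continuous (hS.preimage hπ.cont).compl hx
        refine Or.inl (Or.inl ⟨QB, fun y => Sum.inl ⟨i y, hall y⟩, hQB, ?_, ?_, ?_⟩)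
        · refine IsOpenEmbedding.inl.comp (IsOpenEmbedding.of_comp _
            (hS.preimage hπ.cont).compl.isOpen.isOpenEmbedding_subtypeVal hi)
        · convert hinj using 1
          ext y
          exact h1 ⟨π (i y), hall y⟩
        · rw [← hrange]
          congr 1
          ext y
          exact h1 ⟨π (i y), hall y⟩
    · rcases h5 B hB with h | h
      exacts [Or.inl (Or.inr h), Or.inr h]

end Gluing


/-! ### Elementary facts on fields -/

section Fields

/-- The two-element family with members `A`, `B`. -/
def pair (A B : Mfd.{u} n) : Bool → Mfd.{u} n
  | true => A
  | false => B

/-- A pair of maps as a family of maps. -/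
def pairMap {A B A' B' : Mfd.{u} n} (i : A → A') (j : B → B') : ∀ b, pair A B b → pair A' B' b
  | true => i
  | false => j

/-- A pair of maps with common target as a family of maps. -/
def pairTo {A B X : Mfd.{u} n} (i : A → X) (j : B → X) : ∀ b, pair A B b → X
  | true => i
  | false => j

theorem IsPartition₂.toPartition {A B X : Mfd.{u} n} {i : A → X} {j : B → X}
    (h : IsPartition₂ i j) : IsPartition (pairTo i j) where
  emb := by rintro (_ | _); exacts [h.embr, h.embl]
  bij := by
    constructor
    · rintro ⟨_ | _, x⟩ ⟨_ | _, y⟩ hxy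
      · exact congrArg _ (h.embr.injective hxy)
      · have := h.bij.1 (a₁ := Sum.inr x) (a₂ := Sum.inl y) hxy
        cases this
      · have := h.bij.1 (a₁ := Sum.inl x) (a₂ := Sum.inr y) hxy
        cases this
      · exact congrArg _ (h.embl.injective hxy)
    · intro x
      obtain ⟨y | y, rfl⟩ := h.bij.2 x
      exacts [⟨⟨true, y⟩, rfl⟩, ⟨⟨false, y⟩, rfl⟩]

namespace FieldSystem

variable (F : FieldSystem.{u} n)

theorem res_inj₂ {A B X : Mfd.{u} n} {i : A → X} {j : B → X} (h : IsPartition₂ i j)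
    {f f' : F.Field n X} (h1 : F.res i h.embl f = F.res i h.embl f')
    (h2 : F.res j h.embr f = F.res j h.embr f') : f = f' := by
  refine (F.res_bijective le_rfl _ h.toPartition).1 (funext ?_)
  rintro (_ | _)
  exacts [h2, h1]

theorem exists_res₂ {A B X : Mfd.{u} n} {i : A → X} {j : B → X} (h : IsPartition₂ i j)
    (a : F.Field n A) (b : F.Field n B) :
    ∃ f, F.res i h.embl f = a ∧ F.res j h.embr f = b := by
  obtain ⟨f, hf⟩ := (F.res_bijective le_rfl _ h.toPartition).2
    (fun | true => a | false => b)
  exact ⟨f, congrFun hf true, congrFun hf false⟩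

theorem glued_iff₂ {A B X A' B' X' : Mfd.{u} n} {i : A → X} {j : B → X} (h : IsPartition₂ i j)
    {i' : A' → X'} {j' : B' → X'} (h' : IsPartition₂ i' j') {π : X → X'} {ρ : A → A'} {σ : B → B'}
    (hπ : IsGluing π) (hρ : IsGluing ρ) (hσ : IsGluing σ) (h1 : π ∘ i = i' ∘ ρ)
    (h2 : π ∘ j = j' ∘ σ) (f : F.Field n X) (g : F.Field n X') :
    F.Glued π f g ↔ F.Glued ρ (F.res i h.embl f) (F.res i' h'.embl g) ∧
      F.Glued σ (F.res j h.embr f) (F.res j' h'.embr g) := by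
  rw [F.glued_partition le_rfl _ _ h.toPartition h'.toPartition π (pairMap ρ σ) hπ
    (by rintro (_ | _); exacts [hσ, hρ]) (by rintro (_ | _); exacts [h2, h1])]
  exact ⟨fun H => ⟨H true, H false⟩, by rintro ⟨H1, H2⟩ (_ | _); exacts [H2, H1]⟩

theorem glued_id (X : Mfd.{u} n) (f : F.Field n X) : F.Glued (id : X → X) f f :=
  (F.glued_homeo le_rfl (Homeomorph.refl X) f f).2 (F.res_id le_rfl _ f)

theorem res_res_eq' {A B X : Mfd.{u} n} {i : A → B} {j : B → X} {k : A → X}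
    (hi : IsOpenEmbedding i) (hj : IsOpenEmbedding j) (hk : IsOpenEmbedding k)
    (h : j ∘ i = k) (f : F.Field n X) :
    F.res i hi (F.res j hj f) = F.res k hk f := by
  subst h
  exact F.res_comp le_rfl i j hi hj hk f

end FieldSystem

end Fields


/-! ### Forgetting a blob -/

section Forget

variable {M W : Mfd.{u} n}

theorem GluingSeq.exists_generic (γ : GluingSeq M W) {X : Mfd.{u} n} (hX : X.IsBall) {i : X → M}
    (hi : IsOpenEmbedding i) : ∃ x, ∀ m, γ.map (i x) = γ.map m → i x = m := by
  obtain ⟨O, _, hd, hO⟩ := γ.exists_dense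
  obtain ⟨x0⟩ := hX.nonempty
  obtain ⟨_, ⟨x, rfl⟩, hx⟩ := hd.inter_open_nonempty _ hi.isOpen_range ⟨_, x0, rfl⟩
  exact ⟨x, hO _ hx⟩

theorem Collapse.mem_of_subset {γ : GluingSeq M W} {P : Set W} (c : Collapse γ P)
    {X : Mfd.{u} n} (hX : X.IsBall) {i : X → M} (hi : IsOpenEmbedding i)
    (h : Set.range (γ.map ∘ i) ⊆ P) : ∀ x, i x ∈ c.S := by
  obtain ⟨x, hx⟩ := γ.exists_generic hX hi
  have hxP := h ⟨x, rfl⟩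
  rw [← c.range] at hxP
  obtain ⟨q, hq⟩ := hxP
  obtain ⟨y, rfl⟩ := c.gluing.surjective q
  refine hX.subset_of_mem hi.continuous c.hS (x := x) ?_
  rw [hx y.1 (hq.symm.trans (c.mapr y))]
  exact y.2

theorem Collapse.subset_of_mem {γ : GluingSeq M W} {P : Set W} (c : Collapse γ P)
    {m : M} (hm : m ∈ c.S) : γ.map m ∈ P := by
  rw [← c.range]
  exact ⟨c.ρ ⟨m, hm⟩, c.mapr ⟨m, hm⟩⟩

theorem GluingSeq.nested (γ : GluingSeq M W) {X : Mfd.{u} n} (hX : X.IsBall) {i : X → M}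
    (hi : IsOpenEmbedding i) {P P' : Set W} (hP : γ.Has P) (hP' : γ.Has P')
    (h : Set.range (γ.map ∘ i) ⊆ P) (h' : Set.range (γ.map ∘ i) ⊆ P') : P ⊆ P' ∨ P' ⊆ P := by
  obtain ⟨c⟩ := γ.exists_collapse hP
  rcases c.has P' hP' with hc | hc
  swap
  · exact Or.inr hc
  left
  obtain ⟨c'⟩ := c.γ'.exists_collapse hc
  obtain ⟨x, hx⟩ := γ.exists_generic hX hi
  have hxS := c.mem_of_subset hX hi h x
  have hmem : (Sum.inr (c.ρ ⟨i x, hxS⟩) : (M.sub c.Sᶜ c.hS.compl).sum c.Q) ∈ c'.S := by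
    have hxP := h' ⟨x, rfl⟩
    rw [← c'.range] at hxP
    obtain ⟨q, hq⟩ := hxP
    obtain ⟨⟨w, hw⟩, rfl⟩ := c'.gluing.surjective q
    have hq2 := hq.symm.trans (c'.mapr ⟨w, hw⟩)
    rcases w with z | y
    · have := hx z.1 (hq2.trans (c.mapl z))
      exact (z.2 (this ▸ hxS)).elim
    · obtain ⟨z, rfl⟩ := c.gluing.surjective y
      have := hx z.1 (hq2.trans (c.mapr z))
      have e : z = ⟨i x, hxS⟩ := Subtype.ext this.symm
      exact e ▸ hw
  have hall := c.ball.subset_of_mem (M := (M.sub c.Sᶜ c.hS.compl).sum c.Q) (i := Sum.inr)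
    continuous_inr c'.hS hmem
  rw [← c.range]
  rintro _ ⟨q, rfl⟩
  exact c'.subset_of_mem (hall q)

/-- The map from `M` to the new initial stage. -/
noncomputable def Collapse.κ {γ : GluingSeq M W} {P : Set W} (c : Collapse γ P) :
    M → (M.sub c.Sᶜ c.hS.compl).sum c.Q :=
  Sum.swap ∘ Sum.map c.ρ id ∘ (isPartition₂_sub c.S c.hS).homeo.symm

section

variable {γ : GluingSeq M W} {P : Set W} (c : Collapse γ P)

theorem Collapse.κ_in (x : M.sub c.S c.hS) : c.κ x.1 = Sum.inr (c.ρ x) := by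
  have : (isPartition₂_sub c.S c.hS).homeo.symm x.1 = Sum.inl x :=
    (isPartition₂_sub c.S c.hS).homeo.symm_apply_apply (Sum.inl x)
  exact congrArg (fun z => Sum.swap (Sum.map c.ρ id z)) this

theorem Collapse.κ_out (x : M.sub c.Sᶜ c.hS.compl) : c.κ x.1 = Sum.inl x := by
  have : (isPartition₂_sub c.S c.hS).homeo.symm x.1 = Sum.inr x :=
    (isPartition₂_sub c.S c.hS).homeo.symm_apply_apply (Sum.inr x)
  exact congrArg (fun z => Sum.swap (Sum.map c.ρ id z)) this

theorem Collapse.isGluing_κ : IsGluing c.κ := by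
  refine IsGluing.comp (M := M) (M' := c.Q.sum (M.sub c.Sᶜ c.hS.compl))
    (IsGluing.homeo (M := c.Q.sum (M.sub c.Sᶜ c.hS.compl))
      (M' := (M.sub c.Sᶜ c.hS.compl).sum c.Q) (Homeomorph.sumComm _ _)) ?_
  exact IsGluing.comp (IsGluing.sum_left c.gluing) (IsGluing.homeo _)

theorem Collapse.map_κ : c.γ'.map ∘ c.κ = γ.map := by
  funext x
  by_cases hx : x ∈ c.S
  · rw [Function.comp_apply, c.κ_in ⟨x, hx⟩]; exact c.mapr _
  · rw [Function.comp_apply, c.κ_out ⟨x, hx⟩]; exact c.mapl _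

end

section

variable {P : Set W} {D : BallDecomp W} (c : Collapse D.γ P)

/-- The initial pieces that do not lie in `P`. -/
abbrev Collapse.Out : Type := {a : D.ι // ∀ x, D.i a x ∉ c.S}

theorem Collapse.inOrOut (a : D.ι) : (∀ x, D.i a x ∈ c.S) ∨ (∀ x, D.i a x ∉ c.S) := by
  by_cases h : ∃ x, D.i a x ∈ c.S
  · obtain ⟨x, hx⟩ := h
    exact Or.inl ((D.ball a).subset_of_mem (D.part.emb a).continuous c.hS hx)
  · exact Or.inr fun x hx => h ⟨x, hx⟩

/-- The new initial pieces. -/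
def Collapse.X' : Option c.Out → Mfd.{u} n
  | none => c.Q
  | some a => D.X a.1

/-- The inclusions of the new initial pieces. -/
def Collapse.i' : ∀ o, c.X' o → ((D.M.sub c.Sᶜ c.hS.compl).sum c.Q : Mfd.{u} n)
  | none => Sum.inr
  | some a => fun x => Sum.inl ⟨D.i a.1 x, a.2 x⟩

theorem Collapse.part' : IsPartition c.i' where
  emb := by
    rintro (_ | a)
    · exact IsOpenEmbedding.inr
    · exact IsOpenEmbedding.inl.comp (IsOpenEmbedding.of_comp _
        c.hS.compl.isOpen.isOpenEmbedding_subtypeVal (D.part.emb a.1))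
  bij := by
    constructor
    · rintro ⟨_ | a, x⟩ ⟨_ | b, y⟩ h
      · exact congrArg _ (Sum.inr_injective h)
      · cases h
      · cases h
      · have h1 : D.i a.1 x = D.i b.1 y := congrArg Subtype.val (Sum.inl_injective h)
        have h2 := D.part.bij.1 (a₁ := ⟨a.1, x⟩) (a₂ := ⟨b.1, y⟩) h1
        obtain ⟨a, ha⟩ := a
        obtain ⟨b, hb⟩ := b
        cases h2
        rfl
    · rintro (z | q)
      · obtain ⟨⟨a, x⟩, hx⟩ := D.part.bij.2 z.1
        have hx' : D.i a x = z.1 := hx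
        refine ⟨⟨some ⟨a, ?_⟩, x⟩, congrArg Sum.inl (Subtype.ext hx')⟩
        rcases c.inOrOut a with h | h
        · exact (z.2 (hx' ▸ h x)).elim
        · exact h
      · exact ⟨⟨none, q⟩, rfl⟩

open Classical in
/-- The new ball decomposition. -/
noncomputable def Collapse.decomp : BallDecomp W where
  ι := Option c.Out
  fin := inferInstance
  X := c.X'
  ball := by rintro (_ | a); exacts [c.ball, D.ball _]
  M := (D.M.sub c.Sᶜ c.hS.compl).sum c.Q
  i := c.i'
  part := c.part'
  γ := c.γ'

end


namespace FieldCategory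

variable (C : FieldCategory.{u} R n)

theorem juxt_apply {ι : Type} [Fintype ι] {X : ι → Mfd.{u} n} {M : Mfd.{u} n}
    {i : ∀ a, X a → M} (hi : IsPartition i) (v : ∀ a, C.Field n (X a) →₀ R) (m : C.Field n M) :
    C.juxt hi v m = ∏ a, v a (C.res (i a) (hi.emb a) m) := rfl

theorem forall_ne_of_juxt_ne {ι : Type} [Fintype ι] {X : ι → Mfd.{u} n} {M : Mfd.{u} n}
    {i : ∀ a, X a → M} (hi : IsPartition i) {v : ∀ a, C.Field n (X a) →₀ R} {m : C.Field n M}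
    (h : C.juxt hi v m ≠ 0) : ∀ a, v a (C.res (i a) (hi.emb a) m) ≠ 0 := fun a ha =>
  h (Finset.prod_eq_zero (Finset.mem_univ a) ha)

/-- The linear combinations of fields on the new initial pieces. -/
def newV {P : Set W} {D : BallDecomp W} (c : Collapse D.γ P)
    (v : ∀ a, C.Field n (D.X a) →₀ R) (w : C.Field n c.Q →₀ R) :
    ∀ o, C.Field n (c.decomp.X o) →₀ R
  | none => w
  | some a => v a.1

/-- The key step when the innermost blob `X_{b₀}` is forgotten and `P` becomes innermost: the
glued linear combination on `P` is a null field, and the whole diagram can be assembled from it. -/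
theorem collapse_fields {P : Set W} {D : BallDecomp W} (c : Collapse D.γ P)
    (v : ∀ a, C.Field n (D.X a) →₀ R) (g : C.Field n D.M → C.Field n W)
    (hg : ∀ m, (∀ a, v a (C.res (D.i a) (D.part.emb a) m) ≠ 0) → C.Glued D.γ.map m (g m))
    (b₀ : D.ι) (hb : ∀ x, D.i b₀ x ∈ c.S) (hnull : C.IsNull (v b₀))
    (hin : ∀ a, (∀ x, D.i a x ∈ c.S) → a ≠ b₀ → ∃ f, v a = Finsupp.single f 1)
    (m₀ : C.Field n D.M) (hm₀ : ∀ a, v a (C.res (D.i a) (D.part.emb a) m₀) ≠ 0) :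
    ∃ (w : C.Field n c.Q →₀ R) (g' : C.Field n c.decomp.M → C.Field n W), C.IsNull w ∧
      (∀ m, w (C.res (c.decomp.i none) (c.decomp.part.emb none) m) ≠ 0 →
        (∀ a : c.Out, v a.1 (C.res (c.decomp.i (some a)) (c.decomp.part.emb (some a)) m) ≠ 0) →
        C.Glued c.decomp.γ.map m (g' m)) ∧
      (C.juxt D.part v).mapDomain g = Finsupp.mapDomain g' (C.juxt c.decomp.part (C.newV c v w)) := by
  classical
  set Good : C.Field n D.M → Prop := fun m => ∀ a, v a (C.res (D.i a) (D.part.emb a) m) ≠ 0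
    with hGood
  have hSc := isPartition₂_sub c.S c.hS
  have hsum := isPartition₂_sum (A := D.M.sub c.Sᶜ c.hS.compl) (E := c.Q)
  -- complement of the piece
  have hR : IsClopen (Set.range (D.i b₀)) :=
    ⟨(D.part.emb b₀).continuous.isClosedMap.isClosed_range, (D.part.emb b₀).isOpen_range⟩
  have hbpart : IsPartition₂ (A := D.X b₀) (B := D.M.sub _ hR.compl) (X := D.M) (D.i b₀)
      Subtype.val := by
    refine ⟨D.part.emb b₀, hR.compl.isOpen.isOpenEmbedding_subtypeVal, ?_, ?_⟩
    · rintro (x | x) (y | y) h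
      · exact congrArg _ ((D.part.emb b₀).injective h)
      · exact (y.2 ⟨x, h⟩).elim
      · exact (x.2 ⟨y, h.symm⟩).elim
      · exact congrArg _ (Subtype.ext h)
    · intro x
      by_cases hx : x ∈ Set.range (D.i b₀)
      · obtain ⟨y, rfl⟩ := hx
        exact ⟨Sum.inl y, rfl⟩
      · exact ⟨Sum.inr ⟨x, hx⟩, rfl⟩
  -- the fields `m f`
  choose mf hmf1 hmf2 using fun f => C.exists_res₂ hbpart f
    (C.res (Subtype.val : D.M.sub _ hR.compl → D.M) hbpart.embr m₀)
  have hrest : ∀ f a, a ≠ b₀ → C.res (D.i a) (D.part.emb a) (mf f) =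
      C.res (D.i a) (D.part.emb a) m₀ := by
    intro f a ha
    have hd : ∀ x, D.i a x ∈ (Set.range (D.i b₀))ᶜ := by
      rintro x ⟨y, hy⟩
      have := D.part.bij.1 (a₁ := ⟨b₀, y⟩) (a₂ := ⟨a, x⟩) hy
      exact ha (congrArg Sigma.fst this).symm
    let l : D.X a → D.M.sub _ hR.compl := fun x => ⟨D.i a x, hd x⟩
    have hl : IsOpenEmbedding l := IsOpenEmbedding.of_comp _
      hR.compl.isOpen.isOpenEmbedding_subtypeVal (D.part.emb a)
    have := congrArg (C.res l hl) (hmf2 f)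
    rwa [C.res_res_eq' hl hbpart.embr (D.part.emb a) rfl, C.res_res_eq' hl hbpart.embr (D.part.emb a) rfl] at this
  have hmfGood : ∀ f ∈ (v b₀).support, Good (mf f) := by
    intro f hf a
    by_cases ha : a = b₀
    · subst ha
      rw [hmf1]
      exact Finsupp.mem_support_iff.mp hf
    · rw [hrest f a ha]
      exact hm₀ a
  -- gluing along `κ`
  have hκ : ∀ m, Good m → ∃ m1, C.Glued c.κ m m1 ∧ C.Glued c.γ'.map m1 (g m) := by
    intro m hm
    have := hg m hm
    rw [← c.map_κ] at this
    exact (C.glued_comp le_rfl _ _ c.isGluing_κ ⟨_, rfl⟩ _ _).1 this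
  have : Nonempty (C.Field n ((D.M.sub c.Sᶜ c.hS.compl).sum c.Q)) := ⟨(hκ m₀ hm₀).choose⟩
  choose! k hk1 hk2 using hκ
  have hκ2 : ∀ (m : C.Field n D.M) (m1 : C.Field n ((D.M.sub c.Sᶜ c.hS.compl).sum c.Q)),
      C.Glued c.κ m m1 ↔ C.Glued c.ρ (C.res _ hSc.embl m) (C.res _ hsum.embr m1) ∧
        C.res _ hSc.embr m = C.res _ hsum.embl m1 := by
    intro m m1
    rw [C.glued_iff₂ hSc hsum.symm c.isGluing_κ c.gluing
      (IsGluing.homeo (Homeomorph.refl (D.M.sub c.Sᶜ c.hS.compl))) (funext c.κ_in)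
      (funext c.κ_out), C.glued_homeo le_rfl]
    have e : ∀ z : C.Field n (D.M.sub c.Sᶜ c.hS.compl), C.res
      (Homeomorph.refl (D.M.sub c.Sᶜ c.hS.compl))
        (Homeomorph.refl (D.M.sub c.Sᶜ c.hS.compl)).isOpenEmbedding z = z := fun z =>
      C.res_id le_rfl _ z
    rw [e]
    exact and_congr_right fun _ => eq_comm
  -- the fields on `P`
  let p : C.Field n (D.X b₀) → C.Field n c.Q := fun f => C.res _ hsum.embr (k (mf f))
  have hp : ∀ f ∈ (v b₀).support, C.Glued c.ρ (C.res _ hSc.embl (mf f)) (p f) := fun f hf =>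
    ((hκ2 _ _).1 (hk1 _ (hmfGood f hf))).1
  -- the factorization of the piece through `S`
  let lb : D.X b₀ → D.M.sub c.S c.hS := fun x => ⟨D.i b₀ x, hb x⟩
  have hlb : IsOpenEmbedding lb := IsOpenEmbedding.of_comp _
    c.hS.isOpen.isOpenEmbedding_subtypeVal (D.part.emb b₀)
  have hlbr : ∀ m, C.res lb hlb (C.res _ hSc.embl m) = C.res (D.i b₀) (D.part.emb b₀) m :=
    fun m => C.res_res_eq' hlb hSc.embl (D.part.emb b₀) rfl m
  have hpinj : Set.InjOn p ((v b₀).support : Set (C.Field n (D.X b₀))) := by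
    intro f hf f' hf' h
    have h1 := hp f hf
    rw [h] at h1
    have h2 := C.glued_injective le_rfl _ c.gluing h1 (hp f' hf')
    have h3 := congrArg (C.res lb hlb) h2
    rwa [hlbr, hlbr, hmf1, hmf1] at h3
  -- a good field agrees with `mf f` on `S`
  have hgood : ∀ m : C.Field n D.M, Good m → C.res (A := D.M.sub c.S c.hS) _ hSc.embl m =
      C.res (A := D.M.sub c.S c.hS) _ hSc.embl (mf (C.res (D.i b₀) (D.part.emb b₀) m)) := by
    intro m hm
    obtain ⟨m', h1, h2⟩ := C.exists_res₂ hSc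
      (C.res _ hSc.embl (mf (C.res (D.i b₀) (D.part.emb b₀) m))) (C.res _ hSc.embr m)
    suffices m' = m by rw [← h1, this]
    refine (C.res_bijective le_rfl _ D.part).1 (funext fun a => ?_)
    change C.res (D.i a) (D.part.emb a) m' = C.res (D.i a) (D.part.emb a) m
    rcases c.inOrOut a with ha | ha
    · let l : D.X a → D.M.sub c.S c.hS := fun x => ⟨D.i a x, ha x⟩
      have hl : IsOpenEmbedding l := IsOpenEmbedding.of_comp _
        c.hS.isOpen.isOpenEmbedding_subtypeVal (D.part.emb a)
      have h3 := congrArg (C.res l hl) h1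
      rw [C.res_res_eq' hl hSc.embl (D.part.emb a) rfl, C.res_res_eq' hl hSc.embl (D.part.emb a) rfl] at h3
      rw [h3]
      by_cases hab : a = b₀
      · subst hab
        rw [hmf1]
      · rw [hrest _ a hab]
        obtain ⟨f, hf⟩ := hin a ha hab
        have e1 := hm₀ a
        have e2 := hm a
        rw [hf, Finsupp.single_apply_ne_zero] at e1 e2
        rw [e1.1, e2.1]
    · let l : D.X a → D.M.sub c.Sᶜ c.hS.compl := fun x => ⟨D.i a x, ha x⟩
      have hl : IsOpenEmbedding l := IsOpenEmbedding.of_comp _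
        c.hS.compl.isOpen.isOpenEmbedding_subtypeVal (D.part.emb a)
      have h3 := congrArg (C.res l hl) h2
      rwa [C.res_res_eq' hl hSc.embr (D.part.emb a) rfl, C.res_res_eq' hl hSc.embr (D.part.emb a) rfl] at h3
  let w : C.Field n c.Q →₀ R := (v b₀).mapDomain p
  have hw0 : ∀ q, w q ≠ 0 → ∃ f ∈ (v b₀).support, p f = q := by
    intro q hq
    have := Finsupp.mapDomain_support (Finsupp.mem_support_iff.mpr hq)
    simpa using this
  have hwp : ∀ f ∈ (v b₀).support, w (p f) = v b₀ f := fun f hf =>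
    Finsupp.mapDomain_apply' _ _ subset_rfl hpinj hf
  have hresi : ∀ (a : c.Out) (m : C.Field n D.M) m1, C.Glued c.κ m m1 →
      C.res (c.decomp.i (some a)) (c.decomp.part.emb (some a)) m1 =
        C.res (D.i a.1) (D.part.emb a.1) m := by
    intro a m m1 h
    let l : D.X a.1 → D.M.sub c.Sᶜ c.hS.compl := fun x => ⟨D.i a.1 x, a.2 x⟩
    have hl : IsOpenEmbedding l := IsOpenEmbedding.of_comp _
      c.hS.compl.isOpen.isOpenEmbedding_subtypeVal (D.part.emb a.1)
    have h3 := congrArg (C.res l hl) ((hκ2 _ _).1 h).2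
    rw [C.res_res_eq' hl hSc.embr (D.part.emb a.1) rfl] at h3
    rw [h3]
    exact (C.res_res_eq' hl hsum.embl (c.decomp.part.emb (some a)) rfl m1).symm
  -- every good field on the new initial stage comes from a good field on `M`
  have hback : ∀ m1 : C.Field n c.decomp.M,
      w (C.res (c.decomp.i none) (c.decomp.part.emb none) m1) ≠ 0 →
      (∀ a : c.Out, v a.1 (C.res (c.decomp.i (some a)) (c.decomp.part.emb (some a)) m1) ≠ 0) →
      ∃ m, Good m ∧ C.Glued c.κ m m1 := by
    intro m1 h1 h2
    obtain ⟨f, hf, hpf⟩ := hw0 _ h1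
    obtain ⟨m, h3, h4⟩ := C.exists_res₂ hSc (C.res _ hSc.embl (mf f))
      (C.res _ hsum.embl m1)
    have hgl : C.Glued c.κ m m1 := by
      refine (hκ2 m m1).2 ⟨?_, h4⟩
      rw [h3]
      have := hp f hf
      rwa [hpf] at this
    refine ⟨m, fun a => ?_, hgl⟩
    rcases c.inOrOut a with ha | ha
    · let l : D.X a → D.M.sub c.S c.hS := fun x => ⟨D.i a x, ha x⟩
      have hl : IsOpenEmbedding l := IsOpenEmbedding.of_comp _
        c.hS.isOpen.isOpenEmbedding_subtypeVal (D.part.emb a)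
      have h5 := congrArg (C.res l hl) h3
      rw [C.res_res_eq' hl hSc.embl (D.part.emb a) rfl, C.res_res_eq' hl hSc.embl (D.part.emb a) rfl] at h5
      rw [h5]
      exact hmfGood f hf a
    · rw [← hresi ⟨a, ha⟩ m m1 hgl]
      exact h2 ⟨a, ha⟩
  have hkk : ∀ m, Good m → ∀ m1, C.Glued c.κ m m1 → k m = m1 := fun m hm m1 h =>
    C.glued_unique le_rfl _ c.isGluing_κ (hk1 m hm) h
  have hkinj : ∀ m m', Good m → Good m' → k m = k m' → m = m' := by
    intro m m' hm hm' h
    have h1 := hk1 m hm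
    rw [h] at h1
    exact C.glued_injective le_rfl _ c.isGluing_κ h1 (hk1 m' hm')
  have hpk : ∀ m, Good m → C.res (c.decomp.i none) (c.decomp.part.emb none) (k m) =
      p (C.res (D.i b₀) (D.part.emb b₀) m) := by
    intro m hm
    have hf : C.res (D.i b₀) (D.part.emb b₀) m ∈ (v b₀).support :=
      Finsupp.mem_support_iff.mpr (hm b₀)
    have h1 := ((hκ2 _ _).1 (hk1 m hm)).1
    rw [hgood m hm] at h1
    exact C.glued_unique le_rfl _ c.gluing h1 (hp _ hf)
  let g' : C.Field n c.decomp.M → C.Field n W := fun m1 =>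
    if h : ∃ m, Good m ∧ C.Glued c.κ m m1 then g h.choose else g m₀
  have hg' : ∀ m, Good m → g' (k m) = g m := by
    intro m hm
    have hex : ∃ m', Good m' ∧ C.Glued c.κ m' (k m) := ⟨m, hm, hk1 m hm⟩
    have h1 : g' (k m) = g hex.choose := dif_pos hex
    rw [h1, C.glued_injective le_rfl _ c.isGluing_κ hex.choose_spec.2 (hk1 m hm)]
  refine ⟨w, g', ?_, ?_, ?_⟩
  · -- `w` is null
    obtain ⟨hn1, hn2⟩ := hnull
    let E := (D.M.sub c.S c.hS).sub (Set.range lb)ᶜ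
      (IsClopen.compl ⟨hlb.continuous.isClosedMap.isClosed_range, hlb.isOpen_range⟩)
    have hE : IsPartition₂ (A := D.X b₀) (B := E) (X := D.M.sub c.S c.hS) lb Subtype.val := by
      have hRl : IsClopen (Set.range lb) :=
        ⟨hlb.continuous.isClosedMap.isClosed_range, hlb.isOpen_range⟩
      refine ⟨hlb, hRl.compl.isOpen.isOpenEmbedding_subtypeVal, ?_, ?_⟩
      · rintro (x | x) (y | y) h
        · exact congrArg _ (hlb.injective h)
        · exact (y.2 ⟨x, h⟩).elim
        · exact (x.2 ⟨y, h.symm⟩).elim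
        · exact congrArg _ (Subtype.ext h)
      · intro x
        by_cases hx : x ∈ Set.range lb
        · obtain ⟨y, rfl⟩ := hx
          exact ⟨Sum.inl y, rfl⟩
        · exact ⟨Sum.inr ⟨x, hx⟩, rfl⟩
    let l : E → D.M.sub _ hR.compl := fun x => ⟨x.1.1, by
      rintro ⟨y, hy⟩
      exact x.2 ⟨y, Subtype.ext hy⟩⟩
    have hl : IsOpenEmbedding l := IsOpenEmbedding.of_comp _
        hR.compl.isOpen.isOpenEmbedding_subtypeVal (hSc.embl.comp hE.embr)
    have := C.U_glue (D.ball b₀) c.ball lb _ hE c.ρ c.gluing (v b₀)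
      (C.res l hl (C.res _ hbpart.embr m₀)) (fun f => C.res _ hSc.embl (mf f)) p
      ((Submodule.Quotient.mk_eq_zero _).mp hn1) hn2 (fun f hf => ⟨?_, ?_, hp f hf⟩)
    · exact ⟨(Submodule.Quotient.mk_eq_zero _).mpr this.1, this.2⟩
    · rw [hlbr, hmf1]
    · rw [← hmf2 f]
      exact (C.res_comp le_rfl _ _ hE.embr hSc.embl (hSc.embl.comp hE.embr) _).trans
        (C.res_comp le_rfl l _ hl hbpart.embr (hSc.embl.comp hE.embr) _).symm
  · intro m1 h1 h2
    obtain ⟨m, hm, hgl⟩ := hback m1 h1 h2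
    have e := hkk m hm m1 hgl
    rw [← e, hg' m hm]
    exact hk2 m hm
  · let k' : C.Field n D.M → C.Field n c.decomp.M := k
    have hS : (C.juxt D.part v).mapDomain k' = C.juxt c.decomp.part (C.newV c v w) := by
      have hkinj' : Set.InjOn k' {m | Good m} := fun m hm m' hm' h => hkinj m m' hm hm' h
      have hsupp : ((C.juxt D.part v).support : Set (C.Field n D.M)) ⊆ {m | Good m} := by
        intro m hm
        exact C.forall_ne_of_juxt_ne D.part (Finsupp.mem_support_iff.mp hm)
      have hopt : ∀ F : Option c.Out → R, ∏ o : c.decomp.ι, F o = F none * ∏ a, F (some a) :=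
        fun F => Fintype.prod_option F
      ext m1
      by_cases hex : ∃ m, Good m ∧ C.Glued c.κ m m1
      · obtain ⟨m, hm, hgl⟩ := hex
        obtain rfl := hkk m hm m1 hgl
        refine (Finsupp.mapDomain_apply' _ _ hsupp hkinj' hm).trans ?_
        refine Eq.trans ?_ (hopt fun o => C.newV c v w o
          (C.res (c.decomp.i o) (c.decomp.part.emb o) (k m))).symm
        have e1 : C.newV c v w none (C.res (c.decomp.i none) (c.decomp.part.emb none) (k m)) =
            v b₀ (C.res (D.i b₀) (D.part.emb b₀) m) := by
          rw [hpk m hm]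
          exact hwp _ (Finsupp.mem_support_iff.mpr (hm b₀))
        have e2 : ∀ a : c.Out, C.newV c v w (some a)
            (C.res (c.decomp.i (some a)) (c.decomp.part.emb (some a)) (k m)) =
            v a.1 (C.res (D.i a.1) (D.part.emb a.1) m) := fun a => by
          rw [hresi a m _ hgl]
          rfl
        rw [e1, Fintype.prod_congr _ _ e2, juxt_apply]
        let o : c.Out → {a // ¬ ∀ x, D.i a x ∈ c.S} := fun a => ⟨a.1, fun h => by
          obtain ⟨x⟩ := (D.ball a.1).nonempty
          exact a.2 x (h x)⟩
        have ho : Function.Bijective o := by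
          refine ⟨fun a b h => Subtype.ext (congrArg (fun z => z.1) h), fun a => ?_⟩
          rcases c.inOrOut a.1 with h | h
          exacts [(a.2 h).elim, ⟨⟨a.1, h⟩, rfl⟩]
        rw [← Fintype.prod_subtype_mul_prod_subtype (fun a => ∀ x, D.i a x ∈ c.S)]
        congr 1
        · refine Fintype.prod_eq_single
            (⟨b₀, hb⟩ : {a // ∀ x, D.i a x ∈ c.S}) (fun a ha => ?_)
          obtain ⟨f, hf⟩ := hin a.1 a.2 fun h => ha (Subtype.ext h)
          have e2 := hm a.1
          rw [hf] at e2 ⊢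
          rw [Finsupp.single_apply_ne_zero] at e2
          rw [e2.1, Finsupp.single_eq_same]
        · exact (Fintype.prod_bijective o ho _ _ fun _ => rfl).symm
      · rw [Finsupp.mapDomain_of_not_mem_image_support]
        · symm
          by_contra hne
          have := C.forall_ne_of_juxt_ne c.decomp.part hne
          exact hex (hback m1 (this none) fun a => this (some a))
        · rintro ⟨m, hm, rfl⟩
          exact hex ⟨m, hsupp hm, hk1 m (hsupp hm)⟩
    rw [← hS]
    refine Eq.trans ?_ Finsupp.mapDomain_comp
    refine Finsupp.mapDomain_congr fun m hm => ?_
    exact (hg' m (C.forall_ne_of_juxt_ne D.part (Finsupp.mem_support_iff.mp hm))).symm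

end FieldCategory


end Forget


namespace FieldCategory

variable (C : FieldCategory.{u} R n)

/-- A blob diagram remains a linear combination of blob diagrams if one of its blobs is forgotten.
-/
theorem IsBlobDiagram.forget {W : Mfd.{u} n} {K : Set (Set W)} {s : C.Field n W →₀ R}
    (h : C.IsBlobDiagram K s) {B : Set W} (hB : B ∈ K) :
    s ∈ Submodule.span R {t | C.IsBlobDiagram (K \ {B}) t} := by
  classical
  obtain ⟨d⟩ := h
  by_cases hex : ∃ P, Innermost (K \ {B}) P ∧ ¬ Innermost K P
  swap
  · have hno : ∀ P, Innermost (K \ {B}) P → Innermost K P := fun P hP => by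
      by_contra h
      exact hex ⟨P, hP, h⟩
    have hback : ∀ P, Innermost K P → P ≠ B → Innermost (K \ {B}) P := fun P hP hne =>
      ⟨⟨hP.1, hne⟩, fun B' hB' => hP.2 B' hB'.1⟩
    by_cases hBi : Innermost K B
    swap
    · refine Submodule.subset_span ⟨{ d with has := fun B' hB' => d.has B' hB'.1, bijOn := ?_ }⟩
      convert d.bijOn using 1
      ext P
      exact ⟨hno P, fun hP => hback P hP fun e => hBi (e ▸ hP)⟩
    · obtain ⟨b, hbN, hb⟩ := d.bijOn.surjOn hBi
      have hb' : Set.range (d.D.toFun b) = B := hb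
      have hsum : C.juxt d.D.part d.v = ∑ f ∈ (d.v b).support,
          d.v b f • C.juxt d.D.part (Function.update d.v b (Finsupp.single f 1)) := by
        ext m
        rw [Finsupp.finsetSum_apply]
        have key : ∀ f, C.juxt d.D.part (Function.update d.v b (Finsupp.single f 1)) m =
            (if f = C.res (d.D.i b) (d.D.part.emb b) m then 1 else 0) *
              ∏ a ∈ {b}ᶜ, d.v a (C.res (d.D.i a) (d.D.part.emb a) m) := by
          intro f
          rw [juxt_apply, Fintype.prod_eq_mul_prod_compl b, Function.update_self,
            Finsupp.single_apply]
          congr 1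
          refine Finset.prod_congr rfl fun a ha => ?_
          rw [Function.update_of_ne (by simpa using ha)]
        simp only [Finsupp.smul_apply, key, smul_eq_mul, ite_mul, one_mul, zero_mul, mul_ite,
          mul_zero, Finset.sum_ite_eq', juxt_apply]
        rw [Fintype.prod_eq_mul_prod_compl b]
        split_ifs with h0
        · rfl
        · rw [Finsupp.notMem_support_iff.mp h0, zero_mul]
      rw [d.eq, hsum, Finsupp.mapDomain_finsetSum]
      refine Submodule.sum_mem _ fun f hf => ?_
      rw [Finsupp.mapDomain_smul]
      refine Submodule.smul_mem _ _ (Submodule.subset_span ⟨?_⟩)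
      refine
        { D := d.D
          has := fun B' hB' => d.has B' hB'.1
          N := d.N \ {b}
          inj := fun a ha => d.inj a ha.1
          bijOn := ⟨?_, d.bijOn.injOn.mono Set.sdiff_subset, ?_⟩
          v := Function.update d.v b (Finsupp.single f 1)
          null := fun a ha => ?_
          single := fun a ha => ?_
          g := d.g
          glued := fun m hm => d.glued m fun a => ?_
          eq := rfl }
      · rintro a ⟨ha, hab⟩
        exact hback _ (d.bijOn.mapsTo ha) fun e => hab (d.bijOn.injOn ha hbN (e.trans hb'.symm))
      · intro P hP
        obtain ⟨a, ha, rfl⟩ := d.bijOn.surjOn (hno P hP)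
        refine ⟨a, ⟨ha, ?_⟩, rfl⟩
        rintro rfl
        exact hP.1.2 hb'
      · rw [Function.update_of_ne ha.2]
        exact d.null a ha.1
      · by_cases hab : a = b
        · subst hab
          exact ⟨f, by rw [Function.update_self]⟩
        · rw [Function.update_of_ne hab]
          exact d.single a fun h => ha ⟨h, hab⟩
      · by_cases hab : a = b
        · subst hab
          have := hm a
          rw [Function.update_self, Finsupp.single_apply_ne_zero] at this
          rw [this.1]
          exact Finsupp.mem_support_iff.mp hf
        · have := hm a
          rwa [Function.update_of_ne hab] at this
  · obtain ⟨P, hP, hPK⟩ := hex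
    -- `B` lies strictly inside `P`, and it is innermost
    have hBP : B ⊂ P := by
      by_contra h
      refine hPK ⟨hP.1.1, fun B' hB' hlt => ?_⟩
      by_cases e : B' = B
      · exact h (e ▸ hlt)
      · exact hP.2 B' ⟨hB', e⟩ hlt
    have hBi : Innermost K B := by
      refine ⟨hB, fun B' hB' hlt => ?_⟩
      exact hP.2 B' ⟨hB', hlt.ne⟩ (hlt.trans hBP)
    obtain ⟨b, hbN, hb⟩ := d.bijOn.surjOn hBi
    have hb' : Set.range (d.D.toFun b) = B := hb
    obtain ⟨c⟩ := d.D.γ.exists_collapse (d.has P hP.1.1)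
    by_cases hm₀ : ∃ m, ∀ a, d.v a (C.res (d.D.i a) (d.D.part.emb a) m) ≠ 0
    swap
    · have : C.juxt d.D.part d.v = 0 := by
        ext m
        by_contra h
        exact hm₀ ⟨m, C.forall_ne_of_juxt_ne d.D.part h⟩
      rw [d.eq, this, Finsupp.mapDomain_zero]
      exact Submodule.zero_mem _
    obtain ⟨m₀, hm₀⟩ := hm₀
    have hbS := c.mem_of_subset (d.D.ball b) (d.D.part.emb b) (hb'.subset.trans hBP.subset)
    have hinN : ∀ a, (∀ x, d.D.i a x ∈ c.S) → a ∈ d.N → a = b := by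
      intro a ha haN
      have hsub : Set.range (d.D.toFun a) ⊆ P := by
        rintro _ ⟨x, rfl⟩
        exact c.subset_of_mem (ha x)
      have hia : Innermost K (Set.range (d.D.toFun a)) := d.bijOn.mapsTo haN
      refine d.bijOn.injOn haN hbN (Eq.trans ?_ hb'.symm)
      by_contra hne
      rcases hsub.eq_or_ssubset with h | h
      · exact hPK (h ▸ hia)
      · exact hP.2 _ ⟨hia.1, hne⟩ h
    obtain ⟨w, g', hw, hg', heq⟩ := C.collapse_fields c d.v d.g d.glued b hbS (d.null b hbN)
      (fun a ha hab => d.single a fun h => hab (hinN a ha h)) m₀ hm₀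
    have htoS : ∀ a : c.Out, c.decomp.toFun (some a) = d.D.toFun a.1 := fun a =>
      funext fun x => c.mapl ⟨d.D.i a.1 x, a.2 x⟩
    have hrN : Set.range (c.decomp.toFun none) = P := c.range
    have hrS : ∀ a : c.Out, Set.range (c.decomp.toFun (some a)) = Set.range (d.D.toFun a.1) :=
      fun a => congrArg Set.range (htoS a)
    have hnone : ∀ a : c.Out, (none : Option c.Out) = some a → a.1 ∈ d.N := fun a h => by cases h
    refine Submodule.subset_span ⟨
      { D := c.decomp
        has := fun B' hB' => ?_
        N := {o | ∀ a, o = some a → a.1 ∈ d.N}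
        inj := ?_
        bijOn := ⟨?_, ?_, ?_⟩
        v := C.newV c d.v w
        null := ?_
        single := ?_
        g := g'
        glued := fun m hm => hg' m (hm none) fun a => hm (some a)
        eq := d.eq.trans heq }⟩
    · rcases c.has B' (d.has B' hB'.1) with h | h
      · exact h
      · rcases h.eq_or_ssubset with h | h
        · subst h
          exact GluingSeq.has_of_isBallImage ⟨c.Q, Sum.inr, c.ball, IsOpenEmbedding.inr,
            c.inj, c.range⟩
        · exact (hP.2 B' hB' h).elim
    · rintro (_ | a) ha
      · exact c.inj
      · exact (congrArg Function.Injective (htoS a)).mpr <| d.inj a.1 (ha a rfl)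
    · rintro (_ | a) ha
      · exact (congrArg (Innermost (K \ {B})) hrN).mpr hP
      · refine (congrArg (Innermost (K \ {B})) (hrS a)).mpr ?_
        have h1 : Innermost K (Set.range (d.D.toFun a.1)) := d.bijOn.mapsTo (ha a rfl)
        refine ⟨⟨h1.1, fun e => ?_⟩, fun B' hB' => h1.2 B' hB'.1⟩
        have e2 := d.bijOn.injOn (ha a rfl) hbN (Eq.trans e hb'.symm)
        obtain ⟨x⟩ := (d.D.ball b).nonempty
        obtain ⟨a, ha'⟩ := a
        subst e2
        exact ha' x (hbS x)
    · have haux : ∀ a : c.Out, Set.range (d.D.toFun a.1) ≠ P := by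
        intro a h
        obtain ⟨x⟩ := (d.D.ball a.1).nonempty
        exact a.2 x (c.mem_of_subset (d.D.ball a.1) (d.D.part.emb a.1) h.subset x)
      rintro (_ | a) ha (_ | a') ha' h
      · rfl
      · exact (haux a' ((hrS a').symm.trans (h.symm.trans hrN))).elim
      · exact (haux a ((hrS a).symm.trans (h.trans hrN))).elim
      · exact congrArg some (Subtype.ext (d.bijOn.injOn (ha a rfl) (ha' a' rfl)
          ((hrS a).symm.trans (h.trans (hrS a')))))
    · intro P' hP'
      by_cases hPP : P' = P
      · exact ⟨none, hnone, hrN.trans hPP.symm⟩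
      have hK' : Innermost K P' := by
        by_contra hnot
        have hBP' : B ⊂ P' := by
          by_contra h
          refine hnot ⟨hP'.1.1, fun B' hB' hlt => ?_⟩
          by_cases e : B' = B
          · exact h (e ▸ hlt)
          · exact hP'.2 B' ⟨hB', e⟩ hlt
        rcases d.D.γ.nested (d.D.ball b) (d.D.part.emb b) (d.has P hP.1.1) (d.has P' hP'.1.1)
          (hb'.subset.trans hBP.subset) (hb'.subset.trans hBP'.subset) with h | h
        · rcases h.eq_or_ssubset with h | h
          · exact hPP h.symm
          · exact hP'.2 P hP.1 h
        · rcases h.eq_or_ssubset with h | h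
          · exact hPP h
          · exact hP.2 P' hP'.1 h
      obtain ⟨a, ha, rfl⟩ := d.bijOn.surjOn hK'
      have haout : ∀ x, d.D.i a x ∉ c.S := by
        rcases c.inOrOut a with h | h
        · have e := hinN a h ha
          subst e
          exact (hP'.1.2 hb').elim
        · exact h
      refine ⟨some ⟨a, haout⟩, ?_, ?_⟩
      · rintro a' h
        rw [← Option.some.inj h]
        exact ha
      · exact hrS _
    · rintro (_ | a) ha
      · exact hw
      · exact d.null a.1 (ha a rfl)
    · rintro (_ | a) ha
      · exact (ha hnone).elim
      · refine d.single a.1 fun h => ha ?_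
        rintro a' e
        rw [← Option.some.inj e]
        exact h

/-- The differential is the alternating sum over the ways to forget one blob. -/
theorem differential_diagram {W : Mfd.{u} n} {k : ℕ} (b : Fin (k + 1) → Set W)
    (s : C.Field n W →₀ R) : C.differential W (C.diagram b s) =
      ∑ i : Fin (k + 1), (-1 : R) ^ (i : ℕ) • C.diagram (b ∘ i.succAbove) s := by
  have key : ∀ (k : ℕ) (b : Fin (k + 1) → Set W),
      CliffordAlgebra.contractLeft (Q := (0 : QuadraticForm R (Set W →₀ R)))
        (Finsupp.linearCombination R fun _ => (1 : R))
        (ExteriorAlgebra.ιMulti R (k + 1) (fun i => Finsupp.single (b i) 1)) =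
      ∑ i : Fin (k + 1), (-1 : R) ^ (i : ℕ) •
        ExteriorAlgebra.ιMulti R k (fun j => Finsupp.single (b (i.succAbove j)) 1) := by
    intro k
    induction k with
    | zero =>
      intro b
      rw [ExteriorAlgebra.ιMulti_succ_apply, ExteriorAlgebra.ιMulti_zero_apply, mul_one]
      refine (CliffordAlgebra.contractLeft_ι (Q := (0 : QuadraticForm R (Set W →₀ R))) _ _).trans ?_
      simp [ExteriorAlgebra.ιMulti_zero_apply]
    | succ k ih =>
      intro b
      have h0 : ∀ (m : ℕ) (d : Fin (m + 1) → Set W), ExteriorAlgebra.ιMulti R (m + 1)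
          (fun i => Finsupp.single (d i) (1 : R)) = ExteriorAlgebra.ι R (Finsupp.single (d 0) 1) *
            ExteriorAlgebra.ιMulti R m (fun i => Finsupp.single (d i.succ) 1) := fun m d =>
        ExteriorAlgebra.ιMulti_succ_apply _
      rw [h0]
      refine (CliffordAlgebra.contractLeft_ι_mul (Q := (0 : QuadraticForm R (Set W →₀ R)))
        _ _ _).trans ?_
      rw [Fin.sum_univ_succ, sub_eq_add_neg]
      congr 1
      · simp
      · refine (congrArg (fun z => -(CliffordAlgebra.ι (0 : QuadraticForm R (Set W →₀ R))
          (Finsupp.single (b 0) 1) * z)) (ih fun i => b i.succ)).trans ?_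
        rw [Finset.mul_sum, ← Finset.sum_neg_distrib]
        refine Finset.sum_congr rfl fun i _ => ?_
        rw [h0, mul_smul_comm, Fin.val_succ, pow_succ, mul_neg_one, neg_smul]
        simp only [Fin.succ_succAbove_zero, Fin.succ_succAbove_succ]
  rw [diagram, differential, LinearMap.rTensor_tmul]
  refine (congrArg (fun z => z ⊗ₜ[R] s) (key k b)).trans ?_
  rw [TensorProduct.sum_tmul]
  rfl

end FieldCategory


/-! ### The blob complex -/

namespace FieldCategory

variable (C : FieldCategory.{u} R n)

theorem diagram_mem_blobGroup {W : Mfd.{u} n} {k : ℕ} {b : Fin k → Set W}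
    (hb : Function.Injective b) {s : C.Field n W →₀ R}
    (hs : s ∈ Submodule.span R {t | C.IsBlobDiagram (Set.range b) t}) :
    C.diagram b s ∈ C.blobGroup W k := by
  induction hs using Submodule.span_induction with
  | mem t ht => exact Submodule.subset_span ⟨b, t, hb, ht, rfl⟩
  | zero => simp [diagram]
  | add x y _ _ hx hy => rw [diagram, TensorProduct.tmul_add]; exact Submodule.add_mem _ hx hy
  | smul a x _ hx => rw [diagram, TensorProduct.tmul_smul]; exact Submodule.smul_mem _ _ hx

theorem differential_mem {W : Mfd.{u} n} {k : ℕ} {x : C.Ambient W}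
    (hx : x ∈ C.blobGroup W (k + 1)) : C.differential W x ∈ C.blobGroup W k := by
  induction hx using Submodule.span_induction with
  | mem x hx =>
    obtain ⟨b, s, hb, hs, rfl⟩ := hx
    rw [differential_diagram]
    refine Submodule.sum_mem _ fun i _ => Submodule.smul_mem _ _ ?_
    refine C.diagram_mem_blobGroup (hb.comp Fin.succAbove_right_injective) ?_
    have h : Set.range (b ∘ i.succAbove) = Set.range b \ {b i} := by
      rw [Set.range_comp, Fin.range_succAbove, Set.image_compl_eq_range_sdiff_image hb,
        Set.image_singleton]
    rw [h]
    exact hs.forget C ⟨i, rfl⟩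
  | zero => simp
  | add x y _ _ hx hy => rw [map_add]; exact Submodule.add_mem _ hx hy
  | smul a x _ hx => rw [map_smul]; exact Submodule.smul_mem _ _ hx

theorem differential_differential {W : Mfd.{u} n} (x : C.Ambient W) :
    C.differential W (C.differential W x) = 0 := by
  induction x using TensorProduct.induction_on with
  | zero => simp
  | tmul y s =>
    rw [differential, LinearMap.rTensor_tmul, LinearMap.rTensor_tmul]
    refine (congrArg (fun z => z ⊗ₜ[R] s) (CliffordAlgebra.contractLeft_contractLeft
      (Q := (0 : QuadraticForm R (Set W →₀ R))) _ y)).trans (TensorProduct.zero_tmul _ _)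
  | add x y hx hy => rw [map_add, map_add, hx, hy, add_zero]

/-- The differential `B_{k+1}(W) → B_k(W)`. -/
noncomputable def d (W : Mfd.{u} n) (k : ℕ) : C.blobGroup W (k + 1) →ₗ[R] C.blobGroup W k :=
  (C.differential W).restrict fun _ hx => C.differential_mem hx

/-- The blob complex of `W` with coefficients in `C`. -/
noncomputable def blobComplex (W : Mfd.{u} n) : ChainComplex (ModuleCat.{u} R) ℕ :=
  ChainComplex.of (fun k => ModuleCat.of R (C.blobGroup W k)) (fun k => ModuleCat.ofHom (C.d W k))
    fun _ => ModuleCat.hom_ext <| LinearMap.ext fun x =>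
      Subtype.ext (C.differential_differential x.1)

/-! ### Functoriality -/

/-- The action of a homeomorphism on sets of blobs and fields. -/
noncomputable def ambientMap {W W' : Mfd.{u} n} (e : W ≃ₜ W') : C.Ambient W →ₗ[R] C.Ambient W' :=
  TensorProduct.map
    (ExteriorAlgebra.map (Finsupp.lmapDomain R R (Set.image e))).toLinearMap
    (Finsupp.lmapDomain R R (C.res e.symm e.symm.isOpenEmbedding))

theorem ambientMap_diagram {W W' : Mfd.{u} n} (e : W ≃ₜ W') {k : ℕ} (b : Fin k → Set W)
    (s : C.Field n W →₀ R) : C.ambientMap e (C.diagram b s) =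
      C.diagram (fun i => e '' b i) (s.mapDomain (C.res e.symm e.symm.isOpenEmbedding)) := by
  simp only [ambientMap, diagram, TensorProduct.map_tmul, AlgHom.toLinearMap_apply,
    ExteriorAlgebra.map_apply_ιMulti, Finsupp.lmapDomain_apply]
  congr 2
  ext1 i
  simp

end FieldCategory

/-- Composition of a sequence of gluings with a homeomorphism. -/
def GluingSeq.transport : {M W W' : Mfd.{u} n} → GluingSeq M W → (W ≃ₜ W') → GluingSeq M W'
  | _, _, _, .iso e, f => .iso (e.trans f)
  | _, _, _, .step π hπ γ, f => .step π hπ (γ.transport f)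

theorem GluingSeq.transport_map : ∀ {M W W' : Mfd.{u} n} (γ : GluingSeq M W) (f : W ≃ₜ W'),
    (γ.transport f).map = f ∘ γ.map
  | _, _, _, .iso _, _ => rfl
  | _, _, _, .step π _ γ, f => by
    simp only [transport, map, γ.transport_map f]
    rfl

theorem IsBallImage.transport {M W W' : Mfd.{u} n} {π : M → W} {B : Set W} (h : IsBallImage π B)
    (f : W ≃ₜ W') : IsBallImage (f ∘ π) (f '' B) := by
  obtain ⟨Q, i, hQ, hi, hinj, rfl⟩ := h
  exact ⟨Q, i, hQ, hi, f.injective.comp hinj, by rw [Function.comp_assoc, Set.range_comp]⟩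

theorem GluingSeq.transport_has : ∀ {M W W' : Mfd.{u} n} (γ : GluingSeq M W) (f : W ≃ₜ W')
    {B : Set W}, γ.Has B → (γ.transport f).Has (f '' B)
  | _, _, _, .iso _, f, _, h => IsBallImage.transport h f
  | _, _, _, .step π _ γ, f, _, h => by
    rcases h with h | h
    · left
      rw [γ.transport_map f]
      exact h.transport f
    · exact Or.inr (γ.transport_has f h)

theorem innermost_image {α β : Type u} (f : α ≃ β) {K : Set (Set α)} {B : Set α} :
    Innermost (Set.image f '' K) (f '' B) ↔ Innermost K B := by
  have hinj : Function.Injective (Set.image f) := Set.image_injective.mpr f.injective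
  have hlt : ∀ B' : Set α, f '' B' ⊂ f '' B ↔ B' ⊂ B := fun B' =>
    f.injective.injOn.image_ssubset_image_iff (Set.subset_univ _) (Set.subset_univ _)
  simp only [Innermost, hinj.mem_set_image, Set.forall_mem_image, hlt]

namespace FieldCategory

variable (C : FieldCategory.{u} R n)

theorem IsBlobDiagram.transport {W W' : Mfd.{u} n} (e : W ≃ₜ W') {K : Set (Set W)}
    {s : C.Field n W →₀ R} (h : C.IsBlobDiagram K s) :
    C.IsBlobDiagram (Set.image e '' K)
      (s.mapDomain (C.res e.symm e.symm.isOpenEmbedding)) := by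
  obtain ⟨d⟩ := h
  have hto : ∀ a, (d.D.γ.transport e).map ∘ d.D.i a = e ∘ d.D.toFun a := fun a => by
    rw [GluingSeq.transport_map]
    rfl
  have hr : ∀ a, Set.range ((d.D.γ.transport e).map ∘ d.D.i a) =
      e '' Set.range (d.D.toFun a) := fun a => by rw [hto, Set.range_comp]
  have hinj : Function.Injective (Set.image e) := Set.image_injective.mpr e.injective
  refine ⟨
    { D := { d.D with γ := d.D.γ.transport e }
      has := ?_
      N := d.N
      inj := fun a ha => ?_
      bijOn := ⟨?_, ?_, ?_⟩
      v := d.v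
      null := d.null
      single := d.single
      g := fun m => C.res e.symm e.symm.isOpenEmbedding (d.g m)
      glued := fun m hm => ?_
      eq := ?_ }⟩
  · rintro _ ⟨B, hB, rfl⟩
    exact d.D.γ.transport_has e (d.has B hB)
  · change Function.Injective ((d.D.γ.transport e).map ∘ d.D.i a)
    rw [hto]
    exact e.injective.comp (d.inj a ha)
  · intro a ha
    change Innermost _ (Set.range ((d.D.γ.transport e).map ∘ d.D.i a))
    rw [hr]
    exact (innermost_image e.toEquiv).2 (d.bijOn.mapsTo ha)
  · intro a ha a' ha' h
    refine d.bijOn.injOn ha ha' (hinj ?_)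
    exact (hr a).symm.trans (h.trans (hr a'))
  · rintro B' hB'
    obtain ⟨B, _, rfl⟩ := hB'.1
    obtain ⟨a, ha, rfl⟩ := d.bijOn.surjOn ((innermost_image e.toEquiv).1 hB')
    exact ⟨a, ha, hr a⟩
  · change C.Glued (d.D.γ.transport e).map m _
    rw [GluingSeq.transport_map, C.glued_comp le_rfl _ _ ⟨_, rfl⟩ (IsGluing.homeo e)]
    refine ⟨_, d.glued m hm, (C.glued_homeo le_rfl e _ _).2 ?_⟩
    rw [C.res_res_eq' (k := id) _ _ IsOpenEmbedding.id (by ext x; simp)]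
    exact C.res_id le_rfl _ _
  · exact (congrArg (Finsupp.mapDomain _) d.eq).trans Finsupp.mapDomain_comp.symm

theorem ambientMap_mem {W W' : Mfd.{u} n} (e : W ≃ₜ W') {k : ℕ} {x : C.Ambient W}
    (hx : x ∈ C.blobGroup W k) : C.ambientMap e x ∈ C.blobGroup W' k := by
  induction hx using Submodule.span_induction with
  | mem x hx =>
    obtain ⟨b, s, hb, hs, rfl⟩ := hx
    rw [ambientMap_diagram]
    refine Submodule.subset_span ⟨_, _, (Set.image_injective.mpr e.injective).comp hb, ?_, rfl⟩
    have := hs.transport C e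
    rwa [← Set.range_comp] at this
  | zero => simp
  | add x y _ _ hx hy => rw [map_add]; exact Submodule.add_mem _ hx hy
  | smul a x _ hx => rw [map_smul]; exact Submodule.smul_mem _ _ hx

theorem ambientMap_differential {W W' : Mfd.{u} n} (e : W ≃ₜ W') (k : ℕ) {x : C.Ambient W}
    (hx : x ∈ C.blobGroup W (k + 1)) :
    C.differential W' (C.ambientMap e x) = C.ambientMap e (C.differential W x) := by
  induction hx using Submodule.span_induction with
  | mem x hx =>
    obtain ⟨b, s, hb, hs, rfl⟩ := hx
    rw [ambientMap_diagram, differential_diagram, differential_diagram, map_sum]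
    refine Finset.sum_congr rfl fun i _ => ?_
    rw [map_smul, ambientMap_diagram]
    rfl
  | zero => simp
  | add x y _ _ hx hy => simp only [map_add, hx, hy]
  | smul a x _ hx => simp only [map_smul, hx]

theorem ambientMap_refl (W : Mfd.{u} n) : C.ambientMap (Homeomorph.refl W) = LinearMap.id := by
  have h1 : Set.image (Homeomorph.refl W) = id := by ext1 s; exact Set.image_id s
  have h2 : C.res (Homeomorph.refl W).symm (Homeomorph.refl W).symm.isOpenEmbedding = id := by
    ext1 f; exact C.res_id le_rfl _ f
  rw [ambientMap, h1, h2, Finsupp.lmapDomain_id, Finsupp.lmapDomain_id, ExteriorAlgebra.map_id]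
  exact TensorProduct.map_id

theorem ambientMap_trans {W W' W'' : Mfd.{u} n} (e : W ≃ₜ W') (f : W' ≃ₜ W'') :
    C.ambientMap (e.trans f) = C.ambientMap f ∘ₗ C.ambientMap e := by
  have h1 : Set.image (e.trans f) = Set.image f ∘ Set.image e := by
    ext1 s; exact Set.image_comp f e s
  have h2 : C.res (e.trans f).symm (e.trans f).symm.isOpenEmbedding =
      C.res f.symm f.symm.isOpenEmbedding ∘ C.res e.symm e.symm.isOpenEmbedding := by
    ext1 g
    exact (C.res_res_eq' f.symm.isOpenEmbedding e.symm.isOpenEmbedding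
      (e.trans f).symm.isOpenEmbedding rfl g).symm
  rw [ambientMap, h1, h2, Finsupp.lmapDomain_comp, Finsupp.lmapDomain_comp,
    ← ExteriorAlgebra.map_comp_map, ambientMap, ambientMap, ← TensorProduct.map_comp]
  rfl

/-- The map `B_k(W) → B_k(W')` induced by a homeomorphism. -/
noncomputable def blobMap {W W' : Mfd.{u} n} (e : W ≃ₜ W') (k : ℕ) :
    C.blobGroup W k →ₗ[R] C.blobGroup W' k :=
  (C.ambientMap e).restrict fun _ hx => C.ambientMap_mem e hx

/-- The blob complex, as a functor from `n`-manifolds and homeomorphisms to chain complexes. -/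
noncomputable def blobFunctor : Mfd.{u} n ⥤ ChainComplex (ModuleCat.{u} R) ℕ where
  obj W := C.blobComplex W
  map {W W'} e := ChainComplex.ofHom (fun k => ModuleCat.ofHom (C.blobMap e k)) fun k => by
    simp only [blobComplex, ChainComplex.of_d]
    exact ModuleCat.hom_ext <| LinearMap.ext fun x =>
      Subtype.ext (C.ambientMap_differential e k x.2)
  map_id W := by
    ext k x
    exact Subtype.ext (LinearMap.congr_fun (C.ambientMap_refl W) x.1)
  map_comp {W W' W''} e f := by
    ext k x
    exact Subtype.ext (LinearMap.congr_fun (C.ambientMap_trans e f) x.1)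

end FieldCategory

/-- Disjoint union of manifolds, as a functor. -/
def disjointUnion (n : ℕ) : Mfd.{u} n × Mfd.{u} n ⥤ Mfd.{u} n where
  obj p := p.1.sum p.2
  map {p q} e := (Homeomorph.sumCongr e.1 e.2 : p.1 ⊕ p.2 ≃ₜ q.1 ⊕ q.2)
  map_id p := by
    refine Homeomorph.ext ?_
    rintro (x | x) <;> rfl
  map_comp e f := by
    refine Homeomorph.ext ?_
    rintro (x | x) <;> rfl

end BlobComplex

namespace BlobComplex

open Topology TensorProduct

/-! ### Disjoint unions and restrictions of sequences of gluings -/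

section Sequences

variable {n : ℕ} {M M' W E A A' M₁ M₂ W₁ W₂ : Mfd.{u} n}

/-! The isomorphism is the product of diagrams: $(b_1\wedge\dots\wedge b_p)\otimes s$ on $A$ and
$(c_1\wedge\dots\wedge c_q)\otimes t$ on $B$ are sent to $(b_1\wedge\dots\wedge b_p\wedge
c_1\wedge\dots\wedge c_q)\otimes(s\times t)$ on $A\sqcup B$, where $s\times t$ comes from reading a
field on $A\sqcup B$ as a pair of fields.

Geometrically, balls are connected and nonempty. Hence every initial piece and every blob in
$A\sqcup B$ lies in exactly one of the two parts, a blob is innermost exactly if it is innermost in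
its own part, and a ball decomposition of $A\sqcup B$ restricts to each part. Conversely, two ball
decompositions have a disjoint union, obtained by doing one sequence of gluings after the other.
Since gluing of fields is compatible with disjoint unions, products of blob diagrams are blob
diagrams (`IsBlobDiagram.sum`), and a blob diagram on $A\sqcup B$ either has $s=0$ or is a product
(`IsBlobDiagram.split`). After sorting the blobs, at the cost of a sign, this makes the product map
surjective (`exists_prodMap_eq`).

It is a chain map because the differential is contraction with the form that is $1$ on every blob,
and contraction is an antiderivation of the exterior algebra: this is the Leibniz rule
`differential_prodMap`, with the sign $(-1)^p$ of the tensor product of complexes.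

Injectivity is algebra. The exterior algebra of a direct sum is the tensor product of the exterior
algebras, and the images of subsets of $A$ and of $B$ in $A\sqcup B$ can agree only for the empty
set, which is never a blob. So the product on the ambient modules has a left inverse up to removal
of the empty set (`exists_prodMap_retract`), and the numbers of blobs on the two sides separate the
bidegrees (`exists_bidegree_comp`). What remains is that $\mathcal B_p(A)\otimes\mathcal B_q(B)$
injects into the tensor product of the ambient modules (`map_subtype_injective`). The ambient
modules are free, and over a principal ideal domain submodules of free modules are flat; this is
what the assumption on $R$ is for.

Naturality holds already for the product on the ambient modules (`ambientMap_prodMap`). -/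

theorem IsGluingAlong.sum_right {π : A → A'} {Y Y' : Set A} (h : IsGluingAlong π Y Y') :
    IsGluingAlong (M := E.sum A) (M' := E.sum A') (Sum.map id π) (Sum.inr '' Y) (Sum.inr '' Y') where
  piece := h.piece.image (M := E.sum A) IsOpenEmbedding.inr
  piece' := h.piece'.image (M := E.sum A) IsOpenEmbedding.inr
  disj := (Set.disjoint_image_iff Sum.inr_injective).mpr h.disj
  cont := continuous_id.sumMap h.cont
  surj := Function.surjective_id.sumMap h.surj
  fiber := by
    rintro (x | x) (y | y) hxy
    · exact Or.inl (congrArg _ (Sum.inl_injective hxy))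
    · cases hxy
    · cases hxy
    · rcases h.fiber x y (Sum.inr_injective hxy) with h1 | h1 | h1
      · exact Or.inl (congrArg _ h1)
      · exact Or.inr (Or.inl ⟨⟨_, h1.1, rfl⟩, ⟨_, h1.2, rfl⟩⟩)
      · exact Or.inr (Or.inr ⟨⟨_, h1.1, rfl⟩, ⟨_, h1.2, rfl⟩⟩)
  image := by
    have : ∀ s : Set A, (Sum.map id π '' (Sum.inr '' s) : Set (E ⊕ A')) = Sum.inr '' (π '' s) :=
      fun s => by simp only [Set.image_image, Sum.map_inr]
    exact (this Y).trans ((congrArg _ h.image).trans (this Y').symm)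

/-- The disjoint union of a homeomorphism and a sequence of gluings. -/
def GluingSeq.sumHomeo (e : M₁ ≃ₜ W₁) :
    {M W : Mfd.{u} n} → GluingSeq M W → GluingSeq (M₁.sum M) (W₁.sum W)
  | M, W, .iso f => .iso (M := M₁.sum M) (W := W₁.sum W) (e.sumCongr f)
  | M, _, .step (M' := M') π hπ γ => .step (M := M₁.sum M) (M' := M₁.sum M') (Sum.map id π)
      (by obtain ⟨_, _, h⟩ := hπ; exact ⟨_, _, h.sum_right⟩) (γ.sumHomeo e)

/-- The disjoint union of two sequences of gluings: first perform the one, then the other. -/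
def GluingSeq.sum : {M₁ W₁ : Mfd.{u} n} → GluingSeq M₁ W₁ → GluingSeq M₂ W₂ →
    GluingSeq (M₁.sum M₂) (W₁.sum W₂)
  | _, _, .iso e, δ => δ.sumHomeo e
  | M, _, .step (M' := M') π hπ γ, δ => .step (M := M.sum M₂) (M' := M'.sum M₂) (Sum.map π id)
      (by obtain ⟨_, _, h⟩ := hπ; exact ⟨_, _, h.sum_left⟩) (γ.sum δ)

theorem GluingSeq.sumHomeo_map (e : M₁ ≃ₜ W₁) : ∀ {M W : Mfd.{u} n} (γ : GluingSeq M W),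
    (γ.sumHomeo e).map = Sum.map e γ.map
  | _, _, .iso _ => rfl
  | _, _, .step π _ γ => by
    funext x
    rcases x with x | x
    exacts [congrFun (γ.sumHomeo_map e) (Sum.inl x), congrFun (γ.sumHomeo_map e) (Sum.inr (π x))]

theorem GluingSeq.sum_map (δ : GluingSeq M₂ W₂) : ∀ {M₁ W₁ : Mfd.{u} n} (γ : GluingSeq M₁ W₁),
    (γ.sum δ).map = Sum.map γ.map δ.map
  | _, _, .iso e => δ.sumHomeo_map e
  | _, _, .step π _ γ => by
    funext x
    rcases x with x | x
    exacts [congrFun (sum_map δ γ) (Sum.inl (π x)), congrFun (sum_map δ γ) (Sum.inr x)]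

theorem IsBallImage.inl {π₁ : M₁ → W₁} {π₂ : M₂ → W₂} {B : Set W₁} (h : IsBallImage π₁ B) :
    IsBallImage (M := M₁.sum M₂) (W := W₁.sum W₂) (Sum.map π₁ π₂) (Sum.inl '' B) := by
  obtain ⟨Q, i, hQ, hi, hinj, rfl⟩ := h
  exact ⟨Q, Sum.inl ∘ i, hQ, IsOpenEmbedding.inl.comp hi,
    Sum.inl_injective.comp hinj, Set.range_comp Sum.inl (π₁ ∘ i)⟩

theorem IsBallImage.inr {π₁ : M₁ → W₁} {π₂ : M₂ → W₂} {B : Set W₂} (h : IsBallImage π₂ B) :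
    IsBallImage (M := M₁.sum M₂) (W := W₁.sum W₂) (Sum.map π₁ π₂) (Sum.inr '' B) := by
  obtain ⟨Q, i, hQ, hi, hinj, rfl⟩ := h
  exact ⟨Q, Sum.inr ∘ i, hQ, IsOpenEmbedding.inr.comp hi,
    Sum.inr_injective.comp hinj, Set.range_comp Sum.inr (π₂ ∘ i)⟩

/-- While the left gluings are performed, the right summand is still `M₂`. A component of a stage of
`γ` is therefore a component of that stage with `M₂` added, and `sum_map` shows that its image in
the final manifold is the expected one. -/
theorem GluingSeq.sum_has_inl (δ : GluingSeq M₂ W₂) : ∀ {M₁ W₁ : Mfd.{u} n}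
    (γ : GluingSeq M₁ W₁) {B : Set W₁}, γ.Has B →
      (γ.sum δ).Has (W := W₁.sum W₂) (Sum.inl '' B)
  | _, _, .iso e, B, h => by
    refine has_of_isBallImage ?_
    rw [sum_map]
    exact IsBallImage.inl h
  | _, _, .step π hπ γ, B, h => by
    rcases h with h | h
    · refine has_of_isBallImage ?_
      rw [sum_map]
      exact IsBallImage.inl h
    · exact Or.inr (sum_has_inl δ γ h)

/-- Every stage of `δ` occurs with `M₁` added, and `e` affects only this added summand. -/
theorem GluingSeq.sumHomeo_has_inr (e : M₁ ≃ₜ W₁) : ∀ {M₂ W₂ : Mfd.{u} n}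
    (δ : GluingSeq M₂ W₂) {B : Set W₂}, δ.Has B →
      (δ.sumHomeo e).Has (W := W₁.sum W₂) (Sum.inr '' B)
  | _, _, .iso f, B, h => IsBallImage.inr h
  | _, _, .step π hπ γ, B, h => by
    rcases h with h | h
    · refine has_of_isBallImage ?_
      rw [sumHomeo_map]
      exact IsBallImage.inr h
    · exact Or.inr (sumHomeo_has_inr e γ h)

/-- All gluings of `γ` come first, so the stages of `δ` are found by walking past them to the final
homeomorphism of `γ`. -/
theorem GluingSeq.sum_has_inr {δ : GluingSeq M₂ W₂} {B : Set W₂} (h : δ.Has B) :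
    ∀ {M₁ W₁ : Mfd.{u} n} (γ : GluingSeq M₁ W₁),
      (γ.sum δ).Has (W := W₁.sum W₂) (Sum.inr '' B)
  | _, _, .iso e => δ.sumHomeo_has_inr e h
  | _, _, .step _ _ γ => Or.inr (sum_has_inr h γ)

/-- The restriction of a sequence of gluings to a union of components of the result. -/
def GluingSeq.restrict : {M W : Mfd.{u} n} → (γ : GluingSeq M W) → (S : Set W) → (hS : IsClopen S) →
    GluingSeq (M.sub (γ.map ⁻¹' S) (hS.preimage γ.continuous_map)) (W.sub S hS)
  | M, W, .iso e, S, hS => .iso (M := M.sub (e ⁻¹' S) (hS.preimage e.continuous)) (W := W.sub S hS)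
      (e.subtype fun _ => Iff.rfl)
  | _, _, .step π hπ γ, S, hS => .step 
      (M := Mfd.sub _ (π ⁻¹' (γ.map ⁻¹' S)) (hS.preimage (GluingSeq.step π hπ γ).continuous_map))
      (M' := Mfd.sub _ (γ.map ⁻¹' S) (hS.preimage γ.continuous_map)) ((γ.map ⁻¹' S).restrictPreimage π)
      (by obtain ⟨_, _, h⟩ := hπ; exact ⟨_, _, h.restrict _ (hS.preimage γ.continuous_map)⟩)
      (γ.restrict S hS)

theorem GluingSeq.restrict_map : ∀ {M W : Mfd.{u} n} (γ : GluingSeq M W) (S : Set W)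
    (hS : IsClopen S) (x : M.sub (γ.map ⁻¹' S) (hS.preimage γ.continuous_map)),
    ((γ.restrict S hS).map x).1 = γ.map x.1
  | _, _, .iso _, _, _, _ => rfl
  | _, _, .step π _ γ, S, hS, x =>
    γ.restrict_map S hS ((γ.map ⁻¹' S).restrictPreimage π x)

/-- The ball stays inside the restricted manifold because its image lies in `S`. The map `ρ` enters
only through its values in `W`, which is the information that `restrict_map` gives at each stage. -/
theorem IsBallImage.restrict {π : M → W} {B : Set W} (h : IsBallImage π B) {S : Set W}
    (hS : IsClopen S) (hT : IsClopen (π ⁻¹' S)) (hB : B ⊆ S)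
    (ρ : M.sub (π ⁻¹' S) hT → W.sub S hS) (hρ : ∀ x, (ρ x).1 = π x.1) :
    IsBallImage ρ (Subtype.val ⁻¹' B) := by
  obtain ⟨Q, i, hQ, hi, hinj, rfl⟩ := h
  let l : Q → M.sub (π ⁻¹' S) hT := fun x => ⟨i x, hB ⟨x, rfl⟩⟩
  have hval : ∀ x, (ρ (l x)).1 = π (i x) := fun x => hρ _
  refine ⟨Q, l, hQ, IsOpenEmbedding.of_comp _ hT.isOpen.isOpenEmbedding_subtypeVal hi, ?_, ?_⟩
  · intro x y h
    exact hinj ((hval x).symm.trans ((congrArg Subtype.val h).trans (hval y)))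
  · refine Set.Subset.antisymm ?_ ?_
    · rintro _ ⟨x, rfl⟩
      exact ⟨x, (hval x).symm⟩
    · rintro y ⟨x, hx⟩
      exact ⟨x, Subtype.ext ((hval x).trans hx)⟩

theorem GluingSeq.restrict_has : ∀ {M W : Mfd.{u} n} (γ : GluingSeq M W) {S : Set W}
    (hS : IsClopen S) {B : Set W}, γ.Has B → B ⊆ S →
    (γ.restrict S hS).Has (Subtype.val ⁻¹' B)
  | _, _, .iso e, S, hS, B, h, hB =>
    has_of_isBallImage (IsBallImage.restrict h hS _ hB _ (restrict_map (.iso e) S hS))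
  | _, _, .step π hπ γ, S, hS, B, h, hB => by
    rcases h with h | h
    · exact has_of_isBallImage (IsBallImage.restrict h hS _ hB _ (restrict_map (.step π hπ γ) S hS))
    · exact Or.inr (γ.restrict_has hS h hB)

/-- All manifolds here are compact Hausdorff, so an open embedding is also a closed map. -/
theorem isClopen_range {i : A → W} (hi : IsOpenEmbedding i) : IsClopen (Set.range i) :=
  ⟨hi.continuous.isClosedMap.isClosed_range, hi.isOpen_range⟩

/-- The part of `M` that lies over the union of components `i : A → W`. -/
abbrev GluingSeq.over (γ : GluingSeq M W) {i : A → W} (hi : IsOpenEmbedding i) : Mfd.{u} n :=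
  M.sub (γ.map ⁻¹' Set.range i) ((isClopen_range hi).preimage γ.continuous_map)

/-- The restriction of a sequence of gluings to a union of components `i : A → W`. -/
noncomputable def GluingSeq.pullback (γ : GluingSeq M W) {i : A → W} (hi : IsOpenEmbedding i) :
    GluingSeq (γ.over hi) A :=
  (γ.restrict _ (isClopen_range hi)).transport
    (hi.isEmbedding.toHomeomorph.symm : W.sub _ (isClopen_range hi) ≃ₜ A)

/-- This square determines the map of the pulled back sequence, since `i` is injective; the later
arguments use it in place of the construction by restriction and transport. -/
theorem GluingSeq.pullback_map (γ : GluingSeq M W) {i : A → W} (hi : IsOpenEmbedding i)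
    (x : γ.over hi) : i ((γ.pullback hi).map x) = γ.map x.1 := by
  refine Eq.trans (congrArg i (congrFun (transport_map _ _) x)) ?_
  exact (congrArg Subtype.val (hi.isEmbedding.toHomeomorph.apply_symm_apply _)).trans
    (γ.restrict_map _ (isClopen_range hi) x)

theorem GluingSeq.pullback_has (γ : GluingSeq M W) {i : A → W} (hi : IsOpenEmbedding i)
    {B : Set A} (h : γ.Has (i '' B)) : (γ.pullback hi).Has B := by
  have := transport_has _ (hi.isEmbedding.toHomeomorph.symm : W.sub _ (isClopen_range hi) ≃ₜ A)
    (γ.restrict_has (isClopen_range hi) h (Set.image_subset_range _ _))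
  refine Eq.mp (congrArg (GluingSeq.Has _) (Set.ext fun x => ?_)) this
  symm
  constructor
  · intro hx
    exact ⟨⟨i x, x, rfl⟩, ⟨x, hx, rfl⟩, hi.isEmbedding.toHomeomorph.symm_apply_apply x⟩
  · rintro ⟨⟨_, y, rfl⟩, hy, rfl⟩
    obtain ⟨z, hz, e⟩ := hy
    obtain rfl := hi.injective e
    have : hi.isEmbedding.toHomeomorph.symm ⟨i z, z, rfl⟩ = z :=
      hi.isEmbedding.toHomeomorph.symm_apply_apply z
    exact this.symm ▸ hz

/-- Forgets the stage at which the blob occurs. Being a continuous image of a ball is all that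
nonemptiness and connectedness of a blob require. -/
theorem GluingSeq.has_isBall {γ : GluingSeq M W} {B : Set W} (h : γ.Has B) :
    ∃ (Q : Mfd.{u} n) (i : Q → W), Q.IsBall ∧ Continuous i ∧ Set.range i = B := by
  induction γ with
  | iso e =>
    obtain ⟨Q, i, hQ, hi, -, hr⟩ := h
    exact ⟨Q, _, hQ, e.continuous.comp hi.continuous, hr⟩
  | step π hπ γ ih =>
    rcases h with h | h
    · obtain ⟨Q, i, hQ, hi, -, hr⟩ := h
      exact ⟨Q, _, hQ, (GluingSeq.step π hπ γ).continuous_map.comp hi.continuous, hr⟩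
    · exact ih h

theorem GluingSeq.has_nonempty {γ : GluingSeq M W} {B : Set W} (h : γ.Has B) : B.Nonempty := by
  obtain ⟨Q, i, hQ, -, rfl⟩ := γ.has_isBall h
  have := hQ.nonempty
  exact Set.range_nonempty i

/-- A ball is connected and both ranges are clopen, so the position of one point decides. -/
theorem GluingSeq.has_subset_or {γ : GluingSeq M W} {B : Set W} (h : γ.Has B) {i : M₁ → W}
    {j : M₂ → W} (hij : IsPartition₂ i j) : B ⊆ Set.range i ∨ B ⊆ Set.range j := by
  obtain ⟨Q, k, hQ, hk, rfl⟩ := γ.has_isBall h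
  obtain ⟨q⟩ := hQ.nonempty
  obtain ⟨y | y, hy⟩ := hij.bij.2 (k q)
  · left
    rintro _ ⟨x, rfl⟩
    exact hQ.subset_of_mem hk (isClopen_range hij.embl) ⟨y, hy⟩ x
  · right
    rintro _ ⟨x, rfl⟩
    exact hQ.subset_of_mem hk (isClopen_range hij.embr) ⟨y, hy⟩ x

theorem IsPartition₂.of_disjoint {i : A → W} {j : E → W} (hi : IsOpenEmbedding i)
    (hj : IsOpenEmbedding j) (h : ∀ x y, i x ≠ j y) (h' : ∀ w, w ∈ Set.range i ∨ w ∈ Set.range j) :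
    IsPartition₂ i j where
  embl := hi
  embr := hj
  bij := by
    constructor
    · rintro (x | x) (y | y) e
      · exact congrArg _ (hi.injective e)
      · exact (h x y e).elim
      · exact (h y x e.symm).elim
      · exact congrArg _ (hj.injective e)
    · intro w
      rcases h' w with ⟨x, rfl⟩ | ⟨x, rfl⟩
      exacts [⟨Sum.inl x, rfl⟩, ⟨Sum.inr x, rfl⟩]

theorem IsPartition₂.ne {i : A → W} {j : E → W} (h : IsPartition₂ i j) (x : A) (y : E) :
    i x ≠ j y := fun e => by
  have := h.bij.1 (a₁ := Sum.inl x) (a₂ := Sum.inr y) e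
  cases this

theorem IsPartition₂.mem_or {i : A → W} {j : E → W} (h : IsPartition₂ i j) (w : W) :
    w ∈ Set.range i ∨ w ∈ Set.range j := by
  obtain ⟨x | x, rfl⟩ := h.bij.2 w
  exacts [Or.inl ⟨x, rfl⟩, Or.inr ⟨x, rfl⟩]

theorem GluingSeq.isPartition₂_over (γ : GluingSeq M W) {i : A → W} {j : E → W}
    (h : IsPartition₂ i j) : IsPartition₂ (A := γ.over h.embl) (B := γ.over h.embr) (X := M)
      Subtype.val Subtype.val := by
  refine .of_disjoint
    ((isClopen_range h.embl).preimage γ.continuous_map).isOpen.isOpenEmbedding_subtypeVal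
    ((isClopen_range h.embr).preimage γ.continuous_map).isOpen.isOpenEmbedding_subtypeVal ?_ ?_
  · rintro ⟨x, a, ha⟩ ⟨y, b, hb⟩ e
    have e' : x = y := e
    exact h.ne a b (ha.trans (e' ▸ hb.symm))
  · intro m
    rcases h.mem_or (γ.map m) with hm | hm
    exacts [Or.inl ⟨⟨m, hm⟩, rfl⟩, Or.inr ⟨⟨m, hm⟩, rfl⟩]

/-! ### Ball decompositions of a disjoint union versus pairs of ball decompositions. -/

/-! ### Disjoint unions and restrictions of ball decompositions -/

/-- The members of the disjoint union of two families of manifolds. -/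
def sumFamily {ι κ : Type} (X : ι → Mfd.{u} n) (Y : κ → Mfd.{u} n) : ι ⊕ κ → Mfd.{u} n
  | .inl a => X a
  | .inr b => Y b

/-- The inclusions of the members of the disjoint union of two families of manifolds. -/
def sumIncl {ι κ : Type} {X : ι → Mfd.{u} n} {Y : κ → Mfd.{u} n} (i : ∀ a, X a → M₁)
    (j : ∀ b, Y b → M₂) : ∀ c, sumFamily X Y c → M₁.sum M₂
  | .inl a => Sum.inl ∘ i a
  | .inr b => Sum.inr ∘ j b

theorem IsPartition.sum {ι κ : Type} {X : ι → Mfd.{u} n} {Y : κ → Mfd.{u} n} {i : ∀ a, X a → M₁}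
    {j : ∀ b, Y b → M₂} (hi : IsPartition i) (hj : IsPartition j) :
    IsPartition (sumIncl i j) where
  emb := by
    rintro (a | b)
    exacts [IsOpenEmbedding.inl.comp (hi.emb a), IsOpenEmbedding.inr.comp (hj.emb b)]
  bij := by
    constructor
    · rintro ⟨a | a, x⟩ ⟨b | b, y⟩ h
      · have h2 := hi.bij.1 (a₁ := ⟨a, x⟩) (a₂ := ⟨b, y⟩) (Sum.inl_injective h)
        cases h2
        rfl
      · cases h
      · cases h
      · have h2 := hj.bij.1 (a₁ := ⟨a, x⟩) (a₂ := ⟨b, y⟩) (Sum.inr_injective h)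
        cases h2
        rfl
    · rintro (x | x)
      · obtain ⟨⟨a, y⟩, rfl⟩ := hi.bij.2 x
        exact ⟨⟨.inl a, y⟩, rfl⟩
      · obtain ⟨⟨a, y⟩, rfl⟩ := hj.bij.2 x
        exact ⟨⟨.inr a, y⟩, rfl⟩

/-- The disjoint union of two ball decompositions. -/
def BallDecomp.sum (D₁ : BallDecomp W₁) (D₂ : BallDecomp W₂) : BallDecomp (W₁.sum W₂) where
  ι := D₁.ι ⊕ D₂.ι
  X := sumFamily D₁.X D₂.X
  ball := by rintro (a | a); exacts [D₁.ball a, D₂.ball a]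
  M := D₁.M.sum D₂.M
  i := sumIncl D₁.i D₂.i
  part := D₁.part.sum D₂.part
  γ := D₁.γ.sum D₂.γ

theorem BallDecomp.sum_toFun_inl (D₁ : BallDecomp W₁) (D₂ : BallDecomp W₂) (a : D₁.ι) :
    (D₁.sum D₂).toFun (.inl a) = Sum.inl ∘ D₁.toFun a := by
  funext x
  exact congrFun (GluingSeq.sum_map D₂.γ D₁.γ) (Sum.inl (D₁.i a x))

theorem BallDecomp.sum_toFun_inr (D₁ : BallDecomp W₁) (D₂ : BallDecomp W₂) (a : D₂.ι) :
    (D₁.sum D₂).toFun (.inr a) = Sum.inr ∘ D₂.toFun a := by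
  funext x
  exact congrFun (GluingSeq.sum_map D₂.γ D₁.γ) (Sum.inr (D₂.i a x))

/-- The pieces of a ball decomposition that lie in the union of components `i : A → W`. -/
abbrev BallDecomp.Over (D : BallDecomp W) (i : A → W) : Type :=
  {a : D.ι // ∀ x, D.toFun a x ∈ Set.range i}

theorem BallDecomp.continuous_toFun (D : BallDecomp W) (a : D.ι) : Continuous (D.toFun a) :=
  D.γ.continuous_map.comp (D.part.emb a).continuous

open Classical in
/-- The restriction of a ball decomposition to a union of components `i : A → W`. -/
noncomputable def BallDecomp.pullback (D : BallDecomp W) {i : A → W} (hi : IsOpenEmbedding i) :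
    BallDecomp A where
  ι := D.Over i
  X a := D.X a.1
  ball a := D.ball a.1
  M := D.γ.over hi
  i a x := ⟨D.i a.1 x, a.2 x⟩
  part :=
    { emb := fun a => IsOpenEmbedding.of_comp _
        ((isClopen_range hi).preimage D.γ.continuous_map).isOpen.isOpenEmbedding_subtypeVal
        (D.part.emb a.1)
      bij := by
        constructor
        · rintro ⟨⟨a, ha⟩, x⟩ ⟨⟨b, hb⟩, y⟩ h
          have h2 := D.part.bij.1 (a₁ := ⟨a, x⟩) (a₂ := ⟨b, y⟩) (congrArg Subtype.val h)
          cases h2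
          rfl
        · rintro ⟨m, hm⟩
          obtain ⟨⟨a, x⟩, rfl⟩ := D.part.bij.2 m
          -- The piece through `m` meets the clopen preimage of `range i`; being connected, it lies
          -- in it entirely, which makes it a member of `D.Over i`.
          exact ⟨⟨⟨a, (D.ball a).subset_of_mem (D.continuous_toFun a) (isClopen_range hi) hm⟩, x⟩,
            rfl⟩ }
  γ := D.γ.pullback hi

theorem BallDecomp.pullback_toFun (D : BallDecomp W) {i : A → W} (hi : IsOpenEmbedding i)
    (a : D.Over i) : i ∘ (D.pullback hi).toFun a = D.toFun a.1 :=
  funext fun x => D.γ.pullback_map hi ⟨D.i a.1 x, a.2 x⟩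

/-- An initial piece is connected, so it lies over one of the parts, and nonempty, so it cannot lie
over both. -/
theorem BallDecomp.over_bijective (D : BallDecomp W) {i : A → W} {j : E → W}
    (h : IsPartition₂ i j) :
    Function.Bijective (Sum.elim Subtype.val Subtype.val : D.Over i ⊕ D.Over j → D.ι) := by
  have hne : ∀ (a : D.Over i) (b : D.Over j), a.1 ≠ b.1 := by
    rintro ⟨a, ha⟩ ⟨b, hb⟩ e
    obtain rfl : a = b := e
    obtain ⟨x⟩ := (D.ball a).nonempty
    obtain ⟨y, hy⟩ := ha x
    obtain ⟨z, hz⟩ := hb x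
    exact h.ne y z (hy.trans hz.symm)
  constructor
  · rintro (a | a) (b | b) e
    · exact congrArg _ (Subtype.ext e)
    · exact (hne a b e).elim
    · exact (hne b a e.symm).elim
    · exact congrArg _ (Subtype.ext e)
  · intro a
    obtain ⟨x⟩ := (D.ball a).nonempty
    rcases h.mem_or (D.toFun a x) with hx | hx
    · exact ⟨.inl ⟨a, (D.ball a).subset_of_mem (D.continuous_toFun a) (isClopen_range h.embl) hx⟩,
        rfl⟩
    · exact ⟨.inr ⟨a, (D.ball a).subset_of_mem (D.continuous_toFun a) (isClopen_range h.embr) hx⟩,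
        rfl⟩

end Sequences

end BlobComplex

namespace BlobComplex

open Topology TensorProduct

/-! ### Blob diagrams on disjoint unions -/

section Innermost

variable {α β γ : Type u} {i : α → γ} {j : β → γ}

/-- A member coming from the other side has a point outside `range i`, so it can neither equal nor
be contained in `i '' B`. Here the nonemptiness of the members of `L` matters: an empty one would be
contained in everything. -/
theorem innermost_union_iff (hi : Function.Injective i) (hij : ∀ x y, i x ≠ j y) {K : Set (Set α)}
    {L : Set (Set β)} (hL : ∀ B ∈ L, B.Nonempty) {B : Set α} :
    Innermost (Set.image i '' K ∪ Set.image j '' L) (i '' B) ↔ Innermost K B := by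
  have hne : ∀ B' ∈ L, ¬ j '' B' ⊆ i '' B := by
    intro B' hB' h
    obtain ⟨y, hy⟩ := hL B' hB'
    obtain ⟨x, -, hx⟩ := h ⟨y, hy, rfl⟩
    exact hij x y hx
  have hmem : i '' B ∈ Set.image i '' K ∪ Set.image j '' L ↔ B ∈ K := by
    constructor
    · rintro (⟨B', hB', e⟩ | ⟨B', hB', e⟩)
      · exact (Set.image_injective.mpr hi e) ▸ hB'
      · exact (hne B' hB' e.subset).elim
    · exact fun h => Or.inl ⟨B, h, rfl⟩
  rw [Innermost, Innermost, hmem]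
  refine and_congr_right fun _ => ⟨fun h B' hB' hlt => ?_, ?_⟩
  · exact h (i '' B') (Or.inl ⟨B', hB', rfl⟩)
      ((hi.injOn.image_ssubset_image_iff (Set.subset_univ _) (Set.subset_univ _)).2 hlt)
  · rintro h _ (⟨B', hB', rfl⟩ | ⟨B', hB', rfl⟩) hlt
    · exact h B' hB'
        ((hi.injOn.image_ssubset_image_iff (Set.subset_univ _) (Set.subset_univ _)).1 hlt)
    · exact hne B' hB' hlt.subset

end Innermost

variable {n : ℕ} {R : Type u} [CommRing R]

namespace FieldCategory

variable (C : FieldCategory.{u} R n)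

/-! ### External products of linear combinations of fields. -/

section Cross

variable {A B X A' B' X' : Mfd.{u} n} {i : A → X} {j : B → X} (h : IsPartition₂ i j)
  {i' : A' → X'} {j' : B' → X'} (h' : IsPartition₂ i' j')

/-- A field on a disjoint union is a pair of fields. -/
noncomputable def fieldEquiv : C.Field n X ≃ C.Field n A × C.Field n B :=
  Equiv.ofBijective (fun f => (C.res i h.embl f, C.res j h.embr f))
    ⟨fun _ _ e => C.res_inj₂ h (congrArg Prod.fst e) (congrArg Prod.snd e), fun p => by
      obtain ⟨f, h1, h2⟩ := C.exists_res₂ h p.1 p.2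
      exact ⟨f, Prod.ext h1 h2⟩⟩

theorem fieldEquiv_apply (f : C.Field n X) :
    C.fieldEquiv h f = (C.res i h.embl f, C.res j h.embr f) := rfl

theorem res_fieldEquiv_symm_left (p : C.Field n A × C.Field n B) :
    C.res i h.embl ((C.fieldEquiv h).symm p) = p.1 :=
  congrArg Prod.fst ((C.fieldEquiv h).apply_symm_apply p)

theorem res_fieldEquiv_symm_right (p : C.Field n A × C.Field n B) :
    C.res j h.embr ((C.fieldEquiv h).symm p) = p.2 :=
  congrArg Prod.snd ((C.fieldEquiv h).apply_symm_apply p)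

/-- Linear combinations of fields on a disjoint union. -/
noncomputable def crossEquiv :
    (C.Field n A →₀ R) ⊗[R] (C.Field n B →₀ R) ≃ₗ[R] (C.Field n X →₀ R) :=
  finsuppTensorFinsupp' R _ _ ≪≫ₗ Finsupp.domLCongr (C.fieldEquiv h).symm

/-- The external product of linear combinations of fields. -/
noncomputable abbrev cross (s : C.Field n A →₀ R) (t : C.Field n B →₀ R) : C.Field n X →₀ R :=
  C.crossEquiv h (s ⊗ₜ t)

theorem cross_apply (s : C.Field n A →₀ R) (t : C.Field n B →₀ R) (f : C.Field n X) :
    C.cross h s t f = s (C.res i h.embl f) * t (C.res j h.embr f) := by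
  simp [crossEquiv, cross, fieldEquiv_apply, Finsupp.domLCongr_apply, Finsupp.equivMapDomain_apply]

theorem cross_single (a : C.Field n A) (b : C.Field n B) (r r' : R) :
    C.cross h (Finsupp.single a r) (Finsupp.single b r') =
      Finsupp.single ((C.fieldEquiv h).symm (a, b)) (r * r') := by
  simp [crossEquiv, cross, Finsupp.domLCongr_apply, -Finsupp.single_mul]

/-- The gluing maps of blob data are prescribed only on fields with nonzero coefficients, so
compatibility of `g` with `g₁` and `g₂` is asked only there. Off the support `g` may be replaced by
the product map, and then both sides are bilinear in `s` and `t`. -/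
theorem mapDomain_cross {s : C.Field n A →₀ R} {t : C.Field n B →₀ R}
    {g : C.Field n X → C.Field n X'} {g₁ : C.Field n A → C.Field n A'}
    {g₂ : C.Field n B → C.Field n B'}
    (h₁ : ∀ f, s (C.res i h.embl f) ≠ 0 → t (C.res j h.embr f) ≠ 0 →
      C.res i' h'.embl (g f) = g₁ (C.res i h.embl f))
    (h₂ : ∀ f, s (C.res i h.embl f) ≠ 0 → t (C.res j h.embr f) ≠ 0 →
      C.res j' h'.embr (g f) = g₂ (C.res j h.embr f)) :
    (C.cross h s t).mapDomain g = C.cross h' (s.mapDomain g₁) (t.mapDomain g₂) := by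
  have e1 : (C.cross h s t).mapDomain g = (C.cross h s t).mapDomain
      (fun f => (C.fieldEquiv h').symm (Prod.map g₁ g₂ (C.fieldEquiv h f))) := by
    refine Finsupp.mapDomain_congr fun f hf => ?_
    rw [Finsupp.mem_support_iff, cross_apply] at hf
    rw [Equiv.eq_symm_apply, fieldEquiv_apply, fieldEquiv_apply]
    exact Prod.ext (h₁ f (left_ne_zero_of_mul hf) (right_ne_zero_of_mul hf))
      (h₂ f (left_ne_zero_of_mul hf) (right_ne_zero_of_mul hf))
  rw [e1]
  -- The support conditions depend on `s` and `t` and would not pass to summands in the induction.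
  clear e1 h₁ h₂
  induction s using Finsupp.induction_linear with
  | zero => simp [cross]
  | add s s' hs hs' =>
    simp only [cross, TensorProduct.add_tmul, map_add, Finsupp.mapDomain_add] at hs hs' ⊢
    rw [hs, hs']
  | single a r =>
    induction t using Finsupp.induction_linear with
    | zero => simp [cross]
    | add t t' ht ht' =>
      simp only [cross, TensorProduct.tmul_add, map_add, Finsupp.mapDomain_add] at ht ht' ⊢
      rw [ht, ht']
    | single b r' =>
      rw [cross_single, Finsupp.mapDomain_single, Finsupp.mapDomain_single,
        Finsupp.mapDomain_single, cross_single, Equiv.apply_symm_apply]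
      rfl

theorem cross_res_comm {e : A ≃ₜ A'} {f : B ≃ₜ B'} {g : X ≃ₜ X'} (hi : g ∘ i = i' ∘ e)
    (hj : g ∘ j = j' ∘ f) (s : C.Field n A →₀ R) (t : C.Field n B →₀ R) :
    (C.cross h s t).mapDomain (C.res g.symm g.symm.isOpenEmbedding) =
      C.cross h' (s.mapDomain (C.res e.symm e.symm.isOpenEmbedding))
        (t.mapDomain (C.res f.symm f.symm.isOpenEmbedding)) := by
  have hi' : g.symm ∘ i' = i ∘ e.symm := by
    funext x
    obtain ⟨y, rfl⟩ := e.surjective x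
    rw [Function.comp_apply, Function.comp_apply, e.symm_apply_apply, Homeomorph.symm_apply_eq]
    exact (congrFun hi y).symm
  have hj' : g.symm ∘ j' = j ∘ f.symm := by
    funext x
    obtain ⟨y, rfl⟩ := f.surjective x
    rw [Function.comp_apply, Function.comp_apply, f.symm_apply_apply, Homeomorph.symm_apply_eq]
    exact (congrFun hj y).symm
  refine C.mapDomain_cross h h' (fun m _ _ => ?_) (fun m _ _ => ?_)
  · rw [C.res_res_eq' h'.embl g.symm.isOpenEmbedding
      (h.embl.comp e.symm.isOpenEmbedding) hi',
      C.res_res_eq' e.symm.isOpenEmbedding h.embl (h.embl.comp e.symm.isOpenEmbedding) rfl]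
  · rw [C.res_res_eq' h'.embr g.symm.isOpenEmbedding
      (h.embr.comp f.symm.isOpenEmbedding) hj',
      C.res_res_eq' f.symm.isOpenEmbedding h.embr (h.embr.comp f.symm.isOpenEmbedding) rfl]

end Cross

/-! ### Products of blob diagrams are blob diagrams. -/

section Sum

variable {W₁ W₂ M₁ M₂ : Mfd.{u} n}

/-- The disjoint union of two families of linear combinations of fields. -/
def sumV {ι κ : Type} {X : ι → Mfd.{u} n} {Y : κ → Mfd.{u} n} (v : ∀ a, C.Field n (X a) →₀ R)
    (w : ∀ b, C.Field n (Y b) →₀ R) : ∀ c, C.Field n (sumFamily X Y c) →₀ R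
  | .inl a => v a
  | .inr b => w b

/-- The coefficient of a field in a juxtaposition is a product over the pieces, and a product over
`ι ⊕ κ` factors. -/
theorem juxt_sum {ι κ : Type} [Fintype ι] [Fintype κ] {X : ι → Mfd.{u} n} {Y : κ → Mfd.{u} n}
    {i : ∀ a, X a → M₁} {j : ∀ b, Y b → M₂} (hi : IsPartition i) (hj : IsPartition j)
    (v : ∀ a, C.Field n (X a) →₀ R) (w : ∀ b, C.Field n (Y b) →₀ R) :
    C.juxt (hi.sum hj) (C.sumV v w) = C.cross isPartition₂_sum (C.juxt hi v) (C.juxt hj w) := by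
  ext m
  refine (Fintype.prod_sum_type _).trans (Eq.trans ?_ (C.cross_apply _ _ _ m).symm)
  refine congrArg₂ (· * ·) (Fintype.prod_congr _ _ fun a => ?_) (Fintype.prod_congr _ _ fun b => ?_)
  · exact congrArg (v a)
      (C.res_res_eq' (hi.emb a) isPartition₂_sum.embl ((hi.sum hj).emb (.inl a)) rfl m).symm
  · exact congrArg (w b)
      (C.res_res_eq' (hj.emb b) isPartition₂_sum.embr ((hi.sum hj).emb (.inr b)) rfl m).symm

/-- The disjoint union of the two ball decompositions, with the two families of linear combinations
side by side, is blob data for the union: innermost blobs are recognized in each part separately,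
and fields are glued in each part separately. -/
theorem IsBlobDiagram.sum {K₁ : Set (Set W₁)} {K₂ : Set (Set W₂)} {s₁ : C.Field n W₁ →₀ R}
    {s₂ : C.Field n W₂ →₀ R} (h₁ : C.IsBlobDiagram K₁ s₁) (h₂ : C.IsBlobDiagram K₂ s₂) :
    C.IsBlobDiagram (W := W₁.sum W₂) (Set.image Sum.inl '' K₁ ∪ Set.image Sum.inr '' K₂)
      (C.cross isPartition₂_sum s₁ s₂) := by
  obtain ⟨d⟩ := h₁
  obtain ⟨e⟩ := h₂
  have hM := isPartition₂_sum (A := d.D.M) (E := e.D.M)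
  have hW := isPartition₂_sum (A := W₁) (E := W₂)
  have hK₁ : ∀ B ∈ K₁, B.Nonempty := fun B hB => GluingSeq.has_nonempty (d.has B hB)
  have hK₂ : ∀ B ∈ K₂, B.Nonempty := fun B hB => GluingSeq.has_nonempty (e.has B hB)
  have hl : ∀ B : Set W₁, Innermost (Set.image Sum.inl '' K₁ ∪ Set.image Sum.inr '' K₂)
      (Sum.inl '' B : Set (W₁ ⊕ W₂)) ↔ Innermost K₁ B := fun B =>
    innermost_union_iff Sum.inl_injective (fun _ _ => Sum.inl_ne_inr) hK₂
  have hr : ∀ B : Set W₂, Innermost (Set.image Sum.inl '' K₁ ∪ Set.image Sum.inr '' K₂)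
      (Sum.inr '' B : Set (W₁ ⊕ W₂)) ↔ Innermost K₂ B := fun B => by
    rw [Set.union_comm]
    exact innermost_union_iff Sum.inr_injective (fun _ _ => Sum.inr_ne_inl) hK₁
  have hrl : ∀ a, Set.range ((d.D.sum e.D).toFun (.inl a)) =
      (Sum.inl '' Set.range (d.D.toFun a) : Set (W₁ ⊕ W₂)) := fun a =>
    (congrArg Set.range (d.D.sum_toFun_inl e.D a)).trans (Set.range_comp _ _)
  have hrr : ∀ a, Set.range ((d.D.sum e.D).toFun (.inr a)) =
      (Sum.inr '' Set.range (e.D.toFun a) : Set (W₁ ⊕ W₂)) := fun a =>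
    (congrArg Set.range (d.D.sum_toFun_inr e.D a)).trans (Set.range_comp _ _)
  have hrne : ∀ a b, (Sum.inl '' Set.range (d.D.toFun a) : Set (W₁ ⊕ W₂)) ≠
      Sum.inr '' Set.range (e.D.toFun b) := fun a b h => by
    obtain ⟨x⟩ := (d.D.ball a).nonempty
    obtain ⟨y, -, hy⟩ := h.subset ⟨_, ⟨x, rfl⟩, rfl⟩
    cases hy
  -- The glued field is the pair of glued fields; `glued_iff₂` splits the condition to be checked
  -- into those of `d` and `e`.
  have hadm : ∀ (m : C.Field n (d.D.M.sum e.D.M)),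
      (∀ c, C.sumV d.v e.v c (C.res ((d.D.sum e.D).i c) ((d.D.sum e.D).part.emb c) m) ≠ 0) →
      C.Glued (d.D.sum e.D).γ.map m ((C.fieldEquiv hW).symm
        (d.g (C.res _ hM.embl m), e.g (C.res _ hM.embr m))) := by
    intro m hm
    refine (C.glued_iff₂ hM hW ⟨_, rfl⟩ ⟨d.D.γ, rfl⟩ ⟨e.D.γ, rfl⟩
      (funext fun x => congrFun (GluingSeq.sum_map e.D.γ d.D.γ) (Sum.inl x))
      (funext fun x => congrFun (GluingSeq.sum_map e.D.γ d.D.γ) (Sum.inr x)) _ _).2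
      ⟨(congrArg (C.Glued _ _) (C.res_fieldEquiv_symm_left hW _)).mpr (d.glued _ fun a => ?_),
        (congrArg (C.Glued _ _) (C.res_fieldEquiv_symm_right hW _)).mpr (e.glued _ fun a => ?_)⟩
    · exact fun h => hm (.inl a) ((congrArg (d.v a) (C.res_res_eq' (d.D.part.emb a) hM.embl
        ((d.D.sum e.D).part.emb (.inl a)) rfl m)).symm.trans h)
    · exact fun h => hm (.inr a) ((congrArg (e.v a) (C.res_res_eq' (e.D.part.emb a) hM.embr
        ((d.D.sum e.D).part.emb (.inr a)) rfl m)).symm.trans h)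
  refine ⟨
    { D := d.D.sum e.D
      has := ?_
      N := Sum.inl '' d.N ∪ Sum.inr '' e.N
      inj := ?_
      bijOn := ⟨?_, ?_, ?_⟩
      v := C.sumV d.v e.v
      null := ?_
      single := ?_
      g := fun m => (C.fieldEquiv hW).symm (d.g (C.res _ hM.embl m), e.g (C.res _ hM.embr m))
      glued := hadm
      eq := ?_ }⟩
  · rintro _ (⟨B, hB, rfl⟩ | ⟨B, hB, rfl⟩)
    · exact GluingSeq.sum_has_inl e.D.γ d.D.γ (d.has B hB)
    · exact GluingSeq.sum_has_inr (e.has B hB) d.D.γ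
  · rintro _ (⟨a, ha, rfl⟩ | ⟨a, ha, rfl⟩)
    · exact (congrArg Function.Injective (d.D.sum_toFun_inl e.D a)).mpr
        (Sum.inl_injective.comp (d.inj a ha))
    · exact (congrArg Function.Injective (d.D.sum_toFun_inr e.D a)).mpr
        (Sum.inr_injective.comp (e.inj a ha))
  · rintro _ (⟨a, ha, rfl⟩ | ⟨a, ha, rfl⟩)
    · exact (congrArg (Innermost _) (hrl a)).mpr ((hl _).2 (d.bijOn.mapsTo ha))
    · exact (congrArg (Innermost _) (hrr a)).mpr ((hr _).2 (e.bijOn.mapsTo ha))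
  · rintro _ (⟨a, ha, rfl⟩ | ⟨a, ha, rfl⟩) _ (⟨b, hb, rfl⟩ | ⟨b, hb, rfl⟩) h
    · exact congrArg _ (d.bijOn.injOn ha hb (Set.image_injective.mpr Sum.inl_injective
        ((hrl a).symm.trans (h.trans (hrl b)))))
    · exact (hrne a b ((hrl a).symm.trans (h.trans (hrr b)))).elim
    · exact (hrne b a ((hrl b).symm.trans (h.symm.trans (hrr a)))).elim
    · exact congrArg _ (e.bijOn.injOn ha hb (Set.image_injective.mpr Sum.inr_injective
        ((hrr a).symm.trans (h.trans (hrr b)))))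
  · intro B' hB'
    have hB'' := hB'
    rcases hB'.1 with ⟨B, hB, rfl⟩ | ⟨B, hB, rfl⟩
    · obtain ⟨a, ha, rfl⟩ := d.bijOn.surjOn ((hl _).1 hB'')
      exact ⟨.inl a, Or.inl ⟨a, ha, rfl⟩, hrl a⟩
    · obtain ⟨a, ha, rfl⟩ := e.bijOn.surjOn ((hr _).1 hB'')
      exact ⟨.inr a, Or.inr ⟨a, ha, rfl⟩, hrr a⟩
  · rintro _ (⟨a, ha, rfl⟩ | ⟨a, ha, rfl⟩)
    exacts [d.null a ha, e.null a ha]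
  · rintro (a | a) ha
    · exact d.single a fun h => ha (Or.inl ⟨a, h, rfl⟩)
    · exact e.single a fun h => ha (Or.inr ⟨a, h, rfl⟩)
  · refine (congrArg₂ (C.cross hW) d.eq e.eq).trans (Eq.trans ?_ <| congrArg (Finsupp.mapDomain _) (C.juxt_sum d.D.part e.D.part d.v e.v).symm)
    refine (C.mapDomain_cross hM hW (fun m _ _ => ?_) (fun m _ _ => ?_)).symm
    · exact C.res_fieldEquiv_symm_left hW _
    · exact C.res_fieldEquiv_symm_right hW _

end Sum

/-! ### Blob diagrams on a disjoint union split. -/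

section Split

variable {A B W : Mfd.{u} n} {i : A → W} {j : B → W} (h : IsPartition₂ i j)

/-- Compatibility of gluing with disjoint unions, applied to the parts of `M` over `A` and over `B`.
-/
theorem glued_iff_pullback {M : Mfd.{u} n} (γ : GluingSeq M W) (m : C.Field n M)
    (f : C.Field n W) : C.Glued γ.map m f ↔
      C.Glued (γ.pullback h.embl).map (C.res _ (γ.isPartition₂_over h).embl m)
        (C.res i h.embl f) ∧
      C.Glued (γ.pullback h.embr).map (C.res _ (γ.isPartition₂_over h).embr m)
        (C.res j h.embr f) :=
  C.glued_iff₂ (γ.isPartition₂_over h) h ⟨_, rfl⟩ ⟨_, rfl⟩ ⟨_, rfl⟩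
    (funext fun x => (γ.pullback_map h.embl x).symm)
    (funext fun x => (γ.pullback_map h.embr x).symm) m f

variable (D : BallDecomp W)

theorem res_pullback (a : D.Over i) (m : C.Field n D.M) :
    C.res ((D.pullback h.embl).i a) ((D.pullback h.embl).part.emb a)
      (C.res _ (D.γ.isPartition₂_over h).embl m) = C.res (D.i a.1) (D.part.emb a.1) m :=
  C.res_res_eq' ((D.pullback h.embl).part.emb a) (D.γ.isPartition₂_over h).embl
    (D.part.emb a.1) rfl m

/-- The product over all initial pieces is regrouped along `over_bijective` into the pieces over `A`
and those over `B`. -/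
theorem juxt_pullback (v : ∀ a, C.Field n (D.X a) →₀ R) :
    C.juxt D.part v = C.cross (D.γ.isPartition₂_over h)
      (C.juxt (D.pullback h.embl).part fun a => v a.1)
      (C.juxt (D.pullback h.embr).part fun a => v a.1) := by
  classical
  ext m
  refine Eq.trans ?_ (C.cross_apply _ _ _ m).symm
  have e := Fintype.prod_bijective _ (D.over_bijective h)
    (fun c => v (Sum.elim Subtype.val Subtype.val c) (C.res (D.i _) (D.part.emb _) m))
    (fun a => v a (C.res (D.i a) (D.part.emb a) m)) (fun _ => rfl)
  refine e.symm.trans ((Fintype.prod_sum_type _).trans (congrArg₂ (· * ·) ?_ ?_))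
  -- The index sets are the same up to the choice of `Fintype` instance, which `congr!` reconciles.
  · refine Finset.prod_congr (by congr!) fun a _ => ?_
    exact congrArg (v a.1) (C.res_pullback h D a m).symm
  · refine Finset.prod_congr (by congr!) fun a _ => ?_
    exact congrArg (v a.1) (C.res_pullback h.symm D a m).symm

variable {C D}

/-- The field glued from a field on the initial pieces over `A` and the restriction of `m₀` to the
other initial pieces. -/
noncomputable def pullbackGlue (g : C.Field n D.M → C.Field n W) (m₀ : C.Field n D.M)
    (m : C.Field n (D.pullback h.embl).M) : C.Field n A :=
  C.res i h.embl (g ((C.fieldEquiv (D.γ.isPartition₂_over h)).symm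
    (m, C.res _ (D.γ.isPartition₂_over h).embr m₀)))

/-- The map `g` is known to glue only those fields on all of `M` that have nonzero coefficients on
every piece. A field over `A` is therefore completed over `B` by the fixed field `m₀` with this
property, glued by `g`, and restricted to `A`. -/
theorem glued_pullbackGlue {v : ∀ a, C.Field n (D.X a) →₀ R} {g : C.Field n D.M → C.Field n W}
    (hg : ∀ m, (∀ a, v a (C.res (D.i a) (D.part.emb a) m) ≠ 0) → C.Glued D.γ.map m (g m))
    {m₀ : C.Field n D.M} (hm₀ : ∀ a, v a (C.res (D.i a) (D.part.emb a) m₀) ≠ 0)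
    (m : C.Field n (D.pullback h.embl).M) (hm : ∀ a : D.Over i, v a.1
      (C.res ((D.pullback h.embl).i a) ((D.pullback h.embl).part.emb a) m) ≠ 0) :
    C.Glued (D.pullback h.embl).γ.map m (pullbackGlue h g m₀ m) := by
  set m' := (C.fieldEquiv (D.γ.isPartition₂_over h)).symm
    (m, C.res _ (D.γ.isPartition₂_over h).embr m₀) with hm'
  have h1 : C.res _ (D.γ.isPartition₂_over h).embl m' = m := C.res_fieldEquiv_symm_left _ _
  have h2 : C.res _ (D.γ.isPartition₂_over h).embr m' = _ := C.res_fieldEquiv_symm_right _ _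
  have hgood : ∀ a, v a (C.res (D.i a) (D.part.emb a) m') ≠ 0 := by
    intro a
    obtain ⟨a | a, rfl⟩ := (D.over_bijective h).2 a
    · refine fun h0 => hm a (Eq.trans (congrArg (v a.1) ?_) h0)
      exact (congrArg (C.res _ ((D.pullback h.embl).part.emb a)) h1).symm.trans
        (C.res_pullback h D a m')
    · refine fun h0 => hm₀ a.1 (Eq.trans (congrArg (v a.1) ?_) h0)
      exact (C.res_pullback h.symm D a m₀).symm.trans
        ((congrArg (C.res _ ((D.pullback h.embr).part.emb a)) h2).symm.trans
          (C.res_pullback h.symm D a m'))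
  exact (congrArg (fun z => C.Glued (D.γ.pullback h.embl).map z (C.res i h.embl (g m'))) h1).mp
    ((C.glued_iff_pullback h D.γ m' (g m')).1 (hg m' hgood)).1

variable (C)

/-- By `GluingSeq.has_subset_or` every blob lies in one of the parts, so it is the image of its
preimage there. -/
theorem eq_union_of_has (h : IsPartition₂ i j) {γ : GluingSeq D.M W} {K : Set (Set W)} (hK : ∀ P ∈ K, γ.Has P) :
    K = Set.image i '' (Set.image i ⁻¹' K) ∪ Set.image j '' (Set.image j ⁻¹' K) := by
  ext P
  constructor
  · intro hP
    rcases GluingSeq.has_subset_or (hK P hP) h with hs | hs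
    · have e : i '' (i ⁻¹' P) = P := Set.image_preimage_eq_of_subset hs
      exact Or.inl ⟨i ⁻¹' P, by rwa [Set.mem_preimage, e], e⟩
    · have e : j '' (j ⁻¹' P) = P := Set.image_preimage_eq_of_subset hs
      exact Or.inr ⟨j ⁻¹' P, by rwa [Set.mem_preimage, e], e⟩
  · rintro (⟨_, hP, rfl⟩ | ⟨_, hP, rfl⟩)
    exacts [hP, hP]

theorem IsBlobDiagram.eq_union (h : IsPartition₂ i j) {K : Set (Set W)} {s : C.Field n W →₀ R}
    (hs : C.IsBlobDiagram K s) :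
    K = Set.image i '' (Set.image i ⁻¹' K) ∪ Set.image j '' (Set.image j ⁻¹' K) := by
  obtain ⟨d⟩ := hs
  exact eq_union_of_has h d.has

theorem IsBlobDiagram.nonempty {K : Set (Set W)} {s : C.Field n W →₀ R}
    (hs : C.IsBlobDiagram K s) {P : Set W} (hP : P ∈ K) : P.Nonempty := by
  obtain ⟨d⟩ := hs
  exact GluingSeq.has_nonempty (d.has P hP)

/-- Everything restricts to the part `A`: the ball decomposition, the blobs, the linear combinations
on the pieces. Only the gluing map needs a choice, namely the auxiliary field `m₀` that fills in the
pieces over the other part. -/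
theorem BlobData.pullback {K : Set (Set W)} {s : C.Field n W →₀ R} (d : C.BlobData K s)
    {m₀ : C.Field n d.D.M} (hm₀ : ∀ a, d.v a (C.res (d.D.i a) (d.D.part.emb a) m₀) ≠ 0) :
    C.IsBlobDiagram (Set.image i ⁻¹' K)
      ((C.juxt (d.D.pullback h.embl).part fun a => d.v a.1).mapDomain
        (pullbackGlue h d.g m₀)) := by
  have hinn : ∀ P : Set A, Innermost K (i '' P) ↔ Innermost (Set.image i ⁻¹' K) P := by
    intro P
    have := innermost_union_iff (K := Set.image i ⁻¹' K) (L := Set.image j ⁻¹' K) (B := P)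
      h.embl.injective h.ne
      (fun B' hB' => Set.image_nonempty.1 (GluingSeq.has_nonempty (d.has _ hB')))
    rwa [← eq_union_of_has h d.has] at this
  have hr : ∀ a : d.D.Over i, i '' Set.range ((d.D.pullback h.embl).toFun a) =
      Set.range (d.D.toFun a.1) := fun a => by
    rw [← Set.range_comp]
    exact congrArg Set.range (d.D.pullback_toFun h.embl a)
  refine ⟨
    { D := d.D.pullback h.embl
      has := fun P hP => d.D.γ.pullback_has h.embl (d.has _ hP)
      N := {a | a.1 ∈ d.N}
      inj := fun a ha => ?_
      bijOn := ⟨fun a ha => ?_, fun a ha b hb e => ?_, fun P hP => ?_⟩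
      v := fun a => d.v a.1
      null := fun a ha => d.null a.1 ha
      single := fun a ha => d.single a.1 ha
      g := pullbackGlue h d.g m₀
      glued := glued_pullbackGlue h d.glued hm₀
      eq := rfl }⟩
  · have := d.inj a.1 ha
    rw [← d.D.pullback_toFun h.embl a] at this
    exact this.of_comp
  · refine (hinn _).1 ?_
    rw [hr a]
    exact d.bijOn.mapsTo ha
  · refine Subtype.ext (d.bijOn.injOn ha hb ?_)
    exact (hr a).symm.trans ((congrArg (Set.image i) e).trans (hr b))
  · obtain ⟨a, ha, e⟩ := d.bijOn.surjOn ((hinn P).2 hP)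
    have e' : Set.range (d.D.toFun a) = i '' P := e
    -- The piece representing `i '' P` has this set as its range, so it is one of the pieces over
    -- `A`.
    have hov : ∀ x, d.D.toFun a x ∈ Set.range i := fun x =>
      Set.image_subset_range i P (e'.subset ⟨x, rfl⟩)
    refine ⟨⟨a, hov⟩, ha, Set.image_injective.mpr h.embl.injective ?_⟩
    exact (hr ⟨a, hov⟩).trans e'

/-- A blob diagram on a disjoint union is a pair of blob diagrams. -/
theorem IsBlobDiagram.split {K : Set (Set W)} {s : C.Field n W →₀ R}
    (hs : C.IsBlobDiagram K s) : s = 0 ∨ ∃ s₁ s₂, C.IsBlobDiagram (Set.image i ⁻¹' K) s₁ ∧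
      C.IsBlobDiagram (Set.image j ⁻¹' K) s₂ ∧ s = C.cross h s₁ s₂ := by
  obtain ⟨d⟩ := hs
  -- Without a field having nonzero coefficients on all pieces, the juxtaposition vanishes and `s =
  -- 0`. Otherwise such a field serves as the auxiliary `m₀` for both parts.
  by_cases hm₀ : ∃ m, ∀ a, d.v a (C.res (d.D.i a) (d.D.part.emb a) m) ≠ 0
  swap
  · left
    have : C.juxt d.D.part d.v = 0 := by
      ext m
      by_contra h
      exact hm₀ ⟨m, C.forall_ne_of_juxt_ne d.D.part h⟩
    rw [d.eq, this, Finsupp.mapDomain_zero]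
  obtain ⟨m₀, hm₀⟩ := hm₀
  refine Or.inr ⟨_, _, BlobData.pullback C h d hm₀, BlobData.pullback C h.symm d hm₀, ?_⟩
  refine d.eq.trans ((congrArg (Finsupp.mapDomain d.g) (C.juxt_pullback h d.D d.v)).trans ?_)
  -- Independence of `m₀`: the restriction of `d.g m` to a part and the field glued with the help of
  -- `m₀` are both results of gluing the same field on that part, so they agree by uniqueness.
  have key : ∀ m, C.juxt (d.D.pullback h.embl).part (fun a => d.v a.1)
        (C.res _ (d.D.γ.isPartition₂_over h).embl m) ≠ 0 →
      C.juxt (d.D.pullback h.embr).part (fun a => d.v a.1)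
        (C.res _ (d.D.γ.isPartition₂_over h).embr m) ≠ 0 →
      C.res i h.embl (d.g m) = pullbackGlue h d.g m₀ (C.res _ (d.D.γ.isPartition₂_over h).embl m) ∧
      C.res j h.embr (d.g m) =
        pullbackGlue h.symm d.g m₀ (C.res _ (d.D.γ.isPartition₂_over h).embr m) := by
    intro m h1 h2
    have hg1 := C.forall_ne_of_juxt_ne _ h1
    have hg2 := C.forall_ne_of_juxt_ne _ h2
    have hgood : ∀ a, d.v a (C.res (d.D.i a) (d.D.part.emb a) m) ≠ 0 := by
      intro a
      obtain ⟨a | a, rfl⟩ := (d.D.over_bijective h).2 a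
      · exact fun h0 => hg1 a ((congrArg (d.v a.1) (C.res_pullback h d.D a m)).trans h0)
      · exact fun h0 => hg2 a ((congrArg (d.v a.1) (C.res_pullback h.symm d.D a m)).trans h0)
    have hgl := (C.glued_iff_pullback h d.D.γ m (d.g m)).1 (d.glued m hgood)
    exact ⟨C.glued_unique le_rfl _ ⟨_, rfl⟩ hgl.1 (glued_pullbackGlue h d.glued hm₀ _ hg1),
      C.glued_unique le_rfl _ ⟨_, rfl⟩ hgl.2 (glued_pullbackGlue h.symm d.glued hm₀ _ hg2)⟩
  exact C.mapDomain_cross (d.D.γ.isPartition₂_over h) h (fun m h1 h2 => (key m h1 h2).1)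
    (fun m h1 h2 => (key m h1 h2).2)

end Split

end FieldCategory

end BlobComplex

namespace BlobComplex

open Topology TensorProduct

/-! ### Products in exterior algebras -/

section Exterior

variable {R M N M₁ M₂ : Type*} [CommRing R] [AddCommGroup M] [Module R M] [AddCommGroup N]
  [Module R N] [AddCommGroup M₁] [Module R M₁] [AddCommGroup M₂] [Module R M₂]

/-- Contraction with a linear form. -/
noncomputable abbrev contract (d : Module.Dual R M) :
    ExteriorAlgebra R M →ₗ[R] ExteriorAlgebra R M :=
  CliffordAlgebra.contractLeft (Q := (0 : QuadraticForm R M)) d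

theorem contract_ι_mul (d : Module.Dual R M) (m : M) (x : ExteriorAlgebra R M) :
    contract d (ExteriorAlgebra.ι R m * x) = d m • x - ExteriorAlgebra.ι R m * contract d x :=
  CliffordAlgebra.contractLeft_ι_mul (Q := (0 : QuadraticForm R M)) d m x

theorem contract_algebraMap (d : Module.Dual R M) (r : R) :
    contract d (algebraMap R (ExteriorAlgebra R M) r) = 0 :=
  CliffordAlgebra.contractLeft_algebraMap (Q := (0 : QuadraticForm R M)) d r

/-- An algebra map induced by `f` sends generators to generators, so contraction by `d` after it is
contraction by the pulled back form before it; the recursion `contract_ι_mul` carries the induction.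
-/
theorem contract_map (d : Module.Dual R N) (f : M →ₗ[R] N) (x : ExteriorAlgebra R M) :
    contract d (ExteriorAlgebra.map f x) = ExteriorAlgebra.map f (contract (d ∘ₗ f) x) := by
  induction x using CliffordAlgebra.left_induction with
  | algebraMap r =>
    rw [AlgHom.commutes]
    exact (contract_algebraMap _ _).trans
      (((congrArg _ (contract_algebraMap _ _)).trans (map_zero _)).symm)
  | add x y hx hy => rw [map_add, map_add, hx, hy, map_add, map_add]
  | ι_mul x m hx =>
    change contract d (ExteriorAlgebra.map f (ExteriorAlgebra.ι R m * x)) =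
      ExteriorAlgebra.map f (contract (d ∘ₗ f) (ExteriorAlgebra.ι R m * x))
    rw [map_mul, ExteriorAlgebra.map_apply_ι, contract_ι_mul, contract_ι_mul, hx, map_sub, map_mul,
      map_smul, ExteriorAlgebra.map_apply_ι]
    rfl

/-- Contraction is an antiderivation. -/
theorem contract_ιMulti_mul (d : Module.Dual R M) {k : ℕ} (v : Fin k → M)
    (y : ExteriorAlgebra R M) : contract d (ExteriorAlgebra.ιMulti R k v * y) =
      contract d (ExteriorAlgebra.ιMulti R k v) * y +
        (-1 : R) ^ k • (ExteriorAlgebra.ιMulti R k v * contract d y) := by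
  induction k with
  | zero =>
    have : contract d (1 : ExteriorAlgebra R M) = 0 := by
      rw [← map_one (algebraMap R (ExteriorAlgebra R M)), contract_algebraMap]
    simp [this]
  | succ k ih =>
    rw [ExteriorAlgebra.ιMulti_succ_apply, mul_assoc, contract_ι_mul, contract_ι_mul, ih]
    simp only [mul_add, sub_mul, mul_smul_comm, smul_mul_assoc, mul_assoc, pow_succ, mul_neg_one,
      neg_smul]
    abel

/-- The product of the images of two elements of exterior algebras. -/
noncomputable def extMul (f₁ : M₁ →ₗ[R] N) (f₂ : M₂ →ₗ[R] N) :
    ExteriorAlgebra R M₁ ⊗[R] ExteriorAlgebra R M₂ →ₗ[R] ExteriorAlgebra R N :=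
  LinearMap.mul' R (ExteriorAlgebra R N) ∘ₗ
    TensorProduct.map (ExteriorAlgebra.map f₁).toLinearMap (ExteriorAlgebra.map f₂).toLinearMap

theorem extMul_tmul (f₁ : M₁ →ₗ[R] N) (f₂ : M₂ →ₗ[R] N) (x : ExteriorAlgebra R M₁)
    (y : ExteriorAlgebra R M₂) : extMul f₁ f₂ (x ⊗ₜ y) =
      ExteriorAlgebra.map f₁ x * ExteriorAlgebra.map f₂ y := rfl

/-- The decomposition of the exterior algebra of a product. -/
theorem exists_extMul_comp (f₁ : M₁ →ₗ[R] N) (f₂ : M₂ →ₗ[R] N) (g : N →ₗ[R] M₁ × M₂)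
    (p₁ : M₁ →ₗ[R] M₁) (p₂ : M₂ →ₗ[R] M₂) (h₁ : ∀ m, g (f₁ m) = (p₁ m, 0))
    (h₂ : ∀ m, g (f₂ m) = (0, p₂ m)) :
    ∃ ρ : ExteriorAlgebra R N →ₗ[R] ExteriorAlgebra R M₁ ⊗[R] ExteriorAlgebra R M₂,
      ρ ∘ₗ extMul f₁ f₂ = TensorProduct.map (ExteriorAlgebra.map p₁).toLinearMap
        (ExteriorAlgebra.map p₂).toLinearMap := by
  let Q₁ : QuadraticForm R M₁ := 0
  let Q₂ : QuadraticForm R M₂ := 0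
  -- Exterior algebras are treated as Clifford algebras of zero forms, for which the decomposition
  -- of an orthogonal sum is available. The form `Q₁.prod Q₂` takes the value `0 + 0`, so `g` enters
  -- as an isometry into it.
  let G : (0 : QuadraticForm R N) →qᵢ Q₁.prod Q₂ := { g with map_app' := fun _ => add_zero _ }
  -- Two algebra maps out of an exterior algebra agree once they agree on vectors, where this is
  -- `h₁`.
  have e₁ : (CliffordAlgebra.map G).comp (ExteriorAlgebra.map f₁) =
      (CliffordAlgebra.map (.inl Q₁ Q₂)).comp (ExteriorAlgebra.map p₁) := by
    refine ExteriorAlgebra.hom_ext (LinearMap.ext fun m => ?_)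
    change CliffordAlgebra.map G (ExteriorAlgebra.map f₁ (ExteriorAlgebra.ι R m)) =
      CliffordAlgebra.map (.inl Q₁ Q₂) (ExteriorAlgebra.map p₁ (ExteriorAlgebra.ι R m))
    rw [ExteriorAlgebra.map_apply_ι, ExteriorAlgebra.map_apply_ι]
    refine (CliffordAlgebra.map_apply_ι _ _).trans (Eq.trans ?_ (CliffordAlgebra.map_apply_ι _ _).symm)
    exact congrArg _ (h₁ m)
  have e₂ : (CliffordAlgebra.map G).comp (ExteriorAlgebra.map f₂) =
      (CliffordAlgebra.map (.inr Q₁ Q₂)).comp (ExteriorAlgebra.map p₂) := by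
    refine ExteriorAlgebra.hom_ext (LinearMap.ext fun m => ?_)
    change CliffordAlgebra.map G (ExteriorAlgebra.map f₂ (ExteriorAlgebra.ι R m)) =
      CliffordAlgebra.map (.inr Q₁ Q₂) (ExteriorAlgebra.map p₂ (ExteriorAlgebra.ι R m))
    rw [ExteriorAlgebra.map_apply_ι, ExteriorAlgebra.map_apply_ι]
    refine (CliffordAlgebra.map_apply_ι _ _).trans (Eq.trans ?_ (CliffordAlgebra.map_apply_ι _ _).symm)
    exact congrArg _ (h₂ m)
  refine ⟨(GradedTensorProduct.of R (CliffordAlgebra.evenOdd Q₁)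
    (CliffordAlgebra.evenOdd Q₂)).symm.toLinearMap ∘ₗ
      (CliffordAlgebra.ofProd Q₁ Q₂).toLinearMap ∘ₗ (CliffordAlgebra.map G).toLinearMap, ?_⟩
  refine TensorProduct.ext' fun x y => ?_
  change (GradedTensorProduct.of R (CliffordAlgebra.evenOdd Q₁)
    (CliffordAlgebra.evenOdd Q₂)).symm (CliffordAlgebra.ofProd Q₁ Q₂ (CliffordAlgebra.map G
      (ExteriorAlgebra.map f₁ x * ExteriorAlgebra.map f₂ y))) =
    ExteriorAlgebra.map p₁ x ⊗ₜ ExteriorAlgebra.map p₂ y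
  -- By `e₁` and `e₂` the product becomes a product of an element from the first summand and one
  -- from the second, in this order; this is the value of `toProd` on a pure tensor, with no sign.
  -- The inverse `ofProd` then recovers the tensor.
  have e : CliffordAlgebra.map G (ExteriorAlgebra.map f₁ x * ExteriorAlgebra.map f₂ y) =
      CliffordAlgebra.toProd Q₁ Q₂ (GradedTensorProduct.of R (CliffordAlgebra.evenOdd Q₁)
        (CliffordAlgebra.evenOdd Q₂) (ExteriorAlgebra.map p₁ x ⊗ₜ ExteriorAlgebra.map p₂ y)) :=
    (map_mul _ _ _).trans
      (congrArg₂ (· * ·) (DFunLike.congr_fun e₁ x) (DFunLike.congr_fun e₂ y))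
  rw [e, LinearEquiv.symm_apply_eq]
  exact DFunLike.congr_fun (CliffordAlgebra.ofProd_comp_toProd Q₁ Q₂) _

/-- A basis of `M` gives the basis of ordered wedge monomials; any linear order on the index set
will do. This makes the ambient modules of blob diagrams free. -/
instance exteriorAlgebra_free [Module.Free R M] : Module.Free R (ExteriorAlgebra R M) := by
  classical
  obtain ⟨I, b⟩ := Module.Free.exists_basis R M
  let : LinearOrder I := linearOrderOfSTO WellOrderingRel
  exact Module.Free.of_basis b.ExteriorAlgebra

theorem proj_ιMulti (k l : ℕ) (v : Fin k → M) :
    GradedAlgebra.proj (fun i : ℕ => ⋀[R]^i M) l (ExteriorAlgebra.ιMulti R k v) =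
      if k = l then ExteriorAlgebra.ιMulti R k v else 0 := by
  have hm : ExteriorAlgebra.ιMulti R k v ∈ ⋀[R]^k M :=
    ExteriorAlgebra.ιMulti_range R k ⟨v, rfl⟩
  rw [GradedAlgebra.proj_apply]
  split_ifs with h
  · subst h
    exact DirectSum.decompose_of_mem_same (fun i : ℕ => ⋀[R]^i M) hm
  · exact DirectSum.decompose_of_mem_ne (fun i : ℕ => ⋀[R]^i M) hm h

/-- Over a principal ideal domain submodules of free modules are flat, so the inclusions can be
tensored one after the other without losing injectivity. -/
theorem map_subtype_injective [IsDomain R] [IsPrincipalIdealRing R] [Module.Free R M]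
    [Module.Free R N] (P : Submodule R M) (Q : Submodule R N) :
    Function.Injective (TensorProduct.map P.subtype Q.subtype) :=
  TensorProduct.map_injective_of_flat_flat _ _ P.injective_subtype Q.injective_subtype

end Exterior

end BlobComplex

namespace BlobComplex

open Topology TensorProduct

variable {n : ℕ} {R : Type u} [CommRing R]

/-! ### The product of blob diagrams -/

namespace FieldCategory

variable (C : FieldCategory.{u} R n)

section Product

variable {A B X A' B' X' : Mfd.{u} n} {i : A → X} {j : B → X} (h : IsPartition₂ i j)
  {i' : A' → X'} {j' : B' → X'} (h' : IsPartition₂ i' j')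

/-- The map on collections of subsets induced by a map of spaces. -/
noncomputable abbrev imageMap (R : Type u) [CommRing R] {α β : Type u} (f : α → β) :
    (Set α →₀ R) →ₗ[R] (Set β →₀ R) :=
  Finsupp.lmapDomain R R (Set.image f)

/-- The product of blob diagrams on the two parts of a disjoint union. -/
noncomputable def prodMap : C.Ambient A ⊗[R] C.Ambient B →ₗ[R] C.Ambient X :=
  TensorProduct.map (extMul (imageMap R i) (imageMap R j)) (C.crossEquiv h).toLinearMap ∘ₗ
    (TensorProduct.tensorTensorTensorComm R _ _ _ _).toLinearMap

theorem prodMap_tmul (x : ExteriorAlgebra R (Set A →₀ R)) (s : C.Field n A →₀ R)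
    (y : ExteriorAlgebra R (Set B →₀ R)) (t : C.Field n B →₀ R) :
    C.prodMap h ((x ⊗ₜ s) ⊗ₜ (y ⊗ₜ t)) =
      (ExteriorAlgebra.map (imageMap R i) x * ExteriorAlgebra.map (imageMap R j) y) ⊗ₜ
        C.cross h s t := rfl

/-- The product of two wedges is the wedge of the concatenated list, so the product of diagrams
lists the blobs of `A` before those of `B`. -/
theorem prodMap_diagram {p q : ℕ} (b : Fin p → Set A) (s : C.Field n A →₀ R) (c : Fin q → Set B)
    (t : C.Field n B →₀ R) : C.prodMap h (C.diagram b s ⊗ₜ C.diagram c t) =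
      C.diagram (Fin.append (Set.image i ∘ b) (Set.image j ∘ c)) (C.cross h s t) := by
  rw [diagram, diagram, prodMap_tmul, ExteriorAlgebra.map_apply_ιMulti,
    ExteriorAlgebra.map_apply_ιMulti, ExteriorAlgebra.ιMulti_mul_ιMulti, diagram]
  congr 2
  funext a
  induction a using Fin.addCases <;> simp [imageMap]

/-- Both the blob factor and the field factor of the product are natural, so on pure tensors this
comes down to the two commuting squares. -/
theorem ambientMap_prodMap {e : A ≃ₜ A'} {f : B ≃ₜ B'} {g : X ≃ₜ X'} (hi : g ∘ i = i' ∘ e)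
    (hj : g ∘ j = j' ∘ f) (x : C.Ambient A) (y : C.Ambient B) :
    C.ambientMap g (C.prodMap h (x ⊗ₜ y)) =
      C.prodMap h' (C.ambientMap e x ⊗ₜ C.ambientMap f y) := by
  induction x using TensorProduct.induction_on with
  | zero => simp
  | add x x' hx hx' => simp only [TensorProduct.add_tmul, map_add, hx, hx']
  | tmul ω s =>
    induction y using TensorProduct.induction_on with
    | zero => simp
    | add y y' hy hy' => simp only [TensorProduct.tmul_add, map_add, hy, hy']
    | tmul η t =>
      have key : ∀ {Y Y' : Mfd.{u} n} (k : Y → X) (k' : Y' → X') (e : Y ≃ₜ Y'), g ∘ k = k' ∘ e →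
          ∀ ω, ExteriorAlgebra.map (imageMap R g) (ExteriorAlgebra.map (imageMap R k) ω) =
            ExteriorAlgebra.map (imageMap R k') (ExteriorAlgebra.map (imageMap R e) ω) := by
        intro Y Y' k k' e hk ω
        have e1 : imageMap R g ∘ₗ imageMap R k = imageMap R k' ∘ₗ imageMap R e := by
          rw [imageMap, imageMap, imageMap, imageMap, ← Finsupp.lmapDomain_comp,
            ← Finsupp.lmapDomain_comp]
          congr 1
          funext S
          rw [Function.comp_apply, Function.comp_apply, ← Set.image_comp, ← Set.image_comp, hk]
        rw [← AlgHom.comp_apply, ← AlgHom.comp_apply, ExteriorAlgebra.map_comp_map,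
          ExteriorAlgebra.map_comp_map, e1]
      rw [prodMap_tmul, ambientMap, ambientMap, ambientMap, TensorProduct.map_tmul,
        TensorProduct.map_tmul, TensorProduct.map_tmul, prodMap_tmul]
      refine congrArg₂ (· ⊗ₜ[R] ·) ?_ (C.cross_res_comm h h' hi hj s t)
      refine (map_mul (ExteriorAlgebra.map (imageMap R g)) _ _).trans ?_
      exact congrArg₂ (· * ·) (key i i' e hi ω) (key j j' f hj η)

/-- The Leibniz rule, from the fact that contraction is an antiderivation. Only the first factor
must be homogeneous, because the sign is that of moving the contraction past `p` blobs. -/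
theorem differential_prodMap {p : ℕ} {x : C.Ambient A} (hx : x ∈ C.blobGroup A p)
    (y : C.Ambient B) : C.differential X (C.prodMap h (x ⊗ₜ y)) =
      C.prodMap h (C.differential A x ⊗ₜ y) +
        (-1 : R) ^ p • C.prodMap h (x ⊗ₜ C.differential B y) := by
  induction hx using Submodule.span_induction with
  | zero => simp
  | add x x' _ _ hx hx' =>
    simp only [TensorProduct.add_tmul, map_add, hx, hx', smul_add]
    abel
  | smul r x _ hx =>
    simp only [← TensorProduct.smul_tmul', map_smul, hx, smul_add]
    rw [smul_comm r]
  | mem x hx =>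
    obtain ⟨b, s, -, -, rfl⟩ := hx
    induction y using TensorProduct.induction_on with
    | zero => simp
    | add y y' hy hy' =>
      simp only [TensorProduct.tmul_add, map_add, hy, hy', smul_add]
      abel
    | tmul η t =>
      -- Image maps send subsets to subsets, so the form with value `1` on every subset pulls back
      -- to the form of the same kind.
      have hd : ∀ {Y : Mfd.{u} n} (k : Y → X),
          (Finsupp.linearCombination R fun _ : Set X => (1 : R)) ∘ₗ imageMap R k =
            Finsupp.linearCombination R fun _ : Set Y => (1 : R) := by
        intro Y k
        ext
        simp [imageMap]
      rw [diagram, differential, differential, differential, prodMap_tmul, LinearMap.rTensor_tmul,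
        LinearMap.rTensor_tmul, LinearMap.rTensor_tmul, prodMap_tmul, prodMap_tmul,
        TensorProduct.smul_tmul', ← TensorProduct.add_tmul]
      refine congrArg (· ⊗ₜ[R] C.cross h s t) ?_
      rw [ExteriorAlgebra.map_apply_ιMulti]
      refine (contract_ιMulti_mul _ _ _).trans ?_
      rw [← ExteriorAlgebra.map_apply_ιMulti, contract_map, contract_map, hd, hd]

/-! ### Recovering the factors of a product. -/

/-- Removing the empty set from a collection of subsets. -/
noncomputable def dropEmpty (R : Type u) [CommRing R] (α : Type u) :
    (Set α →₀ R) →ₗ[R] (Set α →₀ R) :=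
  open Classical in
  Finsupp.linearCombination R fun P => if P.Nonempty then Finsupp.single P 1 else 0

/-- The endomorphism of the ambient module induced by `dropEmpty`. -/
noncomputable def ambientDrop (A : Mfd.{u} n) : C.Ambient A →ₗ[R] C.Ambient A :=
  LinearMap.rTensor _ (ExteriorAlgebra.map (dropEmpty R A)).toLinearMap

/-- Blobs are nonempty, so no blob is affected by `dropEmpty`. -/
theorem ambientDrop_eq {p : ℕ} {x : C.Ambient A} (hx : x ∈ C.blobGroup A p) :
    C.ambientDrop A x = x := by
  induction hx using Submodule.span_induction with
  | zero => simp
  | add x x' _ _ hx hx' => rw [map_add, hx, hx']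
  | smul r x _ hx => rw [map_smul, hx]
  | mem x hx =>
    obtain ⟨b, s, -, hb, rfl⟩ := hx
    rw [diagram, ambientDrop, LinearMap.rTensor_tmul, AlgHom.toLinearMap_apply,
      ExteriorAlgebra.map_apply_ιMulti]
    congr 2
    funext a
    simp [dropEmpty, hb.nonempty C ⟨a, rfl⟩]

/-- The empty subsets of `A` and of `B` have the same image in `X`, so the product of the ambient
modules has in general no left inverse. For nonempty subsets the images from `A` and from `B` are
distinct, and a left inverse exists after the empty set is dropped. -/
theorem exists_prodMap_retract : ∃ ρ : C.Ambient X →ₗ[R] C.Ambient A ⊗[R] C.Ambient B,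
    ρ ∘ₗ C.prodMap h = TensorProduct.map (C.ambientDrop A) (C.ambientDrop B) := by
  classical
  -- A nonempty subset is attributed to the part that contains it; the empty set and the subsets
  -- meeting both parts are sent to zero.
  let g : (Set X →₀ R) →ₗ[R] (Set A →₀ R) × (Set B →₀ R) :=
    Finsupp.linearCombination R fun P =>
      if P.Nonempty ∧ P ⊆ Set.range i then (Finsupp.single (i ⁻¹' P) 1, 0)
      else if P.Nonempty ∧ P ⊆ Set.range j then (0, Finsupp.single (j ⁻¹' P) 1) else 0
  obtain ⟨ρ, hρ⟩ := exists_extMul_comp (imageMap R i) (imageMap R j) g (dropEmpty R A)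
    (dropEmpty R B) (fun m => by
      induction m using Finsupp.induction_linear with
      | zero => simp only [map_zero]; rfl
      | add m m' hm hm' => simp only [map_add, hm, hm', Prod.mk_add_mk, add_zero]
      | single P r =>
        by_cases hP : P.Nonempty
        · simp [g, imageMap, dropEmpty, hP, Set.preimage_image_eq _ h.embl.injective]
        · simp [g, imageMap, dropEmpty, hP]
          rfl) (fun m => by
      induction m using Finsupp.induction_linear with
      | zero => simp only [map_zero]; rfl
      | add m m' hm hm' => simp only [map_add, hm, hm', Prod.mk_add_mk, add_zero]
      | single P r =>
        by_cases hP : P.Nonempty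
        · have hne : ¬ j '' P ⊆ Set.range i := by
            intro hs
            obtain ⟨y, hy⟩ := hP
            obtain ⟨x, hx⟩ := hs ⟨y, hy, rfl⟩
            exact h.ne x y hx
          simp only [g, imageMap, dropEmpty, Finsupp.lmapDomain_apply, Finsupp.mapDomain_single,
            Finsupp.linearCombination_single, hne, and_false, if_false, Set.image_nonempty, hP,
            Set.image_subset_range, and_self, if_true, Prod.smul_mk, smul_zero,
            Set.preimage_image_eq _ h.embr.injective]
        · simp [g, imageMap, dropEmpty, hP]
          rfl)
  refine ⟨(TensorProduct.tensorTensorTensorComm R _ _ _ _).symm.toLinearMap ∘ₗ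
    TensorProduct.map ρ (C.crossEquiv h).symm.toLinearMap, ?_⟩
  refine TensorProduct.ext_fourfold' fun x s y t => ?_
  have e := LinearMap.congr_fun hρ (x ⊗ₜ y)
  rw [LinearMap.comp_apply, extMul_tmul] at e
  rw [LinearMap.comp_apply, prodMap_tmul, LinearMap.comp_apply, TensorProduct.map_tmul, e]
  have e2 : (C.crossEquiv h).symm (C.cross h s t) = s ⊗ₜ t :=
    (C.crossEquiv h).symm_apply_apply _
  simp [e2, ambientDrop]

/-- The part of the ambient module with `k` blobs. -/
noncomputable def ambientProj (A : Mfd.{u} n) (k : ℕ) : C.Ambient A →ₗ[R] C.Ambient A :=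
  LinearMap.rTensor _ (GradedAlgebra.proj (fun i : ℕ => ⋀[R]^i (Set A →₀ R)) k)

theorem ambientProj_eq {p : ℕ} {x : C.Ambient A} (hx : x ∈ C.blobGroup A p) (k : ℕ) :
    C.ambientProj A k x = if p = k then x else 0 := by
  induction hx using Submodule.span_induction with
  | zero => simp
  | add x x' _ _ hx hx' => rw [map_add, hx, hx']; split_ifs <;> simp
  | smul r x _ hx => rw [map_smul, hx]; split_ifs <;> simp
  | mem x hx =>
    obtain ⟨b, s, -, hb, rfl⟩ := hx
    rw [diagram, ambientProj, LinearMap.rTensor_tmul, proj_ιMulti]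
    split_ifs
    exacts [rfl, TensorProduct.zero_tmul _ _]

/-- The product of blob diagrams, restricted to the blob groups. -/
noncomputable def blobProdAmbient (p q : ℕ) :
    C.blobGroup A p ⊗[R] C.blobGroup B q →ₗ[R] C.Ambient X :=
  C.prodMap h ∘ₗ TensorProduct.map (C.blobGroup A p).subtype (C.blobGroup B q).subtype

/-- A product of elements of the blob groups determines its components of each bidegree. -/
theorem exists_bidegree_comp (p q : ℕ) :
    ∃ ρ : C.Ambient X →ₗ[R] C.Ambient A ⊗[R] C.Ambient B, ∀ (p' q' : ℕ)
      (x : C.blobGroup A p' ⊗[R] C.blobGroup B q'), ρ (C.blobProdAmbient h p' q' x) =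
        if p' = p ∧ q' = q then
          TensorProduct.map (C.blobGroup A p').subtype (C.blobGroup B q').subtype x else 0 := by
  obtain ⟨ρ, hρ⟩ := C.exists_prodMap_retract h
  -- The retraction undoes the product on blob groups, where `ambientDrop` is the identity; the
  -- projections then keep the tensors with `p` blobs in `A` and `q` in `B`.
  refine ⟨TensorProduct.map (C.ambientProj A p) (C.ambientProj B q) ∘ₗ ρ, fun p' q' x => ?_⟩
  induction x with
  | zero => simp
  | add x x' hx hx' => rw [map_add, map_add, hx, hx', map_add]; split_ifs <;> simp
  | tmul x y =>
    have e : ρ (C.prodMap h (x.1 ⊗ₜ y.1)) = x.1 ⊗ₜ y.1 := by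
      refine (LinearMap.congr_fun hρ _).trans ?_
      rw [TensorProduct.map_tmul, C.ambientDrop_eq x.2, C.ambientDrop_eq y.2]
    refine (congrArg (TensorProduct.map (C.ambientProj A p) (C.ambientProj B q)) e).trans ?_
    rw [TensorProduct.map_tmul, C.ambientProj_eq x.2, C.ambientProj_eq y.2]
    by_cases hp : p' = p <;> by_cases hq : q' = q <;> simp [hp, hq]

/-! ### Factoring a diagram on a disjoint union. -/

theorem exists_diagram_perm {W : Mfd.{u} n} {k : ℕ} (b : Fin k → Set W) (s : C.Field n W →₀ R)
    (σ : Equiv.Perm (Fin k)) : ∃ c : R, C.diagram b s = c • C.diagram (b ∘ σ) s := by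
  refine ⟨((Equiv.Perm.sign σ : ℤ) : R), ?_⟩
  have := (ExteriorAlgebra.ιMulti R k).map_perm (fun a => Finsupp.single (b a) (1 : R)) σ
  rw [diagram, diagram, TensorProduct.smul_tmul']
  refine congrArg (· ⊗ₜ[R] s) (Eq.trans ?_ (congrArg _ this).symm)
  -- The sign of `σ` is its own inverse, so it can be moved to the other side of `map_perm`.
  rw [Units.smul_def, ← Int.cast_smul_eq_zsmul R, smul_smul, ← Int.cast_mul, Int.units_coe_mul_self,
    Int.cast_one, one_smul]

/-- A finite list can be reordered so that the elements with a given property come first. -/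
theorem exists_sum_equiv {m : ℕ} (P : Fin m → Prop) :
    ∃ (p q : ℕ) (_ : p + q = m) (σ : Fin (p + q) ≃ Fin m),
      (∀ a, P (σ (Fin.castAdd q a))) ∧ ∀ a, ¬ P (σ (Fin.natAdd p a)) := by
  classical
  let e₁ := Fintype.equivFin {a // P a}
  let e₂ := Fintype.equivFin {a // ¬ P a}
  let σ := finSumFinEquiv.symm.trans ((e₁.symm.sumCongr e₂.symm).trans (Equiv.sumCompl P))
  refine ⟨_, _, by simpa using Fintype.card_congr σ, σ, fun a => ?_, fun a => ?_⟩
  · simpa [σ] using (e₁.symm a).2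
  · simpa [σ] using (e₂.symm a).2

/-- A blob diagram on a disjoint union is a product of blob diagrams. -/
theorem exists_prodMap_eq {m : ℕ} {b : Fin m → Set X} {s : C.Field n X →₀ R}
    (hb : Function.Injective b) (hs : C.IsBlobDiagram (Set.range b) s) :
    ∃ (p q : ℕ) (_ : p + q = m) (x : C.blobGroup A p ⊗[R] C.blobGroup B q),
      C.blobProdAmbient h p q x = C.diagram b s := by
  obtain rfl | ⟨s₁, s₂, h₁, h₂, rfl⟩ := hs.split C h
  -- A diagram with `s = 0` is zero and can be assigned to any bidegree.
  · exact ⟨m, 0, rfl, 0, by simp [diagram]⟩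
  -- The blobs are sorted so that those in `A` come first; by `eq_union` the remaining ones lie in
  -- `B`.
  obtain ⟨p, q, rfl, σ, hp, hq⟩ := exists_sum_equiv fun a => b a ∈ Set.range (Set.image i)
  choose b₁ hb₁ using hp
  have hq' : ∀ a, b (σ (Fin.natAdd p a)) ∈ Set.range (Set.image j) := by
    intro a
    have : b (σ (Fin.natAdd p a)) ∈ Set.range b := ⟨_, rfl⟩
    rw [hs.eq_union C h] at this
    rcases this with ⟨P, -, hP⟩ | ⟨P, -, hP⟩
    · exact (hq a ⟨P, hP⟩).elim
    · exact ⟨P, hP⟩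
  choose b₂ hb₂ using hq'
  have hbσ : b ∘ σ = Fin.append (Set.image i ∘ b₁) (Set.image j ∘ b₂) := by
    funext a
    induction a using Fin.addCases <;> simp [hb₁, hb₂]
  have hinj : ∀ k : Fin (p + q), ∀ k', b (σ k) = b (σ k') → k = k' := fun k k' e =>
    σ.injective (hb e)
  have hb₁' : Function.Injective b₁ := fun a a' e =>
    Fin.castAdd_injective _ _ (hinj _ _ (by rw [← hb₁, ← hb₁, e]))
  have hb₂' : Function.Injective b₂ := fun a a' e =>
    Fin.natAdd_injective _ _ (hinj _ _ (by rw [← hb₂, ← hb₂, e]))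
  -- The sorted lists exhaust the blobs on each side, so the two diagrams given by `split` have
  -- precisely `b₁` and `b₂` as their blobs.
  have hr₁ : Set.range b₁ = Set.image i ⁻¹' Set.range b := by
    ext P
    constructor
    · rintro ⟨a, rfl⟩
      exact ⟨_, (hb₁ a).symm⟩
    · rintro ⟨k, hk⟩
      obtain ⟨k, rfl⟩ := σ.surjective k
      induction k using Fin.addCases with
      | left a =>
        exact ⟨a, Set.image_injective.mpr h.embl.injective ((hb₁ a).trans hk)⟩
      | right a => exact (hq a ⟨P, hk.symm⟩).elim
  have hr₂ : Set.range b₂ = Set.image j ⁻¹' Set.range b := by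
    ext P
    constructor
    · rintro ⟨a, rfl⟩
      exact ⟨_, (hb₂ a).symm⟩
    · rintro ⟨k, hk⟩
      -- A point of the blob is needed to see that it is not also the image of a subset of `A`.
      obtain ⟨y, hy⟩ := Set.image_nonempty.1 (hs.nonempty C ⟨k, hk⟩)
      obtain ⟨k, rfl⟩ := σ.surjective k
      induction k using Fin.addCases with
      | left a =>
        obtain ⟨x, -, hx⟩ := ((hb₁ a).trans hk).superset ⟨y, hy, rfl⟩
        exact (h.ne x y hx).elim
      | right a =>
        exact ⟨a, Set.image_injective.mpr h.embr.injective ((hb₂ a).trans hk)⟩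
  rw [← hr₁] at h₁
  rw [← hr₂] at h₂
  let x₁ : C.blobGroup A p := ⟨_, Submodule.subset_span ⟨b₁, s₁, hb₁', h₁, rfl⟩⟩
  let x₂ : C.blobGroup B q := ⟨_, Submodule.subset_span ⟨b₂, s₂, hb₂', h₂, rfl⟩⟩
  obtain ⟨r, hr⟩ := C.exists_diagram_perm b (C.cross h s₁ s₂) σ
  refine ⟨p, q, rfl, r • (x₁ ⊗ₜ x₂), ?_⟩
  have e : C.blobProdAmbient h p q (x₁ ⊗ₜ x₂) = C.diagram (b ∘ σ) (C.cross h s₁ s₂) :=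
    (C.prodMap_diagram h b₁ s₁ b₂ s₂).trans (by rw [hbσ])
  rw [hr, ← e, map_smul]

end Product

/-! ### The product of blob groups. -/

section Sum

variable (A B : Mfd.{u} n)

/-- By bilinearity it is enough to multiply generators, and their product is again a generator by
`IsBlobDiagram.sum`. The degree `m` is kept apart from `p + q` to match the indexing of the summands
of a tensor product of complexes. -/
theorem blobProdAmbient_mem {p q m : ℕ} (hm : p + q = m)
    (x : C.blobGroup A p ⊗[R] C.blobGroup B q) :
    C.blobProdAmbient (isPartition₂_sum (A := A) (E := B)) p q x ∈ C.blobGroup (A.sum B) m := by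
  subst hm
  induction x with
  | zero => rw [map_zero]; exact Submodule.zero_mem _
  | add x y hx hy => rw [map_add]; exact Submodule.add_mem _ hx hy
  | tmul x y =>
    obtain ⟨x, hx⟩ := x
    obtain ⟨y, hy⟩ := y
    change C.prodMap (isPartition₂_sum (A := A) (E := B)) (x ⊗ₜ y) ∈ _
    induction hx using Submodule.span_induction with
    | zero => rw [TensorProduct.zero_tmul, map_zero]; exact Submodule.zero_mem _
    | add x x' _ _ hx hx' =>
      rw [TensorProduct.add_tmul, map_add]; exact Submodule.add_mem _ hx hx'
    | smul r x _ hx =>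
      rw [← TensorProduct.smul_tmul', map_smul]; exact Submodule.smul_mem _ _ hx
    | mem x hx =>
      obtain ⟨b, s, hb, hs, rfl⟩ := hx
      induction hy using Submodule.span_induction with
      | zero => rw [TensorProduct.tmul_zero, map_zero]; exact Submodule.zero_mem _
      | add y y' _ _ hy hy' =>
        rw [TensorProduct.tmul_add, map_add]; exact Submodule.add_mem _ hy hy'
      | smul r y _ hy =>
        rw [TensorProduct.tmul_smul, map_smul]; exact Submodule.smul_mem _ _ hy
      | mem y hy =>
        obtain ⟨c, t, hc, ht, rfl⟩ := hy
        refine (congrArg (· ∈ C.blobGroup (A.sum B) (p + q))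
          (C.prodMap_diagram isPartition₂_sum b s c t)).mpr ?_
        have hinl : Function.Injective (Set.image (Sum.inl : A → A ⊕ B)) :=
          Set.image_injective.mpr Sum.inl_injective
        have hinr : Function.Injective (Set.image (Sum.inr : B → A ⊕ B)) :=
          Set.image_injective.mpr Sum.inr_injective
        refine Submodule.subset_span ⟨_, _, ?_, ?_, rfl⟩
        · refine Fin.append_injective_iff.2 ⟨hinl.comp hb, hinr.comp hc, fun a a' e => ?_⟩
          -- A left and a right blob could only coincide if both were empty.
          obtain ⟨x, hx⟩ := hs.nonempty C ⟨a, rfl⟩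
          obtain ⟨y, -, hy⟩ := e.subset ⟨x, hx, rfl⟩
          cases hy
        · have := IsBlobDiagram.sum C hs ht
          rw [← Set.range_comp, ← Set.range_comp] at this
          refine Eq.mp (congrArg (fun K => C.IsBlobDiagram K _) ?_) this
          refine Set.Subset.antisymm ?_ ?_
          · rintro _ (⟨a, rfl⟩ | ⟨a, rfl⟩)
            exacts [⟨_, Fin.append_left _ _ a⟩, ⟨_, Fin.append_right _ _ a⟩]
          · rintro _ ⟨k, rfl⟩
            induction k using Fin.addCases with
            | left a => exact Or.inl ⟨a, (Fin.append_left _ _ a).symm⟩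
            | right a => exact Or.inr ⟨a, (Fin.append_right _ _ a).symm⟩

/-- The product `B_p(A) ⊗ B_q(B) → B_m(A ⊔ B)`, for `p + q = m`. -/
noncomputable def blobProd {p q m : ℕ} (hm : p + q = m) :
    C.blobGroup A p ⊗[R] C.blobGroup B q →ₗ[R] C.blobGroup (A.sum B) m :=
  (C.blobProdAmbient isPartition₂_sum p q).codRestrict _ (C.blobProdAmbient_mem A B hm)

end Sum

end FieldCategory

end BlobComplex

namespace BlobComplex

open Topology TensorProduct

/-! ### The isomorphism of chain complexes -/

/-! ### Elements of a tensor product of complexes. -/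

section TensorComplex

open MonoidalCategory HomologicalComplex

variable {R : Type u} [CommRing R]

/-- The pairs of natural numbers with sum `m`. -/
abbrev Bidegree (m : ℕ) : Type := {a : ℕ × ℕ // a ∈ Finset.HasAntidiagonal.antidiagonal m}

theorem Bidegree.add_eq {m : ℕ} (a : Bidegree m) : a.1.1 + a.1.2 = m :=
  Finset.HasAntidiagonal.mem_antidiagonal.1 a.2

/-- Every element of a tensor product of complexes is a sum of elements of the summands. -/
theorem exists_sum_ιTensorObj (K L : ChainComplex (ModuleCat.{u} R) ℕ) (m : ℕ)
    (x : (HomologicalComplex.tensorObj K L).X m) :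
    ∃ z : ∀ a : Bidegree m, (K.X a.1.1 ⊗ L.X a.1.2 : ModuleCat.{u} R),
      x = ∑ a : Bidegree m, (ιTensorObj K L a.1.1 a.1.2 m a.add_eq).hom (z a) := by
  classical
  let S : (∀ a : Bidegree m, (K.X a.1.1 ⊗ L.X a.1.2 : ModuleCat.{u} R)) →ₗ[R]
      (HomologicalComplex.tensorObj K L).X m :=
    ∑ a : Bidegree m, (ιTensorObj K L a.1.1 a.1.2 m a.add_eq).hom ∘ₗ LinearMap.proj a
  have hS : ∀ z, S z =
      ∑ a : Bidegree m, (ιTensorObj K L a.1.1 a.1.2 m a.add_eq).hom (z a) := fun z => by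
    simp [S]
  -- The quotient map by the span of all summands vanishes on each summand, hence is zero by the
  -- universal property; so the summands span.
  have h0 : ModuleCat.ofHom (LinearMap.range S).mkQ = 0 := by
    refine mapBifunctor.hom_ext fun p q hpq => ModuleCat.hom_ext (LinearMap.ext fun y => ?_)
    refine (Submodule.Quotient.mk_eq_zero _).2 ⟨Pi.single
      (⟨(p, q),
        Finset.HasAntidiagonal.mem_antidiagonal.2 hpq⟩ : Bidegree m) y, ?_⟩
    rw [hS, Finset.sum_eq_single
      (⟨(p, q),
        Finset.HasAntidiagonal.mem_antidiagonal.2 hpq⟩ : Bidegree m)]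
    · rw [Pi.single_eq_same]
      rfl
    · intro b _ hb
      rw [Pi.single_eq_of_ne hb, map_zero]
    · simp
  have hx : (LinearMap.range S).mkQ x = 0 := congrArg (fun f => f.hom x) h0
  obtain ⟨z, hz⟩ := (Submodule.Quotient.mk_eq_zero _).1 hx
  exact ⟨z, hz.symm.trans (hS z)⟩

end TensorComplex

/-! ### The product map of blob complexes. -/

namespace FieldCategory

open MonoidalCategory HomologicalComplex

variable {n : ℕ} {R : Type u} [CommRing R] (C : FieldCategory.{u} R n)

/-- Contraction kills scalars. This accounts for the edges of the double complex, where the tensor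
product has no differential although the Leibniz rule on the ambient modules still has a term. -/
theorem differential_eq_zero {W : Mfd.{u} n} {x : C.Ambient W} (hx : x ∈ C.blobGroup W 0) :
    C.differential W x = 0 := by
  induction hx using Submodule.span_induction with
  | zero => simp
  | add x x' _ _ hx hx' => rw [map_add, hx, hx', add_zero]
  | smul r x _ hx => rw [map_smul, hx, smul_zero]
  | mem x hx =>
    obtain ⟨b, s, -, -, rfl⟩ := hx
    rw [diagram, differential, LinearMap.rTensor_tmul, ExteriorAlgebra.ιMulti_zero_apply]
    refine (congrArg (· ⊗ₜ[R] s) (CliffordAlgebra.contractLeft_one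
      (Q := (0 : QuadraticForm R (Set W →₀ R))) _)).trans (TensorProduct.zero_tmul _ _)

theorem blobComplex_d_apply (W : Mfd.{u} n) (k : ℕ) (x : C.blobGroup W (k + 1)) :
    (((C.blobComplex W).d (k + 1) k).hom x : C.blobGroup W k).1 = C.differential W x.1 := by
  have e : (C.blobComplex W).d (k + 1) k = ModuleCat.ofHom (C.d W k) := by
    simp only [blobComplex, ChainComplex.of_d]
  exact congrArg (fun f => (f.hom x : C.blobGroup W k).1) e

variable (A B : Mfd.{u} n)

/-- The product of blob diagrams, as a map of modules. -/
noncomputable def blobProdMor {p q m : ℕ} (hpq : p + q = m) :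
    ((C.blobComplex A).X p ⊗ (C.blobComplex B).X q : ModuleCat.{u} R) ⟶
      (C.blobComplex (A.sum B)).X m :=
  ModuleCat.ofHom (X := (ModuleCat.of R (C.blobGroup A p) ⊗ ModuleCat.of R (C.blobGroup B q) :
    ModuleCat.{u} R)) (Y := C.blobGroup (A.sum B) m) (C.blobProd A B hpq)

/-- The components of the product map. -/
noncomputable def blobProdX (m : ℕ) :
    (HomologicalComplex.tensorObj (C.blobComplex A) (C.blobComplex B)).X m ⟶
      (C.blobComplex (A.sum B)).X m :=
  mapBifunctorDesc fun p q hpq => C.blobProdMor A B (p := p) (q := q) (m := m) hpq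

theorem ι_blobProdX (p q m : ℕ) (hpq : p + q = m) :
    ιTensorObj (C.blobComplex A) (C.blobComplex B) p q m hpq ≫ C.blobProdX A B m =
      C.blobProdMor A B hpq :=
  ι_mapBifunctorDesc _ _ _ _

/-- The first term of the Leibniz rule. For `p = 0` both sides vanish; otherwise the sign `ε₁` is
trivial. -/
theorem d₁_blobProdX (p q m : ℕ) (hpq : p + q = m + 1) (x : C.blobGroup A p)
    (y : C.blobGroup B q) :
    ((mapBifunctor.d₁ (C.blobComplex A) (C.blobComplex B) (curriedTensor _) (ComplexShape.down ℕ)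
      p q m ≫ C.blobProdX A B m).hom (x ⊗ₜ[R] y) : C.blobGroup (A.sum B) m).1 =
      C.prodMap (isPartition₂_sum (A := A) (E := B)) (C.differential A x.1 ⊗ₜ y.1) := by
  cases p with
  | zero =>
    rw [mapBifunctor.d₁_eq_zero _ _ _ _ _ _ _ (by simp), Limits.zero_comp,
      C.differential_eq_zero x.2, TensorProduct.zero_tmul, map_zero]
    rfl
  | succ p =>
    have hpq' : p + q = m := by omega
    rw [mapBifunctor.d₁_eq _ _ _ _ (show (ComplexShape.down ℕ).Rel (p + 1) p from rfl) _ _ hpq']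
    have e : ComplexShape.ε₁ (ComplexShape.down ℕ) (ComplexShape.down ℕ) (ComplexShape.down ℕ)
      (p + 1, q) = 1 := rfl
    rw [e, one_smul, Category.assoc]
    refine (congrArg (fun f => (f.hom ((((C.blobComplex A).d (p + 1) p).hom x) ⊗ₜ[R] y) :
      C.blobGroup (A.sum B) m).1) (C.ι_blobProdX A B p q m hpq')).trans ?_
    refine congrArg (fun z => C.prodMap (isPartition₂_sum (A := A) (E := B)) (z ⊗ₜ y.1)) ?_
    exact C.blobComplex_d_apply A p x

/-- The second term of the Leibniz rule. For `q = 0` both sides vanish; otherwise `ε₂` contributes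
the sign. -/
theorem d₂_blobProdX (p q m : ℕ) (hpq : p + q = m + 1) (x : C.blobGroup A p)
    (y : C.blobGroup B q) :
    ((mapBifunctor.d₂ (C.blobComplex A) (C.blobComplex B) (curriedTensor _) (ComplexShape.down ℕ)
      p q m ≫ C.blobProdX A B m).hom (x ⊗ₜ[R] y) : C.blobGroup (A.sum B) m).1 =
      (-1 : R) ^ p •
        C.prodMap (isPartition₂_sum (A := A) (E := B)) (x.1 ⊗ₜ C.differential B y.1) := by
  cases q with
  | zero =>
    rw [mapBifunctor.d₂_eq_zero _ _ _ _ _ _ _ (by simp), Limits.zero_comp,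
      C.differential_eq_zero y.2, TensorProduct.tmul_zero, map_zero, smul_zero]
    rfl
  | succ q =>
    have hpq' : p + q = m := by omega
    rw [mapBifunctor.d₂_eq _ _ _ _ _ (show (ComplexShape.down ℕ).Rel (q + 1) q from rfl) _ hpq']
    have e : ComplexShape.ε₂ (ComplexShape.down ℕ) (ComplexShape.down ℕ) (ComplexShape.down ℕ)
      (p, q + 1) = (-1) ^ p := rfl
    -- In the tensor complex the sign is a unit of `ℤ`, in the Leibniz rule an element of `R`.
    have e2 : ∀ v : C.Ambient (A.sum B), ((-1 : ℤˣ) ^ p) • v = (-1 : R) ^ p • v := fun v => by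
      rw [Units.smul_def, ← Int.cast_smul_eq_zsmul R]
      simp
    rw [e, Linear.units_smul_comp, Category.assoc]
    refine Eq.trans ?_ (e2 _)
    refine congrArg (fun v : C.Ambient (A.sum B) => ((-1 : ℤˣ) ^ p) • v) ?_
    refine (congrArg (fun f => (f.hom (x ⊗ₜ[R] (((C.blobComplex B).d (q + 1) q).hom y)) :
      C.blobGroup (A.sum B) m).1) (C.ι_blobProdX A B p q m hpq')).trans ?_
    refine congrArg (fun z => C.prodMap (isPartition₂_sum (A := A) (E := B)) (x.1 ⊗ₜ z)) ?_
    exact C.blobComplex_d_apply B q y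

/-- The product map is a map of chain complexes. -/
noncomputable def blobProdHom :
    (C.blobComplex A ⊗ C.blobComplex B : ChainComplex (ModuleCat.{u} R) ℕ) ⟶
      C.blobComplex (A.sum B) where
  f m := C.blobProdX A B m
  comm' := by
    rintro _ m rfl
    -- Equality of morphisms is tested on pure tensors in each summand and, since blob groups are
    -- submodules, in the ambient module of the union.
    refine mapBifunctor.hom_ext fun p q hpq => ModuleCat.hom_ext (TensorProduct.ext' fun x y => ?_)
    refine Subtype.ext ?_
    have e₁ : ιTensorObj (C.blobComplex A) (C.blobComplex B) p q (m + 1) hpq ≫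
        C.blobProdX A B (m + 1) ≫ (C.blobComplex (A.sum B)).d (m + 1) m =
        C.blobProdMor A B hpq ≫ (C.blobComplex (A.sum B)).d (m + 1) m := by
      rw [← Category.assoc, ι_blobProdX]
    have e₂ : ιTensorObj (C.blobComplex A) (C.blobComplex B) p q (m + 1) hpq ≫
        (HomologicalComplex.tensorObj (C.blobComplex A) (C.blobComplex B)).d (m + 1) m ≫
          C.blobProdX A B m =
        mapBifunctor.d₁ (C.blobComplex A) (C.blobComplex B) (curriedTensor _)
          (ComplexShape.down ℕ) p q m ≫ C.blobProdX A B m +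
        mapBifunctor.d₂ (C.blobComplex A) (C.blobComplex B) (curriedTensor _)
          (ComplexShape.down ℕ) p q m ≫ C.blobProdX A B m := by
      rw [mapBifunctor.d_eq, Preadditive.add_comp, Preadditive.comp_add,
        mapBifunctor.ι_D₁_assoc, mapBifunctor.ι_D₂_assoc]
    refine (congrArg (fun f => (f.hom (x ⊗ₜ[R] y) : C.blobGroup (A.sum B) m).1)
      e₁).trans (Eq.trans ?_ (congrArg (fun f => (f.hom (x ⊗ₜ[R] y) : C.blobGroup (A.sum B) m).1)
        e₂).symm)
    refine (C.blobComplex_d_apply (A.sum B) m (C.blobProd A B hpq (x ⊗ₜ y))).trans ?_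
    refine (C.differential_prodMap isPartition₂_sum x.2 y.1).trans ?_
    exact (congrArg₂ (· + ·) (C.d₁_blobProdX A B p q m hpq x y)
      (C.d₂_blobProdX A B p q m hpq x y)).symm

/-- Diagrams generate, and each of them is a product from a single bidegree by `exists_prodMap_eq`.
-/
theorem blobProdX_surjective (m : ℕ) : Function.Surjective (C.blobProdX A B m).hom := by
  rw [← LinearMap.range_eq_top, eq_top_iff]
  rintro ⟨x, hx⟩ -
  suffices h : x ∈ (LinearMap.range (C.blobProdX A B m).hom).map (C.blobGroup (A.sum B) m).subtype by
    obtain ⟨y, hy, e⟩ := h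
    have e' : y = ⟨x, hx⟩ := Subtype.ext e
    exact e' ▸ hy
  refine Submodule.span_le.2 ?_ hx
  rintro _ ⟨b, s, hb, hs, rfl⟩
  obtain ⟨p, q, hpq, z, hz⟩ := C.exists_prodMap_eq (isPartition₂_sum (A := A) (E := B)) hb hs
  refine ⟨C.blobProd A B hpq z, ⟨(ιTensorObj (C.blobComplex A) (C.blobComplex B) p q m hpq).hom z,
    ?_⟩, hz⟩
  exact congrArg (fun f => f.hom z) (C.ι_blobProdX A B p q m hpq)

/-- An element of the kernel is written as a sum over bidegrees. The map from `exists_bidegree_comp`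
isolates one of its terms inside the tensor product of the ambient modules, and
`map_subtype_injective` shows that this term is zero before the inclusion. -/
theorem blobProdX_injective [IsDomain R] [IsPrincipalIdealRing R] (m : ℕ) :
    Function.Injective (C.blobProdX A B m).hom := by
  classical
  rw [injective_iff_map_eq_zero]
  intro x hx
  obtain ⟨z, rfl⟩ := exists_sum_ιTensorObj _ _ m x
  have hsum : ∑ a : Bidegree m,
      C.blobProdAmbient (isPartition₂_sum (A := A) (E := B)) a.1.1 a.1.2 (z a) = 0 := by
    rw [map_sum] at hx
    refine Eq.trans ?_ (congrArg (C.blobGroup (A.sum B) m).subtype hx)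
    refine Eq.trans ?_ (map_sum _ _ _).symm
    refine Finset.sum_congr rfl fun a _ => ?_
    exact (congrArg (fun f => (f.hom (z a) : C.blobGroup (A.sum B) m).1)
      (C.ι_blobProdX A B a.1.1 a.1.2 m a.add_eq)).symm
  refine Finset.sum_eq_zero fun a _ => ?_
  obtain ⟨ρ, hρ⟩ := C.exists_bidegree_comp (isPartition₂_sum (A := A) (E := B)) a.1.1 a.1.2
  have h0 : TensorProduct.map (C.blobGroup A a.1.1).subtype (C.blobGroup B a.1.2).subtype (z a) =
      0 := by
    have h1 := congrArg ρ hsum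
    rw [map_sum, map_zero] at h1
    rw [← h1]
    refine Eq.trans ?_ (Finset.sum_congr rfl fun b _ => (hρ b.1.1 b.1.2 (z b)).symm)
    -- All other bidegrees are killed by `ρ`, so the vanishing sum reduces to the term at `a`.
    refine Eq.trans ?_ (Finset.sum_eq_single a (fun b _ hb => if_neg fun e => hb
      (Subtype.ext (Prod.ext e.1 e.2))) (by simp)).symm
    exact (if_pos ⟨rfl, rfl⟩).symm
  have hz : z a = 0 := map_subtype_injective _ _ (h0.trans (map_zero _).symm)
  rw [hz, map_zero]

/-- The product map is an isomorphism of chain complexes. -/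
noncomputable def blobProdIso [IsDomain R] [IsPrincipalIdealRing R] :
    (C.blobComplex A ⊗ C.blobComplex B : ChainComplex (ModuleCat.{u} R) ℕ) ≅
      C.blobComplex (A.sum B) :=
  have : ∀ m, IsIso ((C.blobProdHom A B).f m) := fun m =>
    (ConcreteCategory.isIso_iff_bijective _).2
      ⟨C.blobProdX_injective A B m, C.blobProdX_surjective A B m⟩
  have := Hom.isIso_of_components (C.blobProdHom A B)
  asIso (C.blobProdHom A B)

/-- On pure tensors in each summand this is `ambientMap_prodMap` for the homeomorphism of the
disjoint union, whose two commuting squares hold by definition. -/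
theorem blobProdHom_naturality {A A' B B' : Mfd.{u} n} (e : A ⟶ A') (f : B ⟶ B') :
    HomologicalComplex.tensorHom (C.blobFunctor.map e) (C.blobFunctor.map f) ≫ C.blobProdHom A' B' =
      C.blobProdHom A B ≫ C.blobFunctor.map ((disjointUnion n).map
        (show (A, B) ⟶ (A', B') from (e, f))) := by
  refine HomologicalComplex.hom_ext _ _ fun m => mapBifunctor.hom_ext fun p q hpq =>
    ModuleCat.hom_ext (TensorProduct.ext' fun x y => Subtype.ext ?_)
  have e₁ : ιTensorObj (C.blobComplex A) (C.blobComplex B) p q m hpq ≫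
      (HomologicalComplex.tensorHom (C.blobFunctor.map e) (C.blobFunctor.map f)).f m ≫
        C.blobProdX A' B' m =
      (((C.blobFunctor.map e).f p) ⊗ₘ ((C.blobFunctor.map f).f q)) ≫
        C.blobProdMor A' B' hpq := by
    rw [← ι_blobProdX]
    refine (ι_mapBifunctorMap_assoc _ _ _ _ _ _ _ hpq _).trans ?_
    rw [MonoidalCategory.tensorHom_def]
    rfl
  have e₂ : ιTensorObj (C.blobComplex A) (C.blobComplex B) p q m hpq ≫ C.blobProdX A B m ≫
      (C.blobFunctor.map ((disjointUnion n).map (show (A, B) ⟶ (A', B') from (e, f)))).f m =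
      C.blobProdMor A B hpq ≫
      (C.blobFunctor.map ((disjointUnion n).map (show (A, B) ⟶ (A', B') from (e, f)))).f m := by
    exact (Category.assoc _ _ _).symm.trans (congrArg (· ≫ _) (C.ι_blobProdX A B p q m hpq))
  refine (congrArg (fun f => (f.hom (x ⊗ₜ[R] y) : C.blobGroup (A'.sum B') m).1)
    e₁).trans (Eq.trans ?_ (congrArg (fun f => (f.hom (x ⊗ₜ[R] y) : C.blobGroup (A'.sum B') m).1)
        e₂).symm)
  exact (C.ambientMap_prodMap (e := e) (f := f)
    (g := (Homeomorph.sumCongr e f : (A.sum B : Mfd.{u} n) ≃ₜ (A'.sum B' : Mfd.{u} n)))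
    isPartition₂_sum isPartition₂_sum rfl rfl x.1 y.1).symm

end FieldCategory

end BlobComplex

theorem mainTheorem11 {R : Type u} [CommRing R] [IsDomain R] [IsPrincipalIdealRing R]
    {n : ℕ} (C : BlobComplex.FieldCategory.{u} R n) :
    Nonempty (BlobComplex.disjointUnion.{u} n ⋙ C.blobFunctor ≅
      C.blobFunctor.prod C.blobFunctor ⋙
        CategoryTheory.MonoidalCategory.tensor (ChainComplex (ModuleCat.{u} R) ℕ)) := by
  -- The product map goes from the tensor product to the disjoint union, hence the inverse.
  refine ⟨(NatIso.ofComponents (fun p => C.blobProdIso p.1 p.2) ?_).symm⟩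
  intro p q f
  exact C.blobProdHom_naturality f.1 f.2
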